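/- **Theorem (Initial data in weighted Lebesgue spaces).** For $\gamma\ge 0$ and $1\le q\le\infty$ let $L^q_\gamma(\mathbb R^N)$ be the space of measurable $f:\mathbb R^N\to\mathbb R$ (modulo null sets) with $\|f\|_{L^q_\gamma}:=\||\cdot|^\gamma f\|_{L^q(\mathbb R^N)}<\infty$. Let $N\ge 1$ be an integer, $\alpha>0$, $0<\gamma<N$, $\gamma<2/\alpha$, and let $q\in(1,\infty]$ satisfy $$\frac1q+\frac{\gamma}{N}<1,\qquad \frac{N\alpha}{2q}+\frac{\alpha\gamma}{2}<1$$ (with $1/\infty=0$). Consider the Cauchy problem $\partial_t u=\Delta u+|u|^\alpha u$ on $(0,T)\times\mathbb R^N$, $u(0)=u_0\in L^q_\gamma(\mathbb R^N)$. Put $r=(\alpha+1)q$, $\nu=\gamma/(\alpha+1)$, $\beta=\frac N2\left(\frac1q-\frac1r\right)+\frac{\nu\alpha}{2}$. A solution on $[0,T]$ with data $u_0$ is a function $u$ such that $u\in C([0,T];L^q_\gamma)$ with $u(0)=u_0$ if $q<\infty$, respectively $u\in C((0,T];L^\infty_\gamma)$ with $\lim_{t\to0}\|u(t)-e^{t\Delta}u_0\|_{L^\infty_\gamma}=0$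 if $q=\infty$; moreover $u\in C((0,T];L^r_\nu)$, the quantity $t^\beta\|u(t)\|_{L^r_\nu}$ is bounded on $(0,T]$, and $$u(t)=e^{t\Delta}u_0+\int_0^t e^{(t-\sigma)\Delta}\big[|u(\sigma)|^\alpha u(\sigma)\big]\,d\sigma,\qquad 0<t\le T,$$ where $e^{t\Delta}$ is convolution with the Gauss kernel $(4\pi t)^{-N/2}e^{-|x|^2/(4t)}$. For $0<T\le\infty$, a solution on $[0,T)$ is a function that is a solution on $[0,S]$ for every $0<S<T$; it is maximal, with existence time $T$, if it does not extend to a solution on a strictly longer interval $[0,T')$. Then there is a constant $C=C(\alpha,q,\gamma,N)>0$ such that for every $\varphi\in L^q_\gamma(\mathbb R^N)$ (possibly singular and sign-changing) and every $\lambda>0$ the problem with $u_0=\lambda\varphi$ has a unique maximal solution, and its existence time $T_{\max}(\lambda\varphi)\in(0,\infty]$ satisfies $$T_{\max}(\lambda\varphi)\ \ge\ \frac{C}{\left(\lambda\|\varphi\|_{L^q_\gamma}\right)^{\left(\frac1\alpha-\frac{N}{2q}-\frac\gamma2\right)^{-1}}},$$ where the right-hand side is $\infty$ if $\varphi=0$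 almost everywhere. -/

import Mathlib

open MeasureTheory Filter Topology Set
open scoped ENNReal

noncomputable section

namespace WeightedHeat

/-- The norm `‖f‖_{L^q_γ} = ‖ |·|^γ f ‖_{L^q}` on `ℝ^N` (with value `∞` allowed). -/
def wNorm {N : ℕ} (γ : ℝ) (q : ℝ≥0∞) (f : EuclideanSpace ℝ (Fin N) → ℝ) : ℝ≥0∞ :=
  eLpNorm (fun x => ‖x‖ ^ γ * f x) q volume

/-- `f` belongs to the weighted Lebesgue space `L^q_γ(ℝ^N)`. -/
def MemW {N : ℕ} (γ : ℝ) (q : ℝ≥0∞) (f : EuclideanSpace ℝ (Fin N) → ℝ) : Prop :=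
  AEStronglyMeasurable f volume ∧ wNorm γ q f < ⊤

/-- `u ∈ C(I; L^q_γ(ℝ^N))`, for a set `I` of times. -/
def ContinuousInW {N : ℕ} (γ : ℝ) (q : ℝ≥0∞) (I : Set ℝ)
    (u : ℝ → EuclideanSpace ℝ (Fin N) → ℝ) : Prop :=
  (∀ t ∈ I, MemW γ q (u t)) ∧
    ∀ t ∈ I, Tendsto (fun s => wNorm γ q (fun x => u s x - u t x)) (𝓝[I] t) (𝓝 0)

/-- The Gauss kernel `(4πt)^{-N/2} exp(-|x|²/(4t))`, used for `t > 0`. -/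
def gaussKernel {N : ℕ} (t : ℝ) (x : EuclideanSpace ℝ (Fin N)) : ℝ :=
  (4 * Real.pi * t) ^ (-(N : ℝ) / 2) * Real.exp (-‖x‖ ^ 2 / (4 * t))

/-- The heat semigroup `(e^{tΔ} f)(x)` on `ℝ^N`, used for `t > 0`. -/
def heat {N : ℕ} (t : ℝ) (f : EuclideanSpace ℝ (Fin N) → ℝ)
    (x : EuclideanSpace ℝ (Fin N)) : ℝ :=
  ∫ y, gaussKernel t (x - y) * f y

/-- The nonlinearity `|f|^α f`. -/
def nonlin {N : ℕ} (α : ℝ) (f : EuclideanSpace ℝ (Fin N) → ℝ)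
    (x : EuclideanSpace ℝ (Fin N)) : ℝ :=
  |f x| ^ α * f x

/-- The auxiliary Lebesgue exponent `r = (α + 1) q`. -/
def auxExp (α : ℝ) (q : ℝ≥0∞) : ℝ≥0∞ := ENNReal.ofReal (α + 1) * q

/-- The auxiliary weight `ν = γ / (α + 1)`. -/
def auxWeight (α γ : ℝ) : ℝ := γ / (α + 1)

/-- The time weight `β = (N/2) (1/q - 1/r) + ν α / 2`, where `1/∞ = 0`. -/
def auxRate (N : ℕ) (α γ : ℝ) (q : ℝ≥0∞) : ℝ :=
  (N : ℝ) / 2 * ((q⁻¹).toReal - ((auxExp α q)⁻¹).toReal) + auxWeight α γ * α / 2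

/-- `u` is a (mild) solution on `[0, T]` of `∂ₜ u = Δ u + |u|^α u` with `u(0) = u₀`, in the class
in which the Cauchy problem is well posed in `L^q_γ`. Here `u t` is a function on `ℝ^N` considered
up to null sets. -/
structure IsSolutionOn {N : ℕ} (α γ : ℝ) (q : ℝ≥0∞) (u₀ : EuclideanSpace ℝ (Fin N) → ℝ)
    (T : ℝ) (u : ℝ → EuclideanSpace ℝ (Fin N) → ℝ) : Prop where
  /-- For `q < ∞`: `u ∈ C([0,T]; L^q_γ)` and `u(0) = u₀`. -/
  cont_of_ne_top : q ≠ ⊤ → ContinuousInW γ q (Icc 0 T) u ∧ u 0 =ᵐ[volume] u₀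
  /-- For `q = ∞`: `u ∈ C((0,T]; L^∞_γ)` and `‖u(t) - e^{tΔ}u₀‖_{L^∞_γ} → 0` as `t → 0`. -/
  cont_of_eq_top : q = ⊤ → ContinuousInW γ q (Ioc 0 T) u ∧
    Tendsto (fun t => wNorm γ q (fun x => u t x - heat t u₀ x)) (𝓝[>] 0) (𝓝 0)
  /-- `u ∈ C((0,T]; L^r_ν)`. -/
  cont_aux : ContinuousInW (auxWeight α γ) (auxExp α q) (Ioc 0 T) u
  /-- `t^β ‖u(t)‖_{L^r_ν}` is bounded on `(0,T]`. -/
  bdd_aux : ∃ M : ℝ, ∀ t ∈ Ioc 0 T,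
    ENNReal.ofReal (t ^ auxRate N α γ q) * wNorm (auxWeight α γ) (auxExp α q) (u t)
      ≤ ENNReal.ofReal M
  /-- `u(t) = e^{tΔ} u₀ + ∫₀ᵗ e^{(t-σ)Δ} (|u(σ)|^α u(σ)) dσ` for `0 < t ≤ T`, the integral being
  absolutely convergent almost everywhere on `ℝ^N`. -/
  integral_eq : ∀ t ∈ Ioc 0 T, ∀ᵐ x ∂(volume : Measure (EuclideanSpace ℝ (Fin N))),
    IntegrableOn (fun σ => heat (t - σ) (nonlin α (u σ)) x) (Ioo 0 t) volume ∧
      u t x = heat t u₀ x + ∫ σ in Ioo 0 t, heat (t - σ) (nonlin α (u σ)) x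

/-- `u` is a solution on `[0, T)`, where `T ∈ [0, ∞]`: it is a solution on `[0, S]` for every real
`0 < S < T`. -/
def IsSolutionUpTo {N : ℕ} (α γ : ℝ) (q : ℝ≥0∞) (u₀ : EuclideanSpace ℝ (Fin N) → ℝ)
    (T : ℝ≥0∞) (u : ℝ → EuclideanSpace ℝ (Fin N) → ℝ) : Prop :=
  ∀ S : ℝ, 0 < S → ENNReal.ofReal S < T → IsSolutionOn α γ q u₀ S u

/-- `u` and `v` coincide on the time interval `(0, T)`. -/
def AgreeUpTo {N : ℕ} (T : ℝ≥0∞) (u v : ℝ → EuclideanSpace ℝ (Fin N) → ℝ) : Prop :=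
  ∀ t : ℝ, 0 < t → ENNReal.ofReal t < T → u t =ᵐ[volume] v t

/-- `u` is a maximal solution in `L^q_γ` with existence time `T ∈ (0, ∞]`: it is a solution on
`[0, T)` that is not the restriction of a solution on a strictly longer interval. -/
structure IsMaximalSolution {N : ℕ} (α γ : ℝ) (q : ℝ≥0∞) (u₀ : EuclideanSpace ℝ (Fin N) → ℝ)
    (T : ℝ≥0∞) (u : ℝ → EuclideanSpace ℝ (Fin N) → ℝ) : Prop where
  pos : 0 < T
  isSolution : IsSolutionUpTo α γ q u₀ T u
  maximal : ∀ (S : ℝ≥0∞) (v : ℝ → EuclideanSpace ℝ (Fin N) → ℝ),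
    IsSolutionUpTo α γ q u₀ S v → AgreeUpTo T v u → S ≤ T

end WeightedHeat

end

/-! The integral equation is solved by Banach's fixed point theorem among curves `u` for which `t ^
β * ‖u t‖` stays bounded in `L^r_ν`. Write `ρ = N/(2q) + γ/2` and `b = β (α + 1)`.

Linear part. Hölder's inequality against the Gauss kernel separates the singular weight `|y|^{-γ}`
from `|·|^γ f`; the weight to the dual power is integrable near the origin because `1/q + γ/N < 1`.
This gives a pointwise bound by `t^{-ρ}` (`exists_pointwiseBound`) and boundedness of the heat flow
on `L^q_γ` (`exists_smoothingBound_self`). Geometric interpolation of the two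
(`SmoothingBound.interpolate`) maps `L^q_γ` to `L^r_ν` at the rate `t^{-β}`, with `β = ρ α / (α +
1)`.

Nonlinear part. The exponents `r` and `ν` make `f ↦ |f|^α f` locally Lipschitz from `L^r_ν` to
`L^q_γ` (`wNorm_nonlin_sub_le`). Along a curve of the class the source term is `O(σ^{-b})`, and `b =
α ρ < 1` is the second condition on `q`. As `β < b` too, the Duhamel integral converges in both
spaces (`duhamel_bound_aux`) and gains a factor `T^{1-b}` in the norm of the class.

Existence and lifespan. On the ball whose radius is a multiple of `‖u₀‖`, the map contracts once
`T^{1-b} ‖u₀‖^α` is small (`Estimates.exists_isSolutionOn`). Since `1 - b = α (1/α - N/(2q) - γ/2)`,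
this smallness condition is the stated lower bound for the existence time.

Uniqueness and maximality. For large `l`, the weight `e^{-lt}` makes the difference of two Duhamel
terms contract on an interval of any length, so solutions are unique (`IsSolutionOn.ae_eq`). All
solutions with the same data can then be glued, and the supremum of their lengths is the maximal
time. -/

namespace WeightedHeat

/-! ### Pointwise and integral bounds for the Gauss kernel -/

section Kernel

variable {N : ℕ}

theorem gaussKernel_nonneg {t : ℝ} (ht : 0 < t) (z : EuclideanSpace ℝ (Fin N)) :
    0 ≤ gaussKernel t z := by
  unfold gaussKernel; positivity

theorem continuous_gaussKernel (t : ℝ) :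
    Continuous (gaussKernel t : EuclideanSpace ℝ (Fin N) → ℝ) := by
  unfold gaussKernel; fun_prop

theorem gaussKernel_le {t : ℝ} (ht : 0 < t) (z : EuclideanSpace ℝ (Fin N)) :
    gaussKernel t z ≤ (4 * Real.pi * t) ^ (-(N : ℝ) / 2) := by
  unfold gaussKernel
  refine mul_le_of_le_one_right (by positivity) (Real.exp_le_one_iff.2 ?_)
  exact div_nonpos_of_nonpos_of_nonneg (by simp) (by positivity)

theorem integral_gaussKernel {t : ℝ} (ht : 0 < t) :
    ∫ z : EuclideanSpace ℝ (Fin N), gaussKernel t z = 1 := by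
  have hb : 0 < 1 / (4 * t) := by positivity
  have h := GaussianFourier.integral_rexp_neg_mul_sq_norm (V := EuclideanSpace ℝ (Fin N)) hb
  have h2 : ∀ z : EuclideanSpace ℝ (Fin N), gaussKernel t z =
      (4 * Real.pi * t) ^ (-(N : ℝ) / 2) * Real.exp (-(1 / (4 * t)) * ‖z‖ ^ 2) := by
    intro z; unfold gaussKernel; congr 2; ring
  simp_rw [h2]
  rw [integral_const_mul, h, finrank_euclideanSpace_fin]
  have : Real.pi / (1 / (4 * t)) = 4 * Real.pi * t := by field_simp
  rw [this, ← Real.rpow_add (by positivity)]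
  ring_nf; simp

theorem lintegral_gaussKernel {t : ℝ} (ht : 0 < t) :
    ∫⁻ z : EuclideanSpace ℝ (Fin N), ENNReal.ofReal (gaussKernel t z) = 1 := by
  rw [← ofReal_integral_eq_lintegral_ofReal
    (integrable_of_integral_eq_one (integral_gaussKernel ht))
    (ae_of_all _ (gaussKernel_nonneg ht)), integral_gaussKernel ht, ENNReal.ofReal_one]

theorem lintegral_gaussKernel_sub {t : ℝ} (ht : 0 < t) (x : EuclideanSpace ℝ (Fin N)) :
    ∫⁻ y : EuclideanSpace ℝ (Fin N), ENNReal.ofReal (gaussKernel t (x - y)) = 1 := by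
  rw [lintegral_sub_left_eq_self (fun z => ENNReal.ofReal (gaussKernel t z)) x,
    lintegral_gaussKernel ht]

theorem lintegral_gaussKernel_sub' {t : ℝ} (ht : 0 < t) (y : EuclideanSpace ℝ (Fin N)) :
    ∫⁻ x : EuclideanSpace ℝ (Fin N), ENNReal.ofReal (gaussKernel t (x - y)) = 1 := by
  rw [lintegral_sub_right_eq_self (fun z => ENNReal.ofReal (gaussKernel t z)) y,
    lintegral_gaussKernel ht]

theorem rpow_mul_exp_neg_le {k s : ℝ} (hk : 0 < k) (hs : 0 ≤ s) :
    s ^ k * Real.exp (-s) ≤ k ^ k := by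
  have h1 : s / k ≤ Real.exp (s / k) := (by linarith [Real.add_one_le_exp (s / k)])
  have h2 : (s / k) ^ k ≤ Real.exp s := by
    calc (s / k) ^ k ≤ (Real.exp (s / k)) ^ k :=
          Real.rpow_le_rpow (by positivity) h1 hk.le
      _ = Real.exp s := by rw [← Real.exp_mul]; congr 1; field_simp
  rw [Real.div_rpow hs hk.le, div_le_iff₀ (by positivity)] at h2
  rw [Real.exp_neg, ← div_eq_mul_inv, div_le_iff₀ (Real.exp_pos _)]
  linarith

/-- Powers of `‖z‖` are absorbed by the Gauss kernel at the cost of doubling the time. -/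
theorem norm_rpow_mul_gaussKernel_le {a : ℝ} (ha : 0 < a) : ∃ C : ℝ, 0 < C ∧
    ∀ (t : ℝ), 0 < t → ∀ z : EuclideanSpace ℝ (Fin N),
      ‖z‖ ^ a * gaussKernel t z ≤ C * t ^ (a / 2) * gaussKernel (2 * t) z := by
  -- The exponent `|z|²/(4t)` is split into two halves `|z|²/(8t)`: one absorbs the power of `|z|`,
  -- the other is the exponential of the kernel at time `2t`.
  refine ⟨8 ^ (a / 2) * (a / 2) ^ (a / 2) * 2 ^ ((N : ℝ) / 2), by positivity, fun t ht z => ?_⟩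
  have hs : 0 ≤ ‖z‖ ^ 2 / (8 * t) := by positivity
  have h1 := rpow_mul_exp_neg_le (half_pos ha) hs
  have h2 : ‖z‖ ^ a = (8 * t) ^ (a / 2) * (‖z‖ ^ 2 / (8 * t)) ^ (a / 2) := by
    rw [← Real.mul_rpow (by positivity) hs, mul_div_cancel₀ _ (by positivity),
      ← Real.rpow_natCast, ← Real.rpow_mul (norm_nonneg _)]
    congr 1; push_cast; ring
  have h3 : Real.exp (-‖z‖ ^ 2 / (4 * t)) =
      Real.exp (-(‖z‖ ^ 2 / (8 * t))) * Real.exp (-‖z‖ ^ 2 / (4 * (2 * t))) := by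
    rw [← Real.exp_add]; congr 1; field_simp; ring
  have h4 : (4 * Real.pi * t) ^ (-(N : ℝ) / 2) =
      2 ^ ((N : ℝ) / 2) * (4 * Real.pi * (2 * t)) ^ (-(N : ℝ) / 2) := by
    have : 4 * Real.pi * (2 * t) = 2 * (4 * Real.pi * t) := by ring
    rw [this, Real.mul_rpow (x := 2) (by norm_num) (by positivity), ← mul_assoc,
      ← Real.rpow_add (by norm_num)]
    ring_nf; simp
  unfold gaussKernel
  rw [h2, h3, h4, Real.mul_rpow (by norm_num) ht.le]
  set E := Real.exp (-‖z‖ ^ 2 / (4 * (2 * t)))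
  set B := (4 * Real.pi * (2 * t)) ^ (-(N : ℝ) / 2)
  have hE : 0 ≤ E := (Real.exp_pos _).le
  have hB : 0 ≤ B := by positivity
  calc _ = (8 ^ (a / 2) * t ^ (a / 2) * 2 ^ ((N : ℝ) / 2) * B * E) *
        ((‖z‖ ^ 2 / (8 * t)) ^ (a / 2) * Real.exp (-(‖z‖ ^ 2 / (8 * t)))) := by ring
    _ ≤ (8 ^ (a / 2) * t ^ (a / 2) * 2 ^ ((N : ℝ) / 2) * B * E) * (a / 2) ^ (a / 2) :=
        mul_le_mul_of_nonneg_left h1 (by positivity)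
    _ = _ := by ring

/-- Modulus of continuity in time of the Gauss kernel, as a function of the ratio of the times. -/
noncomputable def timeModulus (N : ℕ) (ρ : ℝ) : ℝ :=
  2 ^ ((N : ℝ) / 2) * (2 * ρ ^ ((N : ℝ) / 2) * (ρ - 1) + (ρ ^ ((N : ℝ) / 2) - 1))

theorem timeModulus_nonneg {ρ : ℝ} (hρ : 1 ≤ ρ) : 0 ≤ timeModulus N ρ := by
  unfold timeModulus
  have := Real.one_le_rpow hρ (show 0 ≤ (N : ℝ) / 2 by positivity)
  have : 0 ≤ ρ - 1 := by linarith
  have : 0 ≤ ρ ^ ((N : ℝ) / 2) - 1 := by linarith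
  positivity

theorem tendsto_timeModulus : Tendsto (timeModulus N) (𝓝 1) (𝓝 0) := by
  have : ContinuousAt (timeModulus N) 1 := by
    unfold timeModulus
    have : ContinuousAt (fun ρ : ℝ => ρ ^ ((N : ℝ) / 2)) 1 :=
      Real.continuousAt_rpow_const _ _ (Or.inl one_ne_zero)
    fun_prop
  convert this.tendsto using 2
  simp [timeModulus]

/-- The change of the prefactor and the change of the exponential are estimated separately; the
latter produces a factor `|z|²/(8t)`, absorbed by half of the Gaussian. The majorant is a single
Gaussian, so every smoothing bound applies to it, and its coefficient depends only on `t / s`, hence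
is unchanged when both times are multiplied by the same number. -/
theorem abs_gaussKernel_sub_le {s t : ℝ} (hs : 0 < s) (hst : s ≤ t)
    (z : EuclideanSpace ℝ (Fin N)) :
    |gaussKernel t z - gaussKernel s z| ≤ timeModulus N (t / s) * gaussKernel (2 * t) z := by
  have ht : 0 < t := hs.trans_le hst
  set a : ℝ := ‖z‖ ^ 2 / 4 with ha
  have ha0 : 0 ≤ a := by positivity
  have e1 : ∀ r : ℝ, -‖z‖ ^ 2 / (4 * r) = -(a / r) := by
    intro r; rw [ha]; field_simp
  have hρ : 1 ≤ t / s := (one_le_div hs).2 hst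
  have hd : a / t ≤ a / s := div_le_div_of_nonneg_left ha0 hs hst
  have hexp1 : Real.exp (-(a / s)) ≤ Real.exp (-(a / t)) := Real.exp_le_exp.2 (by linarith)
  have hexp2 : Real.exp (-(a / t)) - Real.exp (-(a / s)) ≤
      2 * (t / s - 1) * Real.exp (-(a / (2 * t))) := by
    have h1 : Real.exp (-(a / s)) = Real.exp (-(a / t)) * Real.exp (-(a / s - a / t)) := by
      rw [← Real.exp_add]; congr 1; ring
    have h2 := Real.add_one_le_exp (-(a / s - a / t))
    have h3 : Real.exp (-(a / t)) = Real.exp (-(a / (2 * t))) * Real.exp (-(a / (2 * t))) := by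
      rw [← Real.exp_add]; congr 1; field_simp; ring
    have h4 : a / (2 * t) * Real.exp (-(a / (2 * t))) ≤ 1 := by
      have := Real.add_one_le_exp (a / (2 * t))
      rw [Real.exp_neg, ← div_eq_mul_inv, div_le_one (Real.exp_pos _)]; linarith
    have h5 : a / s - a / t = 2 * (t / s - 1) * (a / (2 * t)) := by field_simp
    have hE := (Real.exp_pos (-(a / (2 * t))))
    calc Real.exp (-(a / t)) - Real.exp (-(a / s))
        ≤ Real.exp (-(a / t)) * (a / s - a / t) := by
          rw [h1]; nlinarith [Real.exp_pos (-(a / t))]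
      _ = 2 * (t / s - 1) * Real.exp (-(a / (2 * t))) *
            (a / (2 * t) * Real.exp (-(a / (2 * t)))) := by rw [h5, h3]; ring
      _ ≤ _ := mul_le_of_le_one_right (by have : 0 ≤ t / s - 1 := by linarith
                                          positivity) h4
  have hexp3 : Real.exp (-(a / t)) ≤ Real.exp (-(a / (2 * t))) :=
    Real.exp_le_exp.2 (neg_le_neg (div_le_div_of_nonneg_left ha0 ht (by linarith)))
  have hpow : (4 * Real.pi * s) ^ (-(N : ℝ) / 2) =
      (t / s) ^ ((N : ℝ) / 2) * (4 * Real.pi * t) ^ (-(N : ℝ) / 2) := by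
    have : 4 * Real.pi * t = (t / s) * (4 * Real.pi * s) := by field_simp
    rw [this, Real.mul_rpow (x := t / s) (by positivity) (by positivity), ← mul_assoc,
      ← Real.rpow_add (by positivity)]
    ring_nf; simp
  have hpow2 : (4 * Real.pi * t) ^ (-(N : ℝ) / 2) =
      2 ^ ((N : ℝ) / 2) * (4 * Real.pi * (2 * t)) ^ (-(N : ℝ) / 2) := by
    have : 4 * Real.pi * (2 * t) = 2 * (4 * Real.pi * t) := by ring
    rw [this, Real.mul_rpow (x := 2) (by norm_num) (by positivity), ← mul_assoc,
      ← Real.rpow_add (by norm_num)]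
    ring_nf; simp
  set P := (t / s) ^ ((N : ℝ) / 2) with hP
  have hP1 : 1 ≤ P := Real.one_le_rpow hρ (by positivity)
  unfold gaussKernel timeModulus
  rw [e1, e1, e1, hpow, ← hP]
  set B := (4 * Real.pi * t) ^ (-(N : ℝ) / 2) with hB
  have hB0 : 0 ≤ B := by positivity
  have key : |B * Real.exp (-(a / t)) - P * B * Real.exp (-(a / s))| ≤
      B * ((2 * P * (t / s - 1) + (P - 1)) * Real.exp (-(a / (2 * t)))) := by
    have : B * Real.exp (-(a / t)) - P * B * Real.exp (-(a / s)) =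
      B * (P * (Real.exp (-(a / t)) - Real.exp (-(a / s))) - (P - 1) * Real.exp (-(a / t))) := by
      ring
    rw [this, abs_mul, abs_of_nonneg hB0]
    refine mul_le_mul_of_nonneg_left ?_ hB0
    refine (abs_sub _ _).trans ?_
    rw [abs_of_nonneg (mul_nonneg (by linarith) (by linarith)),
      abs_of_nonneg (mul_nonneg (by linarith) (Real.exp_pos _).le)]
    have := mul_le_mul_of_nonneg_left hexp2 (show 0 ≤ P by linarith)
    have := mul_le_mul_of_nonneg_left hexp3 (show 0 ≤ P - 1 by linarith)
    linarith
  refine key.trans (le_of_eq ?_)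
  rw [hpow2]; ring

/-- Scaling reduces the radius `R` to the unit ball, where `|y|^{-a}` is integrable since `a < N`.
-/
theorem setLIntegral_ball_norm_rpow {a : ℝ} (hN : 1 ≤ N) (haN : a < N) :
    ∃ C : ℝ, 0 < C ∧ ∀ R : ℝ, 0 < R →
      ∫⁻ y in Metric.ball (0 : EuclideanSpace ℝ (Fin N)) R, ENNReal.ofReal (‖y‖ ^ (-a))
        ≤ ENNReal.ofReal (C * R ^ (N - a)) := by
  have hint : ∀ R : ℝ, IntegrableOn (fun y : EuclideanSpace ℝ (Fin N) => ‖y‖ ^ (-a))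
      (Metric.ball 0 R) := by
    intro R
    refine integrableOn_ball_of_norm_le_rpow (C := 1) (α := a) (by simpa using hN)
      (by simpa using haN) ?_ ?_
    · exact ae_of_all _ fun y => by
        rw [Real.norm_of_nonneg (by positivity), one_mul]
    · exact (measurable_norm.pow_const _).aestronglyMeasurable
  set I := ∫ y in Metric.ball (0 : EuclideanSpace ℝ (Fin N)) 1, ‖y‖ ^ (-a) with hI
  have hI0 : 0 ≤ I := integral_nonneg fun y => by positivity
  -- The added 1 only makes the constant visibly positive.
  refine ⟨I + 1, by linarith, fun R hR => ?_⟩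
  rw [← ofReal_integral_eq_lintegral_ofReal (hint R) (ae_of_all _ fun y => by positivity)]
  refine ENNReal.ofReal_le_ofReal ?_
  have h := Measure.setIntegral_comp_smul_of_pos (volume : Measure (EuclideanSpace ℝ (Fin N)))
    (fun y => ‖y‖ ^ (-a)) (Metric.ball 0 1) hR
  rw [smul_unitBall_of_pos hR, finrank_euclideanSpace_fin, smul_eq_mul] at h
  have h2 : ∫ y in Metric.ball (0 : EuclideanSpace ℝ (Fin N)) 1, ‖R • y‖ ^ (-a) = R ^ (-a) * I := by
    rw [hI, ← integral_const_mul]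
    congr 1; ext y
    rw [norm_smul, Real.norm_of_nonneg hR.le, Real.mul_rpow hR.le (norm_nonneg _)]
  rw [h2] at h
  have h3 : ∫ y in Metric.ball (0 : EuclideanSpace ℝ (Fin N)) R, ‖y‖ ^ (-a) =
      R ^ ((N : ℝ) - a) * I := by
    rw [sub_eq_add_neg, Real.rpow_add hR, Real.rpow_natCast, mul_assoc, h,
      mul_inv_cancel_left₀ (by positivity)]
  rw [h3]
  nlinarith [Real.rpow_pos_of_pos hR ((N : ℝ) - a)]

/-- The integral is cut at the diffusion length `√t`: inside the ball the kernel is at most a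
multiple of `t^{-N/2}`, outside it `|y|^{-a} ≤ t^{-a/2}` and the kernel has mass one. -/
theorem lintegral_gaussKernel_mul_norm_rpow_le {a : ℝ} (hN : 1 ≤ N) (ha : 0 < a) (haN : a < N) :
    ∃ C : ℝ, 0 < C ∧ ∀ t : ℝ, 0 < t → ∀ x : EuclideanSpace ℝ (Fin N),
      ∫⁻ y, ENNReal.ofReal (gaussKernel t (x - y)) * ENNReal.ofReal (‖y‖ ^ (-a))
        ≤ ENNReal.ofReal (C * t ^ (-a / 2)) := by
  obtain ⟨C₀, hC₀, h₀⟩ := setLIntegral_ball_norm_rpow hN haN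
  refine ⟨(4 * Real.pi) ^ (-(N : ℝ) / 2) * C₀ + 1, by positivity, fun t ht x => ?_⟩
  have hst : 0 < Real.sqrt t := Real.sqrt_pos.2 ht
  set c := (4 * Real.pi * t) ^ (-(N : ℝ) / 2) with hc
  have hc0 : 0 ≤ c := by positivity
  have hsq : (Real.sqrt t) ^ (-a) = t ^ (-a / 2) := by
    rw [Real.sqrt_eq_rpow, ← Real.rpow_mul ht.le]; congr 1; ring
  have hptw : ∀ y : EuclideanSpace ℝ (Fin N),
      ENNReal.ofReal (gaussKernel t (x - y)) * ENNReal.ofReal (‖y‖ ^ (-a)) ≤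
      (Metric.ball (0 : EuclideanSpace ℝ (Fin N)) (Real.sqrt t)).indicator
        (fun y => ENNReal.ofReal c * ENNReal.ofReal (‖y‖ ^ (-a))) y +
      ENNReal.ofReal (gaussKernel t (x - y)) * ENNReal.ofReal (t ^ (-a / 2)) := by
    intro y
    by_cases hy : y ∈ Metric.ball (0 : EuclideanSpace ℝ (Fin N)) (Real.sqrt t)
    · rw [indicator_of_mem hy]
      refine le_add_right ?_
      gcongr
      exact gaussKernel_le ht _
    · rw [indicator_of_notMem hy, zero_add]
      gcongr
      rw [← hsq]
      simp only [Metric.mem_ball, dist_zero_right, not_lt] at hy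
      exact Real.rpow_le_rpow_of_nonpos hst hy (by linarith)
  have hm : Measurable fun y : EuclideanSpace ℝ (Fin N) =>
      ENNReal.ofReal (gaussKernel t (x - y)) := by
    have := continuous_gaussKernel (N := N) t
    fun_prop
  refine (lintegral_mono hptw).trans ?_
  rw [lintegral_add_right _ (hm.mul_const _), lintegral_indicator Metric.isOpen_ball.measurableSet,
    lintegral_const_mul _ (by fun_prop), lintegral_mul_const _ hm,
    lintegral_gaussKernel_sub ht, one_mul, add_mul, one_mul,
    ENNReal.ofReal_add (by positivity) (by positivity)]
  gcongr
  refine (mul_le_mul_right (h₀ _ hst) _).trans ?_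
  rw [← ENNReal.ofReal_mul hc0]
  refine ENNReal.ofReal_le_ofReal (le_of_eq ?_)
  rw [hc, Real.mul_rpow (by positivity) ht.le, Real.sqrt_eq_rpow, ← Real.rpow_mul ht.le]
  have : t ^ (-a / 2) = t ^ (-(N : ℝ) / 2) * t ^ (1 / 2 * ((N : ℝ) - a)) := by
    rw [← Real.rpow_add ht]; congr 1; ring
  rw [this]; ring

theorem norm_rpow_le_two_rpow_mul {a : ℝ} (ha : 0 < a) (x y : EuclideanSpace ℝ (Fin N)) :
    ‖x‖ ^ a ≤ 2 ^ a * (‖x - y‖ ^ a + ‖y‖ ^ a) := by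
  have h : ‖x‖ ≤ 2 * max ‖x - y‖ ‖y‖ := by
    have h1 : ‖x‖ ≤ ‖x - y‖ + ‖y‖ := by simpa using norm_add_le (x - y) y
    have := le_max_left ‖x - y‖ ‖y‖
    have := le_max_right ‖x - y‖ ‖y‖
    linarith
  refine (Real.rpow_le_rpow (norm_nonneg _) h ha.le).trans ?_
  rw [Real.mul_rpow (by norm_num) (by positivity)]
  gcongr
  rcases le_total ‖x - y‖ ‖y‖ with h | h
  · rw [max_eq_right h]
    linarith [Real.rpow_nonneg (norm_nonneg (x - y)) a]
  · rw [max_eq_left h]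
    linarith [Real.rpow_nonneg (norm_nonneg y) a]

/-- The weight at `x` is split into `|x - y|^a` and `|y|^a`. The first is absorbed by the kernel at
time `2t`, whose gain `t^{a/2}` cancels the loss `t^{-a/2}` of the previous bound; the second
cancels `|y|^{-a}` and leaves the mass of the kernel. -/
theorem lintegral_gaussKernel_mul_norm_rpow_weight_le {a : ℝ} (hN : 1 ≤ N) (ha : 0 < a)
    (haN : a < N) :
    ∃ C : ℝ, 0 < C ∧ ∀ t : ℝ, 0 < t → ∀ x : EuclideanSpace ℝ (Fin N),
      ENNReal.ofReal (‖x‖ ^ a) *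
        ∫⁻ y, ENNReal.ofReal (gaussKernel t (x - y)) * ENNReal.ofReal (‖y‖ ^ (-a))
        ≤ ENNReal.ofReal C := by
  obtain ⟨C₁, hC₁, h₁⟩ := norm_rpow_mul_gaussKernel_le (N := N) ha
  obtain ⟨C₂, hC₂, h₂⟩ := lintegral_gaussKernel_mul_norm_rpow_le hN ha haN
  refine ⟨2 ^ a * (C₁ * C₂ * 2 ^ (-a / 2) + 1), by positivity, fun t ht x => ?_⟩
  have hm : ∀ t, Measurable fun y : EuclideanSpace ℝ (Fin N) =>
      ENNReal.ofReal (gaussKernel t (x - y)) := by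
    intro t
    have := continuous_gaussKernel (N := N) t
    fun_prop
  have hm' : ∀ t, Measurable fun y : EuclideanSpace ℝ (Fin N) =>
      ENNReal.ofReal (gaussKernel t (x - y)) * ENNReal.ofReal (‖y‖ ^ (-a)) :=
    fun t => (hm t).mul (by fun_prop)
  rw [← lintegral_const_mul _ (hm' t)]
  have hptw : ∀ y : EuclideanSpace ℝ (Fin N),
      ENNReal.ofReal (‖x‖ ^ a) *
        (ENNReal.ofReal (gaussKernel t (x - y)) * ENNReal.ofReal (‖y‖ ^ (-a))) ≤
      ENNReal.ofReal (2 ^ a * C₁ * t ^ (a / 2)) *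
        (ENNReal.ofReal (gaussKernel (2 * t) (x - y)) * ENNReal.ofReal (‖y‖ ^ (-a))) +
      ENNReal.ofReal (2 ^ a) * ENNReal.ofReal (gaussKernel t (x - y)) := by
    intro y
    have g1 := gaussKernel_nonneg ht (x - y)
    have g2 := gaussKernel_nonneg (show 0 < 2 * t by linarith) (x - y)
    have p1 : 0 ≤ ‖y‖ ^ (-a) := by positivity
    rw [← ENNReal.ofReal_mul g1, ← ENNReal.ofReal_mul g2, ← ENNReal.ofReal_mul (by positivity),
      ← ENNReal.ofReal_mul (by positivity), ← ENNReal.ofReal_mul (by positivity),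
      ← ENNReal.ofReal_add (by positivity) (by positivity)]
    refine ENNReal.ofReal_le_ofReal ?_
    -- Only an inequality: at `y = 0` the product is 0.
    have hy : ‖y‖ ^ a * ‖y‖ ^ (-a) ≤ 1 := by
      rcases eq_or_lt_of_le (norm_nonneg y) with h | h
      · rw [← h, Real.zero_rpow ha.ne', zero_mul]; norm_num
      · rw [← Real.rpow_add h]; simp
    calc ‖x‖ ^ a * (gaussKernel t (x - y) * ‖y‖ ^ (-a))
        ≤ 2 ^ a * (‖x - y‖ ^ a + ‖y‖ ^ a) * (gaussKernel t (x - y) * ‖y‖ ^ (-a)) :=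
          mul_le_mul_of_nonneg_right (norm_rpow_le_two_rpow_mul ha x y) (by positivity)
      _ = 2 ^ a * ((‖x - y‖ ^ a * gaussKernel t (x - y)) * ‖y‖ ^ (-a)) +
          2 ^ a * (gaussKernel t (x - y) * (‖y‖ ^ a * ‖y‖ ^ (-a))) := by ring
      _ ≤ 2 ^ a * ((C₁ * t ^ (a / 2) * gaussKernel (2 * t) (x - y)) * ‖y‖ ^ (-a)) +
          2 ^ a * (gaussKernel t (x - y) * 1) := by
          refine add_le_add (mul_le_mul_of_nonneg_left
            (mul_le_mul_of_nonneg_right (h₁ t ht _) p1) (by positivity)) ?_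
          gcongr
      _ = _ := by ring
  refine (lintegral_mono hptw).trans ?_
  rw [lintegral_add_right _ ((hm t).const_mul _),
    lintegral_const_mul _ (hm' _),
    lintegral_const_mul _ (hm t), lintegral_gaussKernel_sub ht]
  refine (add_le_add_left (mul_le_mul_right (h₂ (2 * t) (by linarith) x) _) _).trans ?_
  rw [mul_one, ← ENNReal.ofReal_mul (by positivity),
    ← ENNReal.ofReal_add (by positivity) (by positivity)]
  refine ENNReal.ofReal_le_ofReal (le_of_eq ?_)
  rw [Real.mul_rpow (by norm_num) ht.le]
  have : t ^ (a / 2) * t ^ (-a / 2) = 1 := by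
    rw [← Real.rpow_add ht]; ring_nf; simp
  linear_combination (2 ^ a * C₁ * C₂ * 2 ^ (-a / 2)) * this

end Kernel

/-! ### The heat flow of the absolute value as an extended nonnegative majorant -/

section Majorant

variable {N : ℕ}

/-- The heat semigroup applied to `|f|`, as an extended nonnegative number. -/
noncomputable def heatMaj (t : ℝ) (f : EuclideanSpace ℝ (Fin N) → ℝ)
    (x : EuclideanSpace ℝ (Fin N)) : ℝ≥0∞ :=
  ∫⁻ y, ENNReal.ofReal (gaussKernel t (x - y)) * ‖f y‖ₑ

variable {f g : EuclideanSpace ℝ (Fin N) → ℝ} {t : ℝ}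

theorem heat_congr (h : f =ᵐ[volume] g) : heat t f = heat t g := by
  ext x; exact integral_congr_ae (h.mono fun y hy => by simp [hy])

theorem continuous_gaussKernel_sub (t : ℝ) :
    Continuous fun z : EuclideanSpace ℝ (Fin N) × EuclideanSpace ℝ (Fin N) =>
      gaussKernel t (z.1 - z.2) :=
  (continuous_gaussKernel t).comp (continuous_fst.sub continuous_snd)

theorem measurable_ofReal_gaussKernel_sub (t : ℝ) (x : EuclideanSpace ℝ (Fin N)) :
    Measurable fun y : EuclideanSpace ℝ (Fin N) => ENNReal.ofReal (gaussKernel t (x - y)) := by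
  have := continuous_gaussKernel (N := N) t
  fun_prop

theorem stronglyMeasurable_heat (hf : AEStronglyMeasurable f volume) :
    StronglyMeasurable (heat t f) := by
  rw [heat_congr hf.ae_eq_mk]
  have : StronglyMeasurable fun z : EuclideanSpace ℝ (Fin N) × EuclideanSpace ℝ (Fin N) =>
      gaussKernel t (z.1 - z.2) * hf.mk f z.2 :=
    (continuous_gaussKernel_sub t).stronglyMeasurable.mul
      (hf.stronglyMeasurable_mk.comp_measurable measurable_snd)
  exact this.integral_prod_right

theorem enorm_gaussKernel_mul (ht : 0 < t) (x y : EuclideanSpace ℝ (Fin N)) (c : ℝ) :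
    ‖gaussKernel t (x - y) * c‖ₑ = ENNReal.ofReal (gaussKernel t (x - y)) * ‖c‖ₑ := by
  rw [enorm_mul, Real.enorm_of_nonneg (gaussKernel_nonneg ht _)]

theorem enorm_heat_le (ht : 0 < t) (f : EuclideanSpace ℝ (Fin N) → ℝ)
    (x : EuclideanSpace ℝ (Fin N)) : ‖heat t f x‖ₑ ≤ heatMaj t f x := by
  refine (enorm_integral_le_lintegral_enorm _).trans (le_of_eq ?_)
  exact lintegral_congr fun y => enorm_gaussKernel_mul ht x y _

theorem integrable_heat (ht : 0 < t) (hf : AEStronglyMeasurable f volume)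
    {x : EuclideanSpace ℝ (Fin N)} (hx : heatMaj t f x < ⊤) :
    Integrable (fun y => gaussKernel t (x - y) * f y) := by
  refine ⟨?_, ?_⟩
  · exact ((continuous_gaussKernel t).comp
      (continuous_const.sub continuous_id)).aestronglyMeasurable.mul hf
  · unfold HasFiniteIntegral
    convert hx using 1
    exact lintegral_congr fun y => enorm_gaussKernel_mul ht x y _

theorem heat_sub (ht : 0 < t) (hf : AEStronglyMeasurable f volume)
    (hg : AEStronglyMeasurable g volume)
    {x : EuclideanSpace ℝ (Fin N)} (hfx : heatMaj t f x < ⊤) (hgx : heatMaj t g x < ⊤) :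
    heat t (fun y => f y - g y) x = heat t f x - heat t g x := by
  unfold heat
  rw [← integral_sub (integrable_heat ht hf hfx) (integrable_heat ht hg hgx)]
  congr 1; ext y; ring

theorem enorm_heat_sub_heat_le {s : ℝ} (hs : 0 < s) (hst : s ≤ t)
    (hf : AEStronglyMeasurable f volume) {x : EuclideanSpace ℝ (Fin N)}
    (hsx : heatMaj s f x < ⊤) (htx : heatMaj t f x < ⊤) :
    ‖heat t f x - heat s f x‖ₑ ≤
      ENNReal.ofReal (timeModulus N (t / s)) * heatMaj (2 * t) f x := by
  have ht : 0 < t := hs.trans_le hst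
  have hm : 0 ≤ timeModulus N (t / s) := timeModulus_nonneg ((one_le_div hs).2 hst)
  unfold heat
  rw [← integral_sub (integrable_heat ht hf htx) (integrable_heat hs hf hsx)]
  refine (enorm_integral_le_lintegral_enorm _).trans ?_
  unfold heatMaj
  rw [← lintegral_const_mul' _ _ ENNReal.ofReal_ne_top]
  refine lintegral_mono fun y => ?_
  rw [← sub_mul, enorm_mul, ← mul_assoc, ← ENNReal.ofReal_mul hm, Real.enorm_eq_ofReal_abs]
  gcongr
  exact abs_gaussKernel_sub_le hs hst _

theorem enorm_rpow_norm_mul (κ : ℝ) (x : EuclideanSpace ℝ (Fin N)) (c : ℝ) :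
    ‖‖x‖ ^ κ * c‖ₑ = ENNReal.ofReal (‖x‖ ^ κ) * ‖c‖ₑ := by
  rw [enorm_mul, Real.enorm_of_nonneg (by positivity)]

theorem measurable_norm_rpow (κ : ℝ) :
    Measurable fun x : EuclideanSpace ℝ (Fin N) => ‖x‖ ^ κ :=
  measurable_norm.pow_const _

theorem ae_norm_pos (hN : 1 ≤ N) : ∀ᵐ x : EuclideanSpace ℝ (Fin N), 0 < ‖x‖ := by
  have : Nontrivial (EuclideanSpace ℝ (Fin N)) := by
    apply Module.nontrivial_of_finrank_pos (R := ℝ)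
    rw [finrank_euclideanSpace_fin]; exact hN
  have : ∀ᵐ x : EuclideanSpace ℝ (Fin N), x ≠ 0 := by
    simp [ae_iff]
  exact this.mono fun x hx => norm_pos_iff.2 hx

/-- Hölder's inequality with respect to the Gauss kernel. -/
theorem heatMaj_le_mul (hN : 1 ≤ N) {γ p p' : ℝ} (hpq : p'.HolderConjugate p)
    (hf : AEStronglyMeasurable f volume) (x : EuclideanSpace ℝ (Fin N)) :
    heatMaj t f x ≤
      (∫⁻ y, ENNReal.ofReal (gaussKernel t (x - y)) *
        ENNReal.ofReal (‖y‖ ^ (-(γ * p')))) ^ (1 / p') *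
      (∫⁻ y, ENNReal.ofReal (gaussKernel t (x - y)) *
        (ENNReal.ofReal (‖y‖ ^ γ) * ‖f y‖ₑ) ^ p) ^ (1 / p) := by
  set G : EuclideanSpace ℝ (Fin N) → ℝ≥0∞ := fun y => ENNReal.ofReal (gaussKernel t (x - y))
    with hG
  have hGm : Measurable G := measurable_ofReal_gaussKernel_sub t x
  have hp := hpq.symm.pos
  have hp' := hpq.pos
  -- The kernel is written as `G^{1/p'} G^{1/p}` and, off the origin, 1 as `|y|^{-γ} |y|^γ`; each
  -- Hölder factor takes one of the two pieces.
  have h := ENNReal.lintegral_mul_le_Lp_mul_Lq (volume : Measure (EuclideanSpace ℝ (Fin N))) hpq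
    (f := fun y => G y ^ (1 / p') * ENNReal.ofReal (‖y‖ ^ (-γ)))
    (g := fun y => G y ^ (1 / p) * (ENNReal.ofReal (‖y‖ ^ γ) * ‖f y‖ₑ))
    ((hGm.pow_const _).mul (measurable_norm_rpow _).ennreal_ofReal).aemeasurable
    ((hGm.pow_const _).aemeasurable.mul
      ((measurable_norm_rpow _).ennreal_ofReal.aemeasurable.mul hf.enorm))
  have e0 : heatMaj t f x = ∫⁻ y, ((fun y => G y ^ (1 / p') * ENNReal.ofReal (‖y‖ ^ (-γ))) *
      (fun y => G y ^ (1 / p) * (ENNReal.ofReal (‖y‖ ^ γ) * ‖f y‖ₑ))) y := by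
    refine lintegral_congr_ae ((ae_norm_pos hN).mono fun y hy => ?_)
    have h1 : G y ^ (1 / p') * G y ^ (1 / p) = G y := by
      rw [← ENNReal.rpow_add_of_nonneg _ _ (by positivity) (by positivity)]
      have := hpq.inv_add_inv_eq_one
      rw [one_div, one_div, this, ENNReal.rpow_one]
    have h2 : ENNReal.ofReal (‖y‖ ^ (-γ)) * ENNReal.ofReal (‖y‖ ^ γ) = 1 := by
      rw [← ENNReal.ofReal_mul (by positivity), ← Real.rpow_add hy]; simp
    simp only [Pi.mul_apply]
    calc _ = G y * ‖f y‖ₑ := rfl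
      _ = (G y ^ (1 / p') * G y ^ (1 / p)) *
          (ENNReal.ofReal (‖y‖ ^ (-γ)) * ENNReal.ofReal (‖y‖ ^ γ)) * ‖f y‖ₑ := by
        rw [h1, h2, mul_one]
      _ = _ := by ring
  rw [e0]
  refine h.trans (le_of_eq ?_)
  congr 2
  · refine lintegral_congr fun y => ?_
    rw [ENNReal.mul_rpow_of_nonneg _ _ hp'.le, ← ENNReal.rpow_mul, one_div_mul_cancel hp'.ne',
      ENNReal.rpow_one, ENNReal.ofReal_rpow_of_nonneg (by positivity) hp'.le,
      ← Real.rpow_mul (norm_nonneg _), neg_mul]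
  · refine lintegral_congr fun y => ?_
    rw [ENNReal.mul_rpow_of_nonneg _ _ hp.le, ← ENNReal.rpow_mul, one_div_mul_cancel hp.ne',
      ENNReal.rpow_one]

/-- The case `q = ∞` of the previous inequality. -/
theorem heatMaj_le_mul_top (hN : 1 ≤ N) {γ : ℝ} (x : EuclideanSpace ℝ (Fin N)) :
    heatMaj t f x ≤
      (∫⁻ y, ENNReal.ofReal (gaussKernel t (x - y)) * ENNReal.ofReal (‖y‖ ^ (-γ))) *
        wNorm γ ⊤ f := by
  have hm : Measurable fun y : EuclideanSpace ℝ (Fin N) =>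
      ENNReal.ofReal (gaussKernel t (x - y)) * ENNReal.ofReal (‖y‖ ^ (-γ)) :=
    (measurable_ofReal_gaussKernel_sub t x).mul (measurable_norm_rpow _).ennreal_ofReal
  rw [← lintegral_mul_const _ hm]
  refine lintegral_mono_ae ?_
  have h1 := ae_le_eLpNormEssSup (μ := volume)
    (f := fun y : EuclideanSpace ℝ (Fin N) => ‖y‖ ^ γ * f y)
  filter_upwards [ae_norm_pos hN, h1] with y hy h
  rw [enorm_rpow_norm_mul] at h
  have h2 : ENNReal.ofReal (‖y‖ ^ (-γ)) * ENNReal.ofReal (‖y‖ ^ γ) = 1 := by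
    rw [← ENNReal.ofReal_mul (by positivity), ← Real.rpow_add hy]; simp
  rw [mul_assoc]
  gcongr
  calc ‖f y‖ₑ = ENNReal.ofReal (‖y‖ ^ (-γ)) * (ENNReal.ofReal (‖y‖ ^ γ) * ‖f y‖ₑ) := by
        rw [← mul_assoc, h2, one_mul]
    _ ≤ _ := by
        gcongr
        simpa [wNorm, eLpNorm_exponent_top] using h

end Majorant

/-! ### Smoothing estimates between weighted spaces -/

section Smoothing

variable {N : ℕ}

/-- The smoothing effect `‖e^{tΔ} |f|‖_{L^p_κ} ≤ C t^{-ρ} ‖f‖_{L^q_γ}`. -/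
def SmoothingBound (N : ℕ) (γ : ℝ) (q : ℝ≥0∞) (κ : ℝ) (p : ℝ≥0∞) (ρ C : ℝ) : Prop :=
  ∀ t : ℝ, 0 < t → ∀ f : EuclideanSpace ℝ (Fin N) → ℝ, AEStronglyMeasurable f volume →
    eLpNorm (fun x => ENNReal.ofReal (‖x‖ ^ κ) * heatMaj t f x) p volume
      ≤ ENNReal.ofReal (C * t ^ (-ρ)) * wNorm γ q f

/-- The pointwise smoothing effect `e^{tΔ} |f| ≤ C t^{-ρ} ‖f‖_{L^q_γ}`. -/
def PointwiseBound (N : ℕ) (γ : ℝ) (q : ℝ≥0∞) (ρ C : ℝ) : Prop :=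
  ∀ t : ℝ, 0 < t → ∀ f : EuclideanSpace ℝ (Fin N) → ℝ, AEStronglyMeasurable f volume →
    ∀ x, heatMaj t f x ≤ ENNReal.ofReal (C * t ^ (-ρ)) * wNorm γ q f

/-- The condition `1/q + γ/N < 1` says exactly that `γ p' < N`, that is, that the singular factor
`|y|^{-γp'}` in Hölder's inequality is locally integrable. -/
theorem exists_holderConjugate {γ : ℝ} {q : ℝ≥0∞} (hN : 1 ≤ N) (hγ : 0 < γ) (hq : 1 < q)
    (hqt : q ≠ ⊤) (hq₁ : (q⁻¹).toReal + γ / N < 1) :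
    ∃ p' : ℝ, p'.HolderConjugate q.toReal ∧ 0 < γ * p' ∧ γ * p' < N := by
  have hp : 1 < q.toReal := by
    rw [← ENNReal.toReal_one]; exact (ENNReal.toReal_lt_toReal ENNReal.one_ne_top hqt).2 hq
  have h := (Real.HolderConjugate.conjExponent hp).symm
  refine ⟨_, h, mul_pos hγ h.pos, ?_⟩
  have h1 := h.inv_add_inv_eq_one
  rw [ENNReal.toReal_inv] at hq₁
  have hN' : (0 : ℝ) < N := by exact_mod_cast hN
  have h2 : γ / N < (q.toReal.conjExponent)⁻¹ := by linarith
  rw [div_lt_iff₀ hN', ← div_eq_inv_mul, lt_div_iff₀ h.pos] at h2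
  exact h2

theorem wNorm_eq_lintegral {γ : ℝ} {q : ℝ≥0∞} (hq : 1 < q) (hqt : q ≠ ⊤)
    (f : EuclideanSpace ℝ (Fin N) → ℝ) :
    wNorm γ q f = (∫⁻ y, (ENNReal.ofReal (‖y‖ ^ γ) * ‖f y‖ₑ) ^ q.toReal) ^ (1 / q.toReal) := by
  rw [wNorm, eLpNorm_eq_lintegral_rpow_enorm_toReal (zero_lt_one.trans hq).ne' hqt]
  simp_rw [enorm_rpow_norm_mul]

/-- In Hölder's inequality the singular factor contributes `t^{-γ/2}`; in the other factor the
kernel is replaced by its supremum, which contributes `t^{-N/(2q)}`. -/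
theorem exists_pointwiseBound {γ : ℝ} {q : ℝ≥0∞} (hN : 1 ≤ N) (hγ : 0 < γ) (hγN : γ < N)
    (hq : 1 < q) (hq₁ : (q⁻¹).toReal + γ / N < 1) :
    ∃ C : ℝ, 0 < C ∧ PointwiseBound N γ q ((N : ℝ) / 2 * (q⁻¹).toReal + γ / 2) C := by
  by_cases hqt : q = ⊤
  · subst hqt
    obtain ⟨C, hC, h⟩ := lintegral_gaussKernel_mul_norm_rpow_le hN hγ hγN
    refine ⟨C, hC, fun t ht f hf x => (heatMaj_le_mul_top hN x (γ := γ)).trans ?_⟩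
    have e : -((N : ℝ) / 2 * (⊤⁻¹ : ℝ≥0∞).toReal + γ / 2) = -γ / 2 := by simp; ring
    rw [e]
    gcongr
    exact h t ht x
  · obtain ⟨p', hpq, ha, haN⟩ := exists_holderConjugate hN hγ hq hqt hq₁
    obtain ⟨C, hC, h⟩ := lintegral_gaussKernel_mul_norm_rpow_le hN ha haN
    have hp := hpq.symm.pos
    have hp' := hpq.pos
    set p := q.toReal with hpdef
    refine ⟨C ^ (1 / p') * ((4 * Real.pi) ^ (-(N : ℝ) / 2)) ^ (1 / p), by positivity,
      fun t ht f hf x => (heatMaj_le_mul hN hpq hf x (γ := γ)).trans ?_⟩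
    rw [wNorm_eq_lintegral hq hqt]
    set c := (4 * Real.pi * t) ^ (-(N : ℝ) / 2) with hc
    have hc0 : 0 ≤ c := by positivity
    have h2 : (∫⁻ y, ENNReal.ofReal (gaussKernel t (x - y)) *
        (ENNReal.ofReal (‖y‖ ^ γ) * ‖f y‖ₑ) ^ p) ≤
        ENNReal.ofReal c * ∫⁻ y, (ENNReal.ofReal (‖y‖ ^ γ) * ‖f y‖ₑ) ^ p := by
      rw [← lintegral_const_mul' _ _ ENNReal.ofReal_ne_top]
      refine lintegral_mono fun y => ?_
      gcongr
      exact gaussKernel_le ht _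
    refine (mul_le_mul' (ENNReal.rpow_le_rpow (h t ht x) (by positivity))
      (ENNReal.rpow_le_rpow h2 (by positivity))).trans ?_
    rw [ENNReal.mul_rpow_of_nonneg _ _ (by positivity), ← mul_assoc,
      ENNReal.ofReal_rpow_of_nonneg (by positivity) (by positivity),
      ENNReal.ofReal_rpow_of_nonneg hc0 (by positivity), ← ENNReal.ofReal_mul (by positivity)]
    refine mul_le_mul_left (ENNReal.ofReal_le_ofReal ?_) _
    rw [Real.mul_rpow hC.le (by positivity), hc, Real.mul_rpow (by positivity) ht.le,
      Real.mul_rpow (by positivity) (by positivity), ← Real.rpow_mul ht.le, ← Real.rpow_mul ht.le]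
    have : t ^ (-((N : ℝ) / 2 * (q⁻¹).toReal + γ / 2)) =
        t ^ (-(γ * p') / 2 * (1 / p')) * t ^ (-(N : ℝ) / 2 * (1 / p)) := by
      rw [← Real.rpow_add ht, ENNReal.toReal_inv, ← hpdef]
      congr 1
      field_simp
      ring
    rw [this]
    exact le_of_eq (by ring)

/-- Here the kernel is kept in the second Hölder factor. The weight `|x|^γ` is absorbed by the first
factor, uniformly in `t` and `x`, and integrating the second in `x` by Tonelli uses only that the
kernel has mass one. -/
theorem exists_smoothingBound_self {γ : ℝ} {q : ℝ≥0∞} (hN : 1 ≤ N) (hγ : 0 < γ) (hγN : γ < N)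
    (hq : 1 < q) (hq₁ : (q⁻¹).toReal + γ / N < 1) :
    ∃ C : ℝ, 0 < C ∧ SmoothingBound N γ q γ q 0 C := by
  by_cases hqt : q = ⊤
  · subst hqt
    obtain ⟨C, hC, h⟩ := lintegral_gaussKernel_mul_norm_rpow_weight_le hN hγ hγN
    refine ⟨C, hC, fun t ht f hf => ?_⟩
    rw [eLpNorm_exponent_top]
    refine eLpNormEssSup_le_of_ae_enorm_bound (ae_of_all _ fun x => ?_)
    rw [neg_zero, Real.rpow_zero, mul_one, enorm_eq_self]
    refine (mul_le_mul_right (heatMaj_le_mul_top hN x (γ := γ)) _).trans ?_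
    rw [← mul_assoc]
    gcongr
    exact h t ht x
  · obtain ⟨p', hpq, ha, haN⟩ := exists_holderConjugate hN hγ hq hqt hq₁
    obtain ⟨C, hC, h⟩ := lintegral_gaussKernel_mul_norm_rpow_weight_le hN ha haN
    have hp := hpq.symm.pos
    have hp' := hpq.pos
    refine ⟨C ^ (1 / p'), by positivity, fun t ht f hf => ?_⟩
    rw [neg_zero, Real.rpow_zero, mul_one, wNorm_eq_lintegral hq hqt,
      eLpNorm_eq_lintegral_rpow_enorm_toReal (zero_lt_one.trans hq).ne' hqt]
    set p := q.toReal with hpdef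
    set g : EuclideanSpace ℝ (Fin N) → ℝ≥0∞ :=
      fun y => (ENNReal.ofReal (‖y‖ ^ γ) * ‖f y‖ₑ) ^ p with hg
    have hgm : AEMeasurable g volume :=
      ((measurable_norm_rpow _).ennreal_ofReal.aemeasurable.mul hf.enorm).pow_const _
    have hptw : ∀ x : EuclideanSpace ℝ (Fin N),
        ‖ENNReal.ofReal (‖x‖ ^ γ) * heatMaj t f x‖ₑ ^ p ≤
          (ENNReal.ofReal (C ^ (1 / p'))) ^ p *
            ∫⁻ y, ENNReal.ofReal (gaussKernel t (x - y)) * g y := by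
      intro x
      rw [enorm_eq_self]
      have hx : ENNReal.ofReal (‖x‖ ^ γ) = ENNReal.ofReal (‖x‖ ^ (γ * p')) ^ (1 / p') := by
        rw [ENNReal.ofReal_rpow_of_nonneg (by positivity) (by positivity),
          ← Real.rpow_mul (norm_nonneg _)]
        congr 2; field_simp
      have h1 : ENNReal.ofReal (‖x‖ ^ γ) * heatMaj t f x ≤ ENNReal.ofReal (C ^ (1 / p')) *
          (∫⁻ y, ENNReal.ofReal (gaussKernel t (x - y)) * g y) ^ (1 / p) := by
        refine (mul_le_mul_right (heatMaj_le_mul hN hpq hf x (γ := γ)) _).trans ?_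
        rw [← mul_assoc, hx, ← ENNReal.mul_rpow_of_nonneg _ _ (by positivity),
          ← ENNReal.ofReal_rpow_of_nonneg hC.le (by positivity)]
        gcongr
        exact h t ht x
      refine (ENNReal.rpow_le_rpow h1 hp.le).trans (le_of_eq ?_)
      rw [ENNReal.mul_rpow_of_nonneg _ _ hp.le, ← ENNReal.rpow_mul _ (1 / p),
        one_div_mul_cancel hp.ne', ENNReal.rpow_one]
    have hT : ∫⁻ x, ∫⁻ y, ENNReal.ofReal (gaussKernel t (x - y)) * g y = ∫⁻ y, g y := by
      rw [lintegral_lintegral_swap]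
      · refine lintegral_congr fun y => ?_
        rw [lintegral_mul_const _ (by
          have := continuous_gaussKernel (N := N) t
          fun_prop), lintegral_gaussKernel_sub' ht, one_mul]
      · exact (continuous_gaussKernel_sub t).measurable.ennreal_ofReal.aemeasurable.mul
          (hgm.comp_snd)
    refine (ENNReal.rpow_le_rpow (lintegral_mono hptw) (by positivity)).trans (le_of_eq ?_)
    rw [lintegral_const_mul' _ _ (ENNReal.rpow_ne_top_of_nonneg hp.le ENNReal.ofReal_ne_top), hT,
      ENNReal.mul_rpow_of_nonneg _ _ (by positivity), ← ENNReal.rpow_mul, mul_one_div_cancel hp.ne',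
      ENNReal.rpow_one]

theorem one_le_auxExp {α : ℝ} {q : ℝ≥0∞} (hα : 0 < α) (hq : 1 < q) : 1 ≤ auxExp α q := by
  unfold auxExp
  refine one_le_mul (ENNReal.one_le_ofReal.2 (by linarith)) hq.le

/-- Shows `β` to be the pointwise rate times `α / (α + 1)`, the rate that interpolation produces. -/
theorem auxRate_eq {α γ : ℝ} {q : ℝ≥0∞} (hα : 0 < α) :
    auxRate N α γ q = ((N : ℝ) / 2 * (q⁻¹).toReal + γ / 2) * (α / (α + 1)) := by
  have h1 : (ENNReal.ofReal (α + 1) * q)⁻¹.toReal = (α + 1)⁻¹ * (q⁻¹).toReal := by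
    rw [ENNReal.mul_inv (Or.inl (by simp; linarith)) (Or.inl ENNReal.ofReal_ne_top),
      ENNReal.toReal_mul, ENNReal.toReal_inv, ENNReal.toReal_ofReal (by linarith)]
  rw [auxRate, auxExp, auxWeight, h1]
  field_simp
  ring

/-- A fraction `α / (α + 1)` of the power of the majorant is estimated pointwise. The remaining
power `1 / (α + 1)`, together with the weight `|x|^ν = (|x|^γ)^{1/(α+1)}`, has its `L^r` norm equal
to a power of the `L^q_γ` norm, because `r = (α + 1) q`. -/
theorem SmoothingBound.interpolate {α γ ρ C₁ C₂ : ℝ} {q : ℝ≥0∞} (hα : 0 < α) (hγ : 0 < γ)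
    (hC₁ : 0 < C₁) (hC₂ : 0 < C₂) (h₁ : PointwiseBound N γ q ρ C₁)
    (h₂ : SmoothingBound N γ q γ q 0 C₂) :
    SmoothingBound N γ q (auxWeight α γ) (auxExp α q) (ρ * (α / (α + 1)))
      (C₁ ^ (α / (α + 1)) * C₂ ^ (1 / (α + 1))) := by
  intro t ht f hf
  have hα1 : 0 < α + 1 := by linarith
  set W := wNorm γ q f with hW
  set A := ENNReal.ofReal (C₁ * t ^ (-ρ)) * W with hA
  have e1 : ∀ b : ℝ≥0∞, b ^ (α / (α + 1)) * b ^ (1 / (α + 1)) = b := by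
    intro b
    rw [← ENNReal.rpow_add_of_nonneg _ _ (by positivity) (by positivity), ← add_div,
      div_self hα1.ne', ENNReal.rpow_one]
  have hptw : ∀ x : EuclideanSpace ℝ (Fin N),
      ‖ENNReal.ofReal (‖x‖ ^ auxWeight α γ) * heatMaj t f x‖ₑ ≤
      ENNReal.toNNReal (ENNReal.ofReal (C₁ * t ^ (-ρ)) ^ (α / (α + 1))) * W ^ (α / (α + 1)) *
        ‖(‖ENNReal.ofReal (‖x‖ ^ γ) * heatMaj t f x‖ₑ ^ (1 / (α + 1)))‖ₑ := by
    intro x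
    rw [ENNReal.coe_toNNReal (ENNReal.rpow_ne_top_of_nonneg (by positivity) ENNReal.ofReal_ne_top)]
    simp only [enorm_eq_self]
    have hx : ENNReal.ofReal (‖x‖ ^ auxWeight α γ) =
        ENNReal.ofReal (‖x‖ ^ γ) ^ (1 / (α + 1)) := by
      rw [ENNReal.ofReal_rpow_of_nonneg (by positivity) (by positivity),
          ← Real.rpow_mul (norm_nonneg _), auxWeight]
      congr 2; field_simp
    rw [← ENNReal.mul_rpow_of_nonneg _ _ (by positivity : 0 ≤ α / (α + 1)),
      ENNReal.mul_rpow_of_nonneg _ _ (by positivity : 0 ≤ 1 / (α + 1)), hx]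
    calc _ = heatMaj t f x ^ (α / (α + 1)) *
          (ENNReal.ofReal (‖x‖ ^ γ) ^ (1 / (α + 1)) * heatMaj t f x ^ (1 / (α + 1))) := by
          conv_lhs => rw [← e1 (heatMaj t f x)]
          ring
      _ ≤ _ := by
          gcongr
          exact h₁ t ht f hf x
  -- Infinite data make the right side infinite, the constant being positive; in the other case the
  -- factor is a finite number that can be taken out of the norm.
  by_cases hWt : W = ⊤
  · rw [hWt, ENNReal.mul_top]
    · exact le_top
    · simp only [ne_eq, ENNReal.ofReal_eq_zero, not_le]; positivity
  have hWn : W ^ (α / (α + 1)) ≠ ⊤ := ENNReal.rpow_ne_top_of_nonneg (by positivity) hWt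
  set K := ENNReal.toNNReal (ENNReal.ofReal (C₁ * t ^ (-ρ)) ^ (α / (α + 1))) *
    ENNReal.toNNReal (W ^ (α / (α + 1))) with hK
  have h := eLpNorm_le_nnreal_smul_eLpNorm_of_ae_le_mul' (p := auxExp α q) (c := K)
    (μ := (volume : Measure (EuclideanSpace ℝ (Fin N))))
    (f := fun x => ENNReal.ofReal (‖x‖ ^ auxWeight α γ) * heatMaj t f x)
    (g := fun x => ‖ENNReal.ofReal (‖x‖ ^ γ) * heatMaj t f x‖ₑ ^ (1 / (α + 1)))
    (ae_of_all _ fun x => by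
      refine (hptw x).trans (le_of_eq ?_)
      rw [hK, ENNReal.coe_mul, ENNReal.coe_toNNReal hWn])
  refine h.trans ?_
  rw [eLpNorm_enorm_rpow _ (by positivity)]
  have hq : auxExp α q * ENNReal.ofReal (1 / (α + 1)) = q := by
    rw [auxExp, mul_comm, ← mul_assoc, ← ENNReal.ofReal_mul (by positivity),
      one_div_mul_cancel hα1.ne', ENNReal.ofReal_one, one_mul]
  rw [hq]
  have h3 := ENNReal.rpow_le_rpow (h₂ t ht f hf) (show 0 ≤ 1 / (α + 1) by positivity)
  rw [ENNReal.smul_def, smul_eq_mul]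
  refine (mul_le_mul_right h3 _).trans (le_of_eq ?_)
  rw [hK, ENNReal.coe_mul, ENNReal.coe_toNNReal hWn, ENNReal.coe_toNNReal
    (ENNReal.rpow_ne_top_of_nonneg (by positivity) ENNReal.ofReal_ne_top),
    ENNReal.mul_rpow_of_nonneg _ _ (by positivity), ← hW,
    ENNReal.ofReal_rpow_of_nonneg (by positivity) (by positivity),
    ENNReal.ofReal_rpow_of_nonneg (by positivity) (by positivity)]
  calc _ = ENNReal.ofReal ((C₁ * t ^ (-ρ)) ^ (α / (α + 1))) *
        ENNReal.ofReal ((C₂ * t ^ (-(0 : ℝ))) ^ (1 / (α + 1))) *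
        (W ^ (α / (α + 1)) * W ^ (1 / (α + 1))) := by ring
    _ = _ := by
      rw [e1, ← ENNReal.ofReal_mul (by positivity)]
      congr 2
      rw [neg_zero, Real.rpow_zero, mul_one, Real.mul_rpow hC₁.le (by positivity),
        ← Real.rpow_mul ht.le, neg_mul]
      ring

end Smoothing

/-! ### Minkowski's integral inequality -/

section Minkowski

variable {β Ω : Type*} [MeasurableSpace β] [MeasurableSpace Ω] {ν : Measure β} {μ : Measure Ω}

/-- Hölder with the weight `w` gives `(∫ G)^P ≤ W^{P-1} ∫ w^{1-P} G^P`; Tonelli and the bound of the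
norm of `G σ` by `w σ` then yield `W^P`. Positivity and finiteness of `w` serve to cancel its
powers. -/
theorem eLpNorm_lintegral_le_of_ne_zero [SFinite ν] [SFinite μ] {p : ℝ≥0∞} (hp : 1 < p)
    (hpt : p ≠ ⊤) {G : β → Ω → ℝ≥0∞} (hG : Measurable (Function.uncurry G))
    {w : β → ℝ≥0∞} (hw : Measurable w) (hw0 : ∀ σ, w σ ≠ 0) (hW : ∫⁻ σ, w σ ∂ν ≠ ⊤)
    (h : ∀ᵐ σ ∂ν, eLpNorm (G σ) p μ ≤ w σ) :
    eLpNorm (fun x => ∫⁻ σ, G σ x ∂ν) p μ ≤ ∫⁻ σ, w σ ∂ν := by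
  have hp0 : p ≠ 0 := (zero_lt_one.trans hp).ne'
  have hP : 1 < p.toReal := by
    rw [← ENNReal.toReal_one]; exact (ENNReal.toReal_lt_toReal ENNReal.one_ne_top hpt).2 hp
  set P := p.toReal with hPdef
  have hpq := Real.HolderConjugate.conjExponent hP
  set Q := P.conjExponent with hQ
  have hP0 : 0 < P := hpq.pos
  have hQ0 : 0 < Q := hpq.symm.pos
  set W := ∫⁻ σ, w σ ∂ν with hWdef
  have hwt : ∀ᵐ σ ∂ν, w σ < ⊤ := ae_lt_top hw hW
  have hGx : ∀ x, Measurable fun σ => G σ x := fun x => hG.of_uncurry_right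
  have hGσ : ∀ σ, Measurable (G σ) := fun σ => hG.of_uncurry_left
  have hsum : P⁻¹ + Q⁻¹ = 1 := hpq.inv_add_inv_eq_one
  have hPQ : P / Q = P - 1 := by
    field_simp at hsum ⊢; linarith
  have hptw : ∀ x, ‖∫⁻ σ, G σ x ∂ν‖ₑ ^ P ≤
      W ^ (P - 1) * ∫⁻ σ, w σ ^ (-(P - 1)) * G σ x ^ P ∂ν := by
    intro x
    rw [enorm_eq_self]
    have h1 := ENNReal.lintegral_mul_le_Lp_mul_Lq ν hpq
      (f := fun σ => w σ ^ (-(1 / Q)) * G σ x) (g := fun σ => w σ ^ (1 / Q))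
      ((hw.pow_const _).mul (hGx x)).aemeasurable (hw.pow_const _).aemeasurable
    have h2 : ∫⁻ σ, ((fun σ => w σ ^ (-(1 / Q)) * G σ x) * (fun σ => w σ ^ (1 / Q))) σ ∂ν =
        ∫⁻ σ, G σ x ∂ν := by
      refine lintegral_congr_ae (hwt.mono fun σ hσ => ?_)
      have : w σ ^ (-(1 / Q)) * w σ ^ (1 / Q) = 1 := by
        rw [← ENNReal.rpow_add _ _ (hw0 σ) hσ.ne]; simp
      simp only [Pi.mul_apply]
      rw [mul_right_comm, this, one_mul]
    rw [h2] at h1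
    refine (ENNReal.rpow_le_rpow h1 hP0.le).trans (le_of_eq ?_)
    rw [ENNReal.mul_rpow_of_nonneg _ _ hP0.le, ← ENNReal.rpow_mul, ← ENNReal.rpow_mul,
      one_div_mul_cancel hP0.ne', ENNReal.rpow_one, mul_comm, one_div_mul_eq_div, hPQ]
    congr 1
    · congr 1
      refine lintegral_congr fun σ => ?_
      rw [← ENNReal.rpow_mul, one_div_mul_cancel hQ0.ne', ENNReal.rpow_one]
    · refine lintegral_congr fun σ => ?_
      rw [ENNReal.mul_rpow_of_nonneg _ _ hP0.le, ← ENNReal.rpow_mul, neg_mul,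
        one_div_mul_eq_div, hPQ]
  rw [eLpNorm_eq_lintegral_rpow_enorm_toReal hp0 hpt, ← hPdef]
  have hmain : ∫⁻ x, ‖∫⁻ σ, G σ x ∂ν‖ₑ ^ P ∂μ ≤ W ^ P := by
    refine (lintegral_mono hptw).trans ?_
    rw [lintegral_const_mul' _ _ (ENNReal.rpow_ne_top_of_nonneg (by linarith) hW),
      lintegral_lintegral_swap]
    · have : ∀ᵐ σ ∂ν, ∫⁻ x, w σ ^ (-(P - 1)) * G σ x ^ P ∂μ ≤ w σ := by
        filter_upwards [h, hwt] with σ hσ hσt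
        rw [lintegral_const_mul _ ((hGσ σ).pow_const _)]
        rw [eLpNorm_eq_lintegral_rpow_enorm_toReal hp0 hpt, ← hPdef] at hσ
        simp only [enorm_eq_self] at hσ
        have h3 := ENNReal.rpow_le_rpow hσ hP0.le
        rw [← ENNReal.rpow_mul, one_div_mul_cancel hP0.ne', ENNReal.rpow_one] at h3
        refine (mul_le_mul_right h3 _).trans (le_of_eq ?_)
        rw [← ENNReal.rpow_add _ _ (hw0 σ) hσt.ne]
        simp
      refine (mul_le_mul_right (lintegral_mono_ae this) _).trans (le_of_eq ?_)
      rw [← hWdef]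
      conv_lhs => rw [← ENNReal.rpow_one W]
      rw [← ENNReal.rpow_mul, ← ENNReal.rpow_add_of_nonneg _ _ (by linarith) (by linarith)]
      ring_nf
    · refine Measurable.aemeasurable ?_
      refine Measurable.mul ((hw.comp measurable_snd).pow_const _) ?_
      exact (hG.comp measurable_swap).pow_const _
  refine (ENNReal.rpow_le_rpow hmain (by positivity)).trans (le_of_eq ?_)
  rw [← ENNReal.rpow_mul, mul_one_div_cancel hP0.ne', ENNReal.rpow_one]

/-- Minkowski's integral inequality, for a majorized family of functions. -/
theorem eLpNorm_lintegral_le [IsProbabilityMeasure ν] [SFinite μ] {p : ℝ≥0∞} (hp : 1 < p)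
    {G : β → Ω → ℝ≥0∞} (hG : Measurable (Function.uncurry G))
    {w : β → ℝ≥0∞} (hw : Measurable w) (hW : ∫⁻ σ, w σ ∂ν ≠ ⊤)
    (h : ∀ᵐ σ ∂ν, eLpNorm (G σ) p μ ≤ w σ) :
    eLpNorm (fun x => ∫⁻ σ, G σ x ∂ν) p μ ≤ ∫⁻ σ, w σ ∂ν := by
  by_cases hpt : p = ⊤
  · subst hpt
    rw [eLpNorm_exponent_top]
    refine eLpNormEssSup_le_of_ae_enorm_bound ?_
    have h1 : ∀ᵐ σ ∂ν, ∀ᵐ x ∂μ, G σ x ≤ w σ := by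
      filter_upwards [h] with σ hσ
      filter_upwards [ae_le_eLpNormEssSup (μ := μ) (f := G σ)] with x hx
      rw [eLpNorm_exponent_top] at hσ
      exact hx.trans hσ
    have hms : MeasurableSet {z : β × Ω | G z.1 z.2 ≤ w z.1} :=
      measurableSet_le hG (hw.comp measurable_fst)
    rw [Measure.ae_ae_comm hms] at h1
    filter_upwards [h1] with x hx
    rw [enorm_eq_self]
    exact lintegral_mono_ae hx
  -- The majorant `w` may vanish, so it is replaced by `w + ε`; the total mass of `ν` being one,
  -- this costs only `ε`.
  · refine ENNReal.le_of_forall_pos_le_add fun ε hε _ => ?_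
    have e : ∫⁻ σ, (w σ + ε) ∂ν = ∫⁻ σ, w σ ∂ν + ε := by
      rw [lintegral_add_right _ measurable_const, lintegral_const, measure_univ, mul_one]
    rw [← e]
    refine eLpNorm_lintegral_le_of_ne_zero hp hpt hG (hw.add_const _) (fun σ => ?_) ?_ ?_
    · have : (ε : ℝ≥0∞) ≠ 0 := by exact_mod_cast hε.ne'
      simp [hε.ne']
    · rw [e]; exact ENNReal.add_ne_top.2 ⟨hW, ENNReal.coe_ne_top⟩
    · exact h.mono fun σ hσ => hσ.trans le_self_add

theorem ae_lt_top_of_eLpNorm_lt_top {p : ℝ≥0∞} (hp : p ≠ 0) {G : Ω → ℝ≥0∞} (hG : AEMeasurable G μ)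
    (h : eLpNorm G p μ < ⊤) : ∀ᵐ x ∂μ, G x < ⊤ := by
  by_cases hpt : p = ⊤
  · subst hpt
    rw [eLpNorm_exponent_top] at h
    filter_upwards [ae_le_eLpNormEssSup (μ := μ) (f := G)] with x hx
    exact hx.trans_lt h
  · have h1 := (eLpNorm_lt_top_iff_lintegral_rpow_enorm_lt_top hp hpt).1 h
    simp only [enorm_eq_self] at h1
    have h2 := ae_lt_top' (hG.pow_const _) h1.ne
    filter_upwards [h2] with x hx
    exact (ENNReal.rpow_lt_top_iff_of_pos (ENNReal.toReal_pos hp hpt)).1 hx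

end Minkowski

/-! ### Elementary properties of the weighted norms -/

section Norm

variable {N : ℕ} {κ : ℝ} {p : ℝ≥0∞} {f g h : EuclideanSpace ℝ (Fin N) → ℝ}

theorem aestronglyMeasurable_weight_mul (hf : AEStronglyMeasurable f volume) :
    AEStronglyMeasurable (fun x => ‖x‖ ^ κ * f x) volume :=
  (measurable_norm_rpow κ).aestronglyMeasurable.mul hf

theorem wNorm_congr (h : f =ᵐ[volume] g) : wNorm κ p f = wNorm κ p g :=
  eLpNorm_congr_ae (h.mono fun x hx => by simp [hx])

theorem wNorm_mono (h : ∀ᵐ x, ‖f x‖ₑ ≤ ‖g x‖ₑ) : wNorm κ p f ≤ wNorm κ p g := by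
  refine eLpNorm_mono_enorm_ae (h.mono fun x hx => ?_)
  rw [enorm_rpow_norm_mul, enorm_rpow_norm_mul]
  gcongr

theorem wNorm_add_le (hp : 1 ≤ p) (hf : AEStronglyMeasurable f volume)
    (hg : AEStronglyMeasurable g volume) :
    wNorm κ p (fun x => f x + g x) ≤ wNorm κ p f + wNorm κ p g := by
  have := eLpNorm_add_le (p := p) (aestronglyMeasurable_weight_mul (κ := κ) hf)
    (aestronglyMeasurable_weight_mul (κ := κ) hg) hp
  refine le_trans (le_of_eq ?_) this
  unfold wNorm
  congr 1; ext x; simp [mul_add]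

theorem wNorm_neg : wNorm κ p (fun x => -f x) = wNorm κ p f := by
  refine le_antisymm (wNorm_mono ?_) (wNorm_mono ?_) <;> simp

theorem wNorm_sub_comm : wNorm κ p (fun x => f x - g x) = wNorm κ p (fun x => g x - f x) := by
  rw [← wNorm_neg]; simp

theorem wNorm_sub_le (hp : 1 ≤ p) (hf : AEStronglyMeasurable f volume)
    (hg : AEStronglyMeasurable g volume) :
    wNorm κ p (fun x => f x - g x) ≤ wNorm κ p f + wNorm κ p g := by
  rw [← wNorm_neg (f := g)]
  simp only [sub_eq_add_neg]
  exact wNorm_add_le hp hf hg.neg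

theorem wNorm_const_mul (c : ℝ) : wNorm κ p (fun x => c * f x) = ‖c‖ₑ * wNorm κ p f := by
  unfold wNorm
  rw [← eLpNorm_const_smul]
  congr 1; ext x; simp only [Pi.smul_apply, smul_eq_mul]; ring

theorem wNorm_zero : wNorm κ p (fun _ : EuclideanSpace ℝ (Fin N) => (0 : ℝ)) = 0 := by
  simp [wNorm]

/-- Stated for any function dominated by a multiple of the majorant, so that it covers differences
of the heat flow at two times as well as the flow itself. -/
theorem SmoothingBound.wNorm_le {γ : ℝ} {q : ℝ≥0∞} {ρ C t : ℝ} (hS : SmoothingBound N γ q κ p ρ C)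
    (ht : 0 < t) (hf : AEStronglyMeasurable f volume) {c : ℝ≥0∞} (hc : c ≠ ⊤)
    (h : ∀ᵐ x, ‖g x‖ₑ ≤ c * heatMaj t f x) :
    wNorm κ p g ≤ c * (ENNReal.ofReal (C * t ^ (-ρ)) * wNorm γ q f) := by
  refine le_trans ?_ (mul_le_mul_right (hS t ht f hf) c)
  have h1 := eLpNorm_le_nnreal_smul_eLpNorm_of_ae_le_mul' (p := p) (c := c.toNNReal)
    (μ := (volume : Measure (EuclideanSpace ℝ (Fin N))))
    (f := fun x => ‖x‖ ^ κ * g x)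
    (g := fun x => ENNReal.ofReal (‖x‖ ^ κ) * heatMaj t f x)
    (h.mono fun x hx => by
      rw [enorm_rpow_norm_mul, enorm_eq_self, ENNReal.coe_toNNReal hc, mul_left_comm]
      gcongr)
  rwa [ENNReal.smul_def, smul_eq_mul, ENNReal.coe_toNNReal hc] at h1

theorem SmoothingBound.wNorm_heat_le {γ : ℝ} {q : ℝ≥0∞} {ρ C t : ℝ}
    (hS : SmoothingBound N γ q κ p ρ C)
    (ht : 0 < t) (hf : AEStronglyMeasurable f volume) :
    wNorm κ p (heat t f) ≤ ENNReal.ofReal (C * t ^ (-ρ)) * wNorm γ q f := by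
  have := hS.wNorm_le ht hf ENNReal.one_ne_top (g := heat t f)
    (ae_of_all _ fun x => by rw [one_mul]; exact enorm_heat_le ht f x)
  rwa [one_mul] at this

theorem MemW.sub (hp : 1 ≤ p) (hf : MemW κ p f) (hg : MemW κ p g) :
    MemW κ p (fun x => f x - g x) :=
  ⟨hf.1.sub hg.1, (wNorm_sub_le hp hf.1 hg.1).trans_lt (ENNReal.add_lt_top.2 ⟨hf.2, hg.2⟩)⟩

theorem MemW.add (hp : 1 ≤ p) (hf : MemW κ p f) (hg : MemW κ p g) :
    MemW κ p (fun x => f x + g x) :=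
  ⟨hf.1.add hg.1, (wNorm_add_le hp hf.1 hg.1).trans_lt (ENNReal.add_lt_top.2 ⟨hf.2, hg.2⟩)⟩

theorem MemW.const_mul (hf : MemW κ p f) (c : ℝ) : MemW κ p (fun x => c * f x) :=
  ⟨hf.1.const_mul c, by
    rw [wNorm_const_mul]; exact ENNReal.mul_lt_top (by simp) hf.2⟩

theorem MemW.congr (hf : MemW κ p f) (h : f =ᵐ[volume] g) : MemW κ p g :=
  ⟨hf.1.congr h, by rw [← wNorm_congr h]; exact hf.2⟩

end Norm

/-! ### Continuous curves in weighted spaces -/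

section Continuity

variable {N : ℕ} {κ : ℝ} {p : ℝ≥0∞} {I J : Set ℝ} {u v : ℝ → EuclideanSpace ℝ (Fin N) → ℝ}

theorem ContinuousInW.mono (hu : ContinuousInW κ p I u) (h : J ⊆ I) : ContinuousInW κ p J u :=
  ⟨fun t ht => hu.1 t (h ht), fun t ht => (hu.2 t (h ht)).mono_left (nhdsWithin_mono _ h)⟩

theorem ContinuousInW.congr (hu : ContinuousInW κ p I u) (h : ∀ t ∈ I, u t =ᵐ[volume] v t) :
    ContinuousInW κ p I v := by
  refine ⟨fun t ht => (hu.1 t ht).congr (h t ht), fun t ht => (hu.2 t ht).congr' ?_⟩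
  filter_upwards [self_mem_nhdsWithin] with s hs
  refine wNorm_congr ?_
  filter_upwards [h t ht, h s hs] with x h1 h2
  rw [h1, h2]

theorem ContinuousInW.comp (hu : ContinuousInW κ p I u) {φ : ℝ → ℝ} (hφ : ContinuousOn φ J)
    (hm : MapsTo φ J I) : ContinuousInW κ p J (fun s => u (φ s)) :=
  ⟨fun _ ht => hu.1 _ (hm ht), fun t ht =>
    (hu.2 (φ t) (hm ht)).comp ((hφ t ht).tendsto_nhdsWithin hm)⟩

theorem ContinuousInW.add (hp : 1 ≤ p) (hu : ContinuousInW κ p I u) (hv : ContinuousInW κ p I v) :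
    ContinuousInW κ p I (fun t x => u t x + v t x) := by
  refine ⟨fun t ht => (hu.1 t ht).add hp (hv.1 t ht), fun t ht => ?_⟩
  have h := (hu.2 t ht).add (hv.2 t ht)
  rw [add_zero] at h
  refine tendsto_of_tendsto_of_tendsto_of_le_of_le' tendsto_const_nhds h
    (Eventually.of_forall fun _ => zero_le) ?_
  filter_upwards [self_mem_nhdsWithin] with s hs
  refine le_trans (le_of_eq ?_) (wNorm_add_le hp ((hu.1 s hs).1.sub (hu.1 t ht).1)
    ((hv.1 s hs).1.sub (hv.1 t ht).1))
  congr 1; ext x; ring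

theorem ContinuousInW.smul (hp : 1 ≤ p) (hu : ContinuousInW κ p I u) {c : ℝ → ℝ}
    (hc : ContinuousOn c I) : ContinuousInW κ p I (fun t x => c t * u t x) := by
  refine ⟨fun t ht => (hu.1 t ht).const_mul _, fun t ht => ?_⟩
  have h1 : Tendsto (fun s => ‖c s‖ₑ * wNorm κ p (fun x => u s x - u t x)) (𝓝[I] t) (𝓝 0) := by
    have := ENNReal.Tendsto.mul (hc t ht).enorm (Or.inr ENNReal.zero_ne_top) (hu.2 t ht)
      (Or.inr (by simp))
    simpa using this
  have h2 : Tendsto (fun s => ‖c s - c t‖ₑ * wNorm κ p (u t)) (𝓝[I] t) (𝓝 0) := by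
    have h3 : Tendsto (fun s => ‖c s - c t‖ₑ) (𝓝[I] t) (𝓝 0) := by
      have := ((hc t ht).sub (continuousWithinAt_const (b := c t))).enorm.tendsto
      simpa using this
    have := ENNReal.Tendsto.mul_const (b := wNorm κ p (u t)) h3 (Or.inr (hu.1 t ht).2.ne)
    simpa using this
  have h := h1.add h2
  rw [add_zero] at h
  refine tendsto_of_tendsto_of_tendsto_of_le_of_le' tendsto_const_nhds h
    (Eventually.of_forall fun _ => zero_le) ?_
  filter_upwards [self_mem_nhdsWithin] with s hs
  rw [← wNorm_const_mul, ← wNorm_const_mul]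
  refine le_trans (le_of_eq ?_) (wNorm_add_le hp
    (((hu.1 s hs).1.sub (hu.1 t ht).1).const_mul _) ((hu.1 t ht).1.const_mul _))
  congr 1; ext x; ring

theorem ContinuousInW.sub (hp : 1 ≤ p) (hu : ContinuousInW κ p I u) (hv : ContinuousInW κ p I v) :
    ContinuousInW κ p I (fun t x => u t x - v t x) := by
  have := hu.add hp (hv.smul hp (c := fun _ => -1) continuousOn_const)
  refine this.congr fun t _ => ae_of_all _ fun x => ?_
  simp only; ring

theorem ContinuousInW.continuousOn_wNorm (hp : 1 ≤ p) (hu : ContinuousInW κ p I u) :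
    ContinuousOn (fun t => wNorm κ p (u t)) I := by
  intro t ht
  have h := hu.2 t ht
  have h1 := (tendsto_const_nhds (x := wNorm κ p (u t))).add h
  have h2 := ENNReal.Tendsto.sub (tendsto_const_nhds (x := wNorm κ p (u t))) h
    (Or.inr ENNReal.zero_ne_top)
  rw [add_zero] at h1
  rw [tsub_zero] at h2
  refine tendsto_of_tendsto_of_tendsto_of_le_of_le' h2 h1 ?_ ?_
  · filter_upwards [self_mem_nhdsWithin] with s hs
    rw [tsub_le_iff_right, wNorm_sub_comm]
    refine le_trans (le_of_eq ?_) (wNorm_add_le hp (hu.1 s hs).1 ((hu.1 t ht).1.sub (hu.1 s hs).1))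
    congr 1; ext x; simp
  · filter_upwards [self_mem_nhdsWithin] with s hs
    refine le_trans (le_of_eq ?_) (wNorm_add_le hp (hu.1 t ht).1 ((hu.1 s hs).1.sub (hu.1 t ht).1))
    congr 1; ext x; simp

end Continuity

/-! ### Continuity and joint measurability of the heat flow along a curve -/

section TimeContinuity

variable {N : ℕ} {γ κ ρ C : ℝ} {q p : ℝ≥0∞} {f : EuclideanSpace ℝ (Fin N) → ℝ}

theorem PointwiseBound.lt_top {t : ℝ} (hP : PointwiseBound N γ q ρ C) (ht : 0 < t)
    (hf : MemW γ q f) (x : EuclideanSpace ℝ (Fin N)) : heatMaj t f x < ⊤ :=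
  (hP t ht f hf.1 x).trans_lt (ENNReal.mul_lt_top ENNReal.ofReal_lt_top hf.2)

theorem enorm_heat_sub_heat_le_max {s t : ℝ} (hP : PointwiseBound N γ q ρ C) (hs : 0 < s)
    (ht : 0 < t) (hf : MemW γ q f) (x : EuclideanSpace ℝ (Fin N)) :
    ‖heat s f x - heat t f x‖ₑ ≤
      ENNReal.ofReal (timeModulus N (max s t / min s t)) * heatMaj (2 * max s t) f x := by
  rcases le_total s t with h | h
  · rw [max_eq_right h, min_eq_left h, enorm_sub_rev]
    exact enorm_heat_sub_heat_le hs h hf.1 (hP.lt_top hs hf x) (hP.lt_top ht hf x)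
  · rw [max_eq_left h, min_eq_right h]
    exact enorm_heat_sub_heat_le ht h hf.1 (hP.lt_top ht hf x) (hP.lt_top hs hf x)

theorem tendsto_timeModulus_max_div_min {t : ℝ} (ht : 0 < t) :
    Tendsto (fun s => ENNReal.ofReal (timeModulus N (max s t / min s t))) (𝓝 t) (𝓝 0) := by
  have h1 : ContinuousAt (fun s => max s t / min s t) t :=
    ContinuousAt.div (by fun_prop) (by fun_prop) (by simpa using ht.ne')
  have h2 : Tendsto (fun s => max s t / min s t) (𝓝 t) (𝓝 1) := by
    have := h1.tendsto
    simpa [div_self ht.ne'] using this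
  simpa using ENNReal.tendsto_ofReal (tendsto_timeModulus.comp h2)

variable {J : Set ℝ} {g : ℝ → EuclideanSpace ℝ (Fin N) → ℝ} {τ : ℝ → ℝ}

/-- The two summands bound the effect of changing the data and of changing the time. The same
expression controls the heat flow at a point and in norm, according to which constants `C` and `ρ`
are inserted. -/
theorem tendsto_heat_modulus (hg : ContinuousInW γ q J g) (hτ : ContinuousOn τ J)
    (hτ0 : ∀ s ∈ J, 0 < τ s) {t : ℝ} (ht : t ∈ J) :
    Tendsto (fun s => ENNReal.ofReal (C * τ s ^ (-ρ)) * wNorm γ q (fun x => g s x - g t x) +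
      ENNReal.ofReal (timeModulus N (max (τ s) (τ t) / min (τ s) (τ t))) *
        (ENNReal.ofReal (C * (2 * max (τ s) (τ t)) ^ (-ρ)) * wNorm γ q (g t))) (𝓝[J] t) (𝓝 0) := by
  have hτt := hτ0 t ht
  have hτc : Tendsto τ (𝓝[J] t) (𝓝 (τ t)) := hτ t ht
  have h1 : Tendsto (fun s => ENNReal.ofReal (C * τ s ^ (-ρ))) (𝓝[J] t)
      (𝓝 (ENNReal.ofReal (C * τ t ^ (-ρ)))) :=
    ENNReal.tendsto_ofReal ((hτc.rpow_const (Or.inl hτt.ne')).const_mul C)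
  have h2 := ENNReal.Tendsto.mul h1 (Or.inr ENNReal.zero_ne_top) (hg.2 t ht)
    (Or.inr ENNReal.ofReal_ne_top)
  have h3 := (tendsto_timeModulus_max_div_min (N := N) hτt).comp hτc
  have h4 : Tendsto (fun s => ENNReal.ofReal (C * (2 * max (τ s) (τ t)) ^ (-ρ))) (𝓝[J] t)
      (𝓝 (ENNReal.ofReal (C * (2 * max (τ t) (τ t)) ^ (-ρ)))) := by
    refine ENNReal.tendsto_ofReal ((Tendsto.rpow_const ?_ (Or.inl ?_)).const_mul C)
    · exact (hτc.max tendsto_const_nhds).const_mul 2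
    · simp [hτt.ne']
  have h5 := ENNReal.Tendsto.mul_const (b := wNorm γ q (g t)) h4 (Or.inr (hg.1 t ht).2.ne)
  have h6 := ENNReal.Tendsto.mul h3
    (Or.inr (ENNReal.mul_ne_top ENNReal.ofReal_ne_top (hg.1 t ht).2.ne)) h5
    (Or.inr ENNReal.zero_ne_top)
  have := h2.add h6
  simpa using this

theorem continuousOn_heat (hq : 1 ≤ q) (hP : PointwiseBound N γ q ρ C)
    (hg : ContinuousInW γ q J g) (hτ : ContinuousOn τ J) (hτ0 : ∀ s ∈ J, 0 < τ s)
    (x : EuclideanSpace ℝ (Fin N)) : ContinuousOn (fun s => heat (τ s) (g s) x) J := by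
  intro t ht
  refine tendsto_iff_edist_tendsto_0.2 ?_
  refine tendsto_of_tendsto_of_tendsto_of_le_of_le' tendsto_const_nhds
    (tendsto_heat_modulus (C := C) (ρ := ρ) hg hτ hτ0 ht)
    (Eventually.of_forall fun _ => zero_le) ?_
  filter_upwards [self_mem_nhdsWithin] with s hs
  have hd := (hg.1 s hs).sub hq (hg.1 t ht)
  have e : heat (τ s) (g s) x - heat (τ t) (g t) x = heat (τ s) (fun y => g s y - g t y) x +
      (heat (τ s) (g t) x - heat (τ t) (g t) x) := by
    rw [heat_sub (hτ0 s hs) (hg.1 s hs).1 (hg.1 t ht).1 (hP.lt_top (hτ0 s hs) (hg.1 s hs) x)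
      (hP.lt_top (hτ0 s hs) (hg.1 t ht) x)]
    ring
  rw [edist_eq_enorm_sub, e]
  refine (enorm_add_le _ _).trans (add_le_add ?_ ?_)
  · exact (enorm_heat_le (hτ0 s hs) _ x).trans (hP _ (hτ0 s hs) _ hd.1 x)
  · refine (enorm_heat_sub_heat_le_max hP (hτ0 s hs) (hτ0 t ht) (hg.1 t ht) x).trans ?_
    gcongr
    exact hP _ (mul_pos two_pos (lt_max_of_lt_left (hτ0 s hs))) _ (hg.1 t ht).1 x

theorem continuousInW_heat {ρ' C' : ℝ} (hq : 1 ≤ q) (hp : 1 ≤ p) (hP : PointwiseBound N γ q ρ' C')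
    (hS : SmoothingBound N γ q κ p ρ C)
    (hg : ContinuousInW γ q J g) (hτ : ContinuousOn τ J) (hτ0 : ∀ s ∈ J, 0 < τ s) :
    ContinuousInW κ p J (fun s => heat (τ s) (g s)) := by
  refine ⟨fun t ht => ⟨(stronglyMeasurable_heat (hg.1 t ht).1).aestronglyMeasurable,
    (hS.wNorm_heat_le (hτ0 t ht) (hg.1 t ht).1).trans_lt
      (ENNReal.mul_lt_top ENNReal.ofReal_lt_top (hg.1 t ht).2)⟩, fun t ht => ?_⟩
  refine tendsto_of_tendsto_of_tendsto_of_le_of_le' tendsto_const_nhds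
    (tendsto_heat_modulus (C := C) (ρ := ρ) hg hτ hτ0 ht)
    (Eventually.of_forall fun _ => zero_le) ?_
  filter_upwards [self_mem_nhdsWithin] with s hs
  have hd := (hg.1 s hs).sub hq (hg.1 t ht)
  have e : (fun x => heat (τ s) (g s) x - heat (τ t) (g t) x) = fun x =>
      heat (τ s) (fun y => g s y - g t y) x + (heat (τ s) (g t) x - heat (τ t) (g t) x) := by
    ext x
    rw [heat_sub (hτ0 s hs) (hg.1 s hs).1 (hg.1 t ht).1 (hP.lt_top (hτ0 s hs) (hg.1 s hs) x)
      (hP.lt_top (hτ0 s hs) (hg.1 t ht) x)]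
    ring
  have m : ∀ r, AEStronglyMeasurable (heat r (g t)) volume := fun r =>
    (stronglyMeasurable_heat (hg.1 t ht).1).aestronglyMeasurable
  rw [e]
  refine (wNorm_add_le hp (stronglyMeasurable_heat hd.1).aestronglyMeasurable
    ((m _).sub (m _))).trans (add_le_add ?_ ?_)
  · exact hS.wNorm_heat_le (hτ0 s hs) hd.1
  · exact hS.wNorm_le (mul_pos two_pos (lt_max_of_lt_left (hτ0 s hs))) (hg.1 t ht).1
      ENNReal.ofReal_ne_top (ae_of_all _ fun x =>
        enorm_heat_sub_heat_le_max hP (hτ0 s hs) (hτ0 t ht) (hg.1 t ht) x)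

/-- A curve `g` of classes of functions need not be jointly measurable, but its heat flow is a
Carathéodory function: continuous in time at each point and measurable in space at each time. This
is what allows Tonelli in the Duhamel integral. -/
theorem aestronglyMeasurable_heat_prod (hq : 1 ≤ q) (hP : PointwiseBound N γ q ρ C)
    (hJ : MeasurableSet J)
    (hg : ContinuousInW γ q J g) (hτ : ContinuousOn τ J) (hτ0 : ∀ s ∈ J, 0 < τ s) :
    AEStronglyMeasurable (fun z : ℝ × EuclideanSpace ℝ (Fin N) => heat (τ z.1) (g z.1) z.2)
      ((volume.restrict J).prod volume) := by
  have h1 : StronglyMeasurable (Function.uncurry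
      fun (s : J) (x : EuclideanSpace ℝ (Fin N)) => heat (τ s) (g s) x) := by
    refine stronglyMeasurable_uncurry_of_continuous_of_stronglyMeasurable (fun x => ?_) fun s =>
      stronglyMeasurable_heat (hg.1 s s.2).1
    exact continuousOn_iff_continuous_domRestrict.1 (continuousOn_heat hq hP hg hτ hτ0 x)
  have h2 : MeasurableEmbedding (Prod.map (Subtype.val : J → ℝ)
      (id : EuclideanSpace ℝ (Fin N) → _)) :=
    MeasurableEmbedding.prodMap (MeasurableEmbedding.subtype_coe hJ) MeasurableEmbedding.id
  -- The Carathéodory criterion is applied on the subtype of `J`; what follows transports the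
  -- conclusion to the restricted measure.
  have : SigmaFinite (Measure.comap (Subtype.val : J → ℝ) volume) := by
    refine SigmaFinite.of_map _ measurable_subtype_coe.aemeasurable ?_
    rw [map_comap_subtype_coe hJ]; infer_instance
  have h3 : (volume.restrict J).prod (volume : Measure (EuclideanSpace ℝ (Fin N))) =
      Measure.map (Prod.map (Subtype.val : J → ℝ) id)
        ((Measure.comap Subtype.val volume).prod volume) := by
    rw [← Measure.map_prod_map _ _ measurable_subtype_coe measurable_id, Measure.map_id,
      map_comap_subtype_coe hJ]
  rw [h3, h2.aestronglyMeasurable_map_iff]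
  exact h1.aestronglyMeasurable

end TimeContinuity

/-! ### Superpositions over the unit interval and beta integrals -/

section Superposition

variable {N : ℕ} {κ : ℝ} {p : ℝ≥0∞}

theorem isProbabilityMeasure_restrict_Ioo :
    IsProbabilityMeasure ((volume : Measure ℝ).restrict (Ioo 0 1)) :=
  ⟨by simp⟩

/-- Superpositions of functions in `L^p_κ`. -/
theorem wNorm_integral_le (hN : 1 ≤ N) (hp : 1 < p) {F : ℝ → EuclideanSpace ℝ (Fin N) → ℝ}
    (hF : AEStronglyMeasurable (fun z : ℝ × EuclideanSpace ℝ (Fin N) => F z.1 z.2)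
      ((volume.restrict (Ioo 0 1)).prod volume))
    {w : ℝ → ℝ≥0∞} (hw : Measurable w) (hW : ∫⁻ θ in Ioo 0 1, w θ ≠ ⊤)
    (h : ∀ θ ∈ Ioo (0 : ℝ) 1, wNorm κ p (F θ) ≤ w θ) :
    (∀ᵐ x, IntegrableOn (fun θ => F θ x) (Ioo 0 1)) ∧
      MemW κ p (fun x => ∫ θ in Ioo 0 1, F θ x) ∧
      wNorm κ p (fun x => ∫ θ in Ioo 0 1, F θ x) ≤ ∫⁻ θ in Ioo 0 1, w θ := by
  have := isProbabilityMeasure_restrict_Ioo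
  set ν := (volume : Measure ℝ).restrict (Ioo 0 1) with hν
  -- Minkowski's inequality needs genuine joint measurability, hence a measurable version; it agrees
  -- with `F` on almost every slice in either direction.
  set Fm := hF.mk _ with hFm
  have hFmm : StronglyMeasurable Fm := hF.stronglyMeasurable_mk
  have hae : ∀ᵐ z ∂(ν.prod volume), F z.1 z.2 = Fm z := hF.ae_eq_mk
  have hae1 : ∀ᵐ θ ∂ν, ∀ᵐ x, F θ x = Fm (θ, x) := Measure.ae_ae_of_ae_prod hae
  have hae2 : ∀ᵐ x, ∀ᵐ θ ∂ν, F θ x = Fm (θ, x) :=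
    Measure.ae_ae_of_ae_prod (p := fun z => F z.2 z.1 = Fm (z.2, z.1))
      (Measure.measurePreserving_swap.quasiMeasurePreserving.ae hae)
  set G : ℝ → EuclideanSpace ℝ (Fin N) → ℝ≥0∞ :=
    fun θ x => ENNReal.ofReal (‖x‖ ^ κ) * ‖Fm (θ, x)‖ₑ with hG
  have hGm : Measurable (Function.uncurry G) :=
    ((measurable_norm_rpow κ).comp measurable_snd).ennreal_ofReal.mul hFmm.measurable.enorm
  have hGw : ∀ᵐ θ ∂ν, eLpNorm (G θ) p volume ≤ w θ := by
    filter_upwards [hae1, ae_restrict_mem measurableSet_Ioo] with θ h1 h2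
    refine le_trans (le_of_eq ?_) (h θ h2)
    refine eLpNorm_congr_enorm_ae (h1.mono fun x hx => ?_)
    rw [enorm_rpow_norm_mul, enorm_eq_self, hx]
  have hM := eLpNorm_lintegral_le hp hGm hw hW hGw
  have hI : ∀ x : EuclideanSpace ℝ (Fin N),
      ∫⁻ θ, G θ x ∂ν = ENNReal.ofReal (‖x‖ ^ κ) * ∫⁻ θ, ‖Fm (θ, x)‖ₑ ∂ν := fun x =>
    lintegral_const_mul' _ _ ENNReal.ofReal_ne_top
  have hfin := ae_lt_top_of_eLpNorm_lt_top (zero_lt_one.trans hp).ne'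
    hGm.lintegral_prod_left'.aemeasurable (hM.trans_lt hW.lt_top)
  have hle : wNorm κ p (fun x => ∫ θ in Ioo 0 1, F θ x) ≤ ∫⁻ θ in Ioo 0 1, w θ := by
    refine le_trans (eLpNorm_mono_enorm_ae ?_) hM
    filter_upwards [hae2] with x hx
    rw [enorm_rpow_norm_mul, enorm_eq_self, hI]
    gcongr
    refine (enorm_integral_le_lintegral_enorm _).trans (le_of_eq ?_)
    exact lintegral_congr_ae (hx.mono fun θ hθ => by simp only [hθ])
  refine ⟨?_, ⟨hF.prod_swap.integral_prod_right', hle.trans_lt hW.lt_top⟩, hle⟩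
  -- Off the origin the weight is positive, so finiteness of the weighted integral of `|F θ x|`
  -- forces finiteness of the unweighted one.
  filter_upwards [hae2, hfin, ae_norm_pos hN] with x h1 h2 h3
  have h4 : Integrable (fun θ => Fm (θ, x)) ν := by
    refine ⟨(hFmm.comp_measurable measurable_prodMk_right).aestronglyMeasurable, ?_⟩
    rw [hasFiniteIntegral_iff_enorm]
    by_contra hcon
    have h5 : ∫⁻ θ, ‖Fm (θ, x)‖ₑ ∂ν = ⊤ := not_lt_top_iff.1 hcon
    have h6 : ∫⁻ θ, G θ x ∂ν < ⊤ := h2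
    rw [hI, h5, ENNReal.mul_top (by simpa using Real.rpow_pos_of_pos h3 κ)] at h6
    exact lt_irrefl _ h6
  exact h4.congr (h1.mono fun θ hθ => hθ.symm)

/-- The integral `∫₀¹ (1-θ)^{-ρ} θ^{-b} e^{-s(1-θ)} dθ`. -/
noncomputable def betaInt (ρ b s : ℝ) : ℝ≥0∞ :=
  ∫⁻ θ in Ioo (0 : ℝ) 1, ENNReal.ofReal ((1 - θ) ^ (-ρ) * θ ^ (-b) * Real.exp (-(s * (1 - θ))))

theorem betaInt_zero (ρ b : ℝ) :
    betaInt ρ b 0 = ∫⁻ θ in Ioo (0 : ℝ) 1, ENNReal.ofReal ((1 - θ) ^ (-ρ) * θ ^ (-b)) := by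
  simp [betaInt]

/-- On each half of the interval only one factor is singular, and the other is at most `2^ρ` or
`2^b`. -/
theorem betaInt_zero_lt_top {ρ b : ℝ} (hρ0 : 0 ≤ ρ) (hρ : ρ < 1) (hb0 : 0 ≤ b) (hb : b < 1) :
    betaInt ρ b 0 < ⊤ := by
  have h1 : ∀ c : ℝ, c < 1 → IntegrableOn (fun θ : ℝ => θ ^ (-c)) (Ioo 0 1) := fun c hc =>
    (intervalIntegral.integrableOn_Ioo_rpow_iff zero_lt_one).2 (by linarith)
  have h2 : IntegrableOn (fun θ : ℝ => (1 - θ) ^ (-ρ)) (Ioo 0 1) := by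
    have h3 := (intervalIntegrable_iff_integrableOn_Ioo_of_le zero_le_one).2 (h1 ρ hρ)
    have h4 := h3.comp_sub_left 1
    rw [sub_zero, sub_self] at h4
    exact (intervalIntegrable_iff_integrableOn_Ioo_of_le zero_le_one).1 h4.symm
  have h5 : IntegrableOn (fun θ : ℝ => 2 ^ ρ * θ ^ (-b) + 2 ^ b * (1 - θ) ^ (-ρ)) (Ioo 0 1) :=
    ((h1 b hb).const_mul _).add (h2.const_mul _)
  rw [betaInt_zero]
  refine lt_of_le_of_lt ?_ h5.lintegral_lt_top
  refine setLIntegral_mono' measurableSet_Ioo fun θ hθ => ENNReal.ofReal_le_ofReal ?_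
  have hθ1 : 0 < 1 - θ := by linarith [hθ.2]
  have key : ∀ c r : ℝ, 0 ≤ c → 1 / 2 ≤ r → r ^ (-c) ≤ 2 ^ c := by
    intro c r hc hr
    have := Real.rpow_le_rpow_of_nonpos (by norm_num : (0 : ℝ) < 1 / 2) hr (by linarith : -c ≤ 0)
    refine this.trans (le_of_eq ?_)
    rw [one_div, Real.inv_rpow (by norm_num), Real.rpow_neg (by norm_num), inv_inv]
  have p1 : 0 ≤ θ ^ (-b) := Real.rpow_nonneg hθ.1.le _
  have p2 : 0 ≤ (1 - θ) ^ (-ρ) := Real.rpow_nonneg hθ1.le _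
  have p3 : (0 : ℝ) ≤ 2 ^ ρ := by positivity
  have p4 : (0 : ℝ) ≤ 2 ^ b := by positivity
  rcases le_total θ (1 / 2) with h | h
  · have := mul_le_mul_of_nonneg_right (key ρ (1 - θ) hρ0 (by linarith)) p1
    nlinarith [mul_nonneg p4 p2]
  · have := mul_le_mul_of_nonneg_left (key b θ hb0 h) p2
    nlinarith [mul_nonneg p3 p1]

/-- From `e^{-y} ≤ y^{-η}` for `0 < η ≤ 1`: a slightly worse singularity at `θ = 1` buys decay in
`s`. This decay is the source of smallness in the uniqueness proof. -/
theorem betaInt_le_rpow_mul {ρ b η s : ℝ} (hη : 0 < η) (hη1 : η ≤ 1) (hs : 0 < s) :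
    betaInt ρ b s ≤ ENNReal.ofReal (s ^ (-η)) * betaInt (ρ + η) b 0 := by
  rw [betaInt_zero, betaInt, ← lintegral_const_mul' _ _ ENNReal.ofReal_ne_top]
  refine setLIntegral_mono' measurableSet_Ioo fun θ hθ => ?_
  have hθ1 : 0 < 1 - θ := by linarith [hθ.2]
  rw [← ENNReal.ofReal_mul (by positivity)]
  refine ENNReal.ofReal_le_ofReal ?_
  have hx : 0 < s * (1 - θ) := by positivity
  have h1 : Real.exp (-(s * (1 - θ))) ≤ (s * (1 - θ)) ^ (-η) := by
    rw [Real.exp_neg, Real.rpow_neg hx.le]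
    refine inv_anti₀ (by positivity) ?_
    rcases le_total (s * (1 - θ)) 1 with h | h
    · exact (Real.rpow_le_one hx.le h hη.le).trans (Real.one_le_exp hx.le)
    · calc (s * (1 - θ)) ^ η ≤ (s * (1 - θ)) ^ (1 : ℝ) := Real.rpow_le_rpow_of_exponent_le h hη1
        _ = s * (1 - θ) := Real.rpow_one _
        _ ≤ _ := by linarith [Real.add_one_le_exp (s * (1 - θ))]
  have p1 : 0 ≤ θ ^ (-b) := Real.rpow_nonneg hθ.1.le _
  calc (1 - θ) ^ (-ρ) * θ ^ (-b) * Real.exp (-(s * (1 - θ)))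
      ≤ (1 - θ) ^ (-ρ) * θ ^ (-b) * (s * (1 - θ)) ^ (-η) := by gcongr
    _ = _ := by
      rw [Real.mul_rpow hs.le hθ1.le, neg_add, Real.rpow_add hθ1]; ring

end Superposition

/-! ### The Duhamel integral: convergence, bounds and continuity -/

section Duhamel

theorem integrableOn_Ioo_comp_mul_iff {h : ℝ → ℝ} {t : ℝ} (ht : 0 < t) :
    IntegrableOn (fun θ => h (t * θ)) (Ioo 0 1) ↔ IntegrableOn h (Ioo 0 t) := by
  rw [← intervalIntegrable_iff_integrableOn_Ioo_of_le zero_le_one,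
    ← intervalIntegrable_iff_integrableOn_Ioo_of_le ht.le,
    ← IntervalIntegrable.comp_mul_left_iff (f := h) (c := t) ht.ne', zero_div, div_self ht.ne']

theorem setIntegral_Ioo_eq_mul {h : ℝ → ℝ} {t : ℝ} (ht : 0 < t) :
    ∫ σ in Ioo 0 t, h σ = t * ∫ θ in Ioo 0 1, h (t * θ) := by
  rw [← integral_Ioc_eq_integral_Ioo, ← integral_Ioc_eq_integral_Ioo,
    ← intervalIntegral.integral_of_le ht.le, ← intervalIntegral.integral_of_le zero_le_one,
    intervalIntegral.integral_comp_mul_left _ ht.ne', mul_zero, mul_one, smul_eq_mul,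
    mul_inv_cancel_left₀ ht.ne']

variable {N : ℕ} {γ κ ρ ρ' C C' b K T t : ℝ} {q p : ℝ≥0∞}
  {g h : ℝ → EuclideanSpace ℝ (Fin N) → ℝ}

/-- The Duhamel integral `∫₀ᵗ e^{(t-σ)Δ} g(σ) dσ`. -/
noncomputable def duhamel (g : ℝ → EuclideanSpace ℝ (Fin N) → ℝ) (t : ℝ)
    (x : EuclideanSpace ℝ (Fin N)) : ℝ :=
  ∫ σ in Ioo 0 t, heat (t - σ) (g σ) x

/-- Substituting `σ = tθ` puts all times `t` on the same interval with a probability measure, so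
integrands at different times can be compared for each `θ`. -/
theorem duhamel_eq_mul (ht : 0 < t) (x : EuclideanSpace ℝ (Fin N)) :
    duhamel g t x = t * ∫ θ in Ioo 0 1, heat (t * (1 - θ)) (g (t * θ)) x := by
  rw [duhamel, setIntegral_Ioo_eq_mul ht]
  congr 2; ext θ; congr 1; ring

theorem integrableOn_duhamel_iff (ht : 0 < t) (x : EuclideanSpace ℝ (Fin N)) :
    IntegrableOn (fun θ => heat (t * (1 - θ)) (g (t * θ)) x) (Ioo 0 1) ↔
      IntegrableOn (fun σ => heat (t - σ) (g σ) x) (Ioo 0 t) := by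
  rw [← integrableOn_Ioo_comp_mul_iff ht]
  simp only [mul_sub, mul_one]

theorem mapsTo_mul_Ioo (ht : 0 < t) : MapsTo (fun θ => t * θ) (Ioo 0 1) (Ioo 0 t) := fun θ hθ =>
  ⟨mul_pos ht hθ.1, by nlinarith [hθ.2]⟩

theorem aestronglyMeasurable_duhamel_integrand (hq : 1 ≤ q) (hP : PointwiseBound N γ q ρ' C')
    (ht : 0 < t) (hg : ContinuousInW γ q (Ioo 0 t) g) :
    AEStronglyMeasurable (fun z : ℝ × EuclideanSpace ℝ (Fin N) =>
      heat (t * (1 - z.1)) (g (t * z.1)) z.2) ((volume.restrict (Ioo 0 1)).prod volume) :=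
  aestronglyMeasurable_heat_prod (g := fun θ => g (t * θ)) (τ := fun θ => t * (1 - θ)) hq hP
    measurableSet_Ioo (hg.comp (by fun_prop) (mapsTo_mul_Ioo ht)) (by fun_prop)
    fun θ hθ => mul_pos ht (by linarith [hθ.2])

/-- The smoothing bound is integrated under Minkowski's inequality. The growth factor splits as
`e^{lσ} = e^{lt} e^{-lt(1-θ)}`, the last part being the exponential in `betaInt`. Plain estimates
use `l = 0`, uniqueness uses a large `l`. -/
theorem duhamel_bound_aux (hN : 1 ≤ N) (hq : 1 ≤ q) (hp : 1 < p)
    (hP : PointwiseBound N γ q ρ' C') (hS : SmoothingBound N γ q κ p ρ C) (hC : 0 ≤ C)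
    (hK : 0 ≤ K) (ht : 0 < t) {l : ℝ} (hg : ContinuousInW γ q (Ioo 0 t) g)
    (hgK : ∀ σ ∈ Ioo 0 t, wNorm γ q (g σ) ≤ ENNReal.ofReal (K * σ ^ (-b) * Real.exp (l * σ)))
    (hB : betaInt ρ b (l * t) ≠ ⊤) :
    (∀ᵐ x, IntegrableOn (fun σ => heat (t - σ) (g σ) x) (Ioo 0 t)) ∧ MemW κ p (duhamel g t) ∧
      wNorm κ p (duhamel g t) ≤
        ENNReal.ofReal (C * K * t ^ (1 - ρ - b) * Real.exp (l * t)) * betaInt ρ b (l * t) := by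
  -- One power of `t` short of the final constant: the missing factor is the Jacobian of `σ = tθ`,
  -- restored at the end.
  set A : ℝ := C * K * t ^ (-ρ - b) * Real.exp (l * t) with hA
  set w : ℝ → ℝ≥0∞ := fun θ => ENNReal.ofReal A *
    ENNReal.ofReal ((1 - θ) ^ (-ρ) * θ ^ (-b) * Real.exp (-(l * t * (1 - θ)))) with hw
  have hwm : Measurable w := by
    have m1 : Measurable fun θ : ℝ => (1 - θ) ^ (-ρ) :=
      (measurable_const.sub measurable_id).pow_const _
    have m2 : Measurable fun θ : ℝ => θ ^ (-b) := measurable_id.pow_const _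
    fun_prop
  have hwI : ∫⁻ θ in Ioo (0 : ℝ) 1, w θ = ENNReal.ofReal A * betaInt ρ b (l * t) := by
    rw [betaInt, ← lintegral_const_mul' _ _ ENNReal.ofReal_ne_top]
  have hbd : ∀ θ ∈ Ioo (0 : ℝ) 1, wNorm κ p (heat (t * (1 - θ)) (g (t * θ))) ≤ w θ := by
    intro θ hθ
    have hθ1 : 0 < 1 - θ := by linarith [hθ.2]
    have hm := mapsTo_mul_Ioo ht hθ
    refine (hS.wNorm_heat_le (mul_pos ht hθ1) (hg.1 _ hm).1).trans ?_
    refine (mul_le_mul_right (hgK _ hm) _).trans (le_of_eq ?_)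
    have p1 : 0 ≤ θ ^ (-b) := Real.rpow_nonneg hθ.1.le _
    simp only [hw]
    rw [← ENNReal.ofReal_mul (by positivity), ← ENNReal.ofReal_mul (by positivity)]
    congr 1
    rw [hA, Real.mul_rpow ht.le hθ1.le, Real.mul_rpow ht.le hθ.1.le, sub_eq_add_neg (-ρ),
      Real.rpow_add ht]
    have : Real.exp (l * (t * θ)) = Real.exp (l * t) * Real.exp (-(l * t * (1 - θ))) := by
      rw [← Real.exp_add]; congr 1; ring
    rw [this]; ring
  obtain ⟨h1, h2, h3⟩ := wNorm_integral_le hN hp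
    (aestronglyMeasurable_duhamel_integrand hq hP ht hg) hwm
    (by rw [hwI]; exact ENNReal.mul_ne_top ENNReal.ofReal_ne_top hB) hbd
  have hD : duhamel g t = fun x => t * ∫ θ in Ioo 0 1, heat (t * (1 - θ)) (g (t * θ)) x :=
    funext fun x => duhamel_eq_mul ht x
  refine ⟨h1.mono fun x hx => (integrableOn_duhamel_iff ht x).1 hx, ?_, ?_⟩
  · rw [hD]; exact h2.const_mul t
  · rw [hD, wNorm_const_mul, Real.enorm_of_nonneg ht.le]
    refine (mul_le_mul_right h3 _).trans (le_of_eq ?_)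
    rw [hwI, ← mul_assoc, ← ENNReal.ofReal_mul ht.le]
    congr 2
    have : t ^ (1 - ρ - b) = t * t ^ (-ρ - b) := by
      have e : 1 - ρ - b = 1 + (-ρ - b) := by ring
      rw [e, Real.rpow_add ht, Real.rpow_one]
    rw [hA, this]; ring

theorem duhamel_sub_ae (hP : PointwiseBound N γ q ρ' C')
    (hg : ∀ σ ∈ Ioo 0 t, MemW γ q (g σ)) (hh : ∀ σ ∈ Ioo 0 t, MemW γ q (h σ))
    (hgi : ∀ᵐ x, IntegrableOn (fun σ => heat (t - σ) (g σ) x) (Ioo 0 t))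
    (hhi : ∀ᵐ x, IntegrableOn (fun σ => heat (t - σ) (h σ) x) (Ioo 0 t)) :
    (fun x => duhamel g t x - duhamel h t x) =ᵐ[volume]
      duhamel (fun σ x => g σ x - h σ x) t := by
  filter_upwards [hgi, hhi] with x h1 h2
  rw [duhamel, duhamel, duhamel, ← integral_sub h1 h2]
  refine setIntegral_congr_fun measurableSet_Ioo fun σ hσ => ?_
  have hσt : 0 < t - σ := by linarith [hσ.2]
  exact (heat_sub hσt (hg σ hσ).1 (hh σ hσ).1 (hP.lt_top hσt (hg σ hσ) x)
    (hP.lt_top hσt (hh σ hσ) x)).symm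

theorem mapsTo_mul_Ioc {s : ℝ} (hs : s ∈ Ioc 0 T) :
    MapsTo (fun θ => s * θ) (Ioo 0 1) (Ioc 0 T) := fun _ hθ =>
  ⟨mul_pos hs.1 hθ.1, by nlinarith [hθ.2, hθ.1, hs.1, hs.2]⟩

/-- The norm is continuous in `θ` on the open interval, where the curves are controlled; the
indicator discards all other values, about which nothing is known. -/
theorem measurable_indicator_wNorm_sub (hq : 1 ≤ q) (hg : ContinuousInW γ q (Ioc 0 T) g) {s : ℝ}
    (hs : s ∈ Ioc 0 T) (ht : t ∈ Ioc 0 T) :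
    Measurable ((Ioo (0 : ℝ) 1).indicator (fun θ => ENNReal.ofReal ((1 - θ) ^ (-ρ)) *
      wNorm γ q (fun x => g (s * θ) x - g (t * θ) x))) := by
  have hgs := hg.comp (J := Ioo 0 1) (by fun_prop) (mapsTo_mul_Ioc hs)
  have hgt := hg.comp (J := Ioo 0 1) (by fun_prop) (mapsTo_mul_Ioc ht)
  have h := hgs.sub hq hgt
  rw [← piecewise_eq_indicator]
  refine ContinuousOn.measurable_piecewise (fun θ hθ => ?_) continuousOn_const measurableSet_Ioo
  refine ENNReal.Tendsto.mul (ENNReal.tendsto_ofReal ?_) (Or.inr (h.1 θ hθ).2.ne)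
    (h.continuousOn_wNorm hq θ hθ) (Or.inr ENNReal.ofReal_ne_top)
  have : ContinuousAt (fun θ : ℝ => (1 - θ) ^ (-ρ)) θ :=
    ContinuousAt.rpow_const (by fun_prop) (Or.inl (by linarith [hθ.2]))
  exact this.continuousWithinAt

/-- Dominated convergence: for `s > t / 2` both norms are at most a fixed multiple of `θ^{-b}`, and
the resulting majorant is the finite beta integral. -/
theorem tendsto_lintegral_wNorm_sub (hq : 1 ≤ q) (hK : 0 ≤ K) (hρ0 : 0 ≤ ρ) (hρ : ρ < 1)
    (hb0 : 0 ≤ b) (hb : b < 1)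
    (hg : ContinuousInW γ q (Ioc 0 T) g)
    (hgK : ∀ σ ∈ Ioc 0 T, wNorm γ q (g σ) ≤ ENNReal.ofReal (K * σ ^ (-b))) (ht : t ∈ Ioc 0 T) :
    Tendsto (fun s => ∫⁻ θ in Ioo (0 : ℝ) 1, (Ioo (0 : ℝ) 1).indicator
      (fun θ => ENNReal.ofReal ((1 - θ) ^ (-ρ)) *
        wNorm γ q (fun x => g (s * θ) x - g (t * θ) x)) θ) (𝓝[Ioc 0 T] t) (𝓝 0) := by
  have hmaps : ∀ s ∈ Ioc 0 T, MapsTo (fun θ => s * θ) (Ioo 0 1) (Ioc 0 T) :=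
    fun s hs => mapsTo_mul_Ioc hs
  have hz : (0 : ℝ≥0∞) = ∫⁻ _ in Ioo (0 : ℝ) 1, 0 := by simp
  rw [hz]
  have hthalf : 0 < t / 2 := half_pos ht.1
  refine tendsto_lintegral_filter_of_dominated_convergence
    (fun θ => ENNReal.ofReal (2 * K * (t / 2) ^ (-b)) *
      ENNReal.ofReal ((1 - θ) ^ (-ρ) * θ ^ (-b))) ?_ ?_ ?_ ?_
  · filter_upwards [self_mem_nhdsWithin] with s hs
    exact measurable_indicator_wNorm_sub hq hg hs ht
  · filter_upwards [self_mem_nhdsWithin,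
      mem_nhdsWithin_of_mem_nhds (lt_mem_nhds (half_lt_self ht.1))] with s hs hst
    refine (ae_restrict_mem measurableSet_Ioo).mono fun θ hθ => ?_
    rw [indicator_of_mem hθ]
    have hθ1 : 0 < 1 - θ := by linarith [hθ.2]
    have h1 : ∀ r ∈ Ioc 0 T, t / 2 ≤ r →
        wNorm γ q (g (r * θ)) ≤ ENNReal.ofReal (K * ((t / 2) ^ (-b) * θ ^ (-b))) := by
      intro r hr hrt
      refine (hgK _ (hmaps r hr hθ)).trans (ENNReal.ofReal_le_ofReal ?_)
      rw [Real.mul_rpow hr.1.le hθ.1.le]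
      have := Real.rpow_le_rpow_of_nonpos hthalf hrt (by linarith : -b ≤ 0)
      have p1 : 0 ≤ θ ^ (-b) := Real.rpow_nonneg hθ.1.le _
      gcongr
    have p1 : 0 ≤ θ ^ (-b) := Real.rpow_nonneg hθ.1.le _
    have p2 : 0 ≤ (1 - θ) ^ (-ρ) := Real.rpow_nonneg hθ1.le _
    refine (mul_le_mul_right ((wNorm_sub_le hq (hg.1 _ (hmaps s hs hθ)).1
      (hg.1 _ (hmaps t ht hθ)).1).trans (add_le_add (h1 s hs hst.le)
        (h1 t ht (half_le_self ht.1.le)))) _).trans (le_of_eq ?_)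
    rw [← ENNReal.ofReal_add (by positivity) (by positivity), ← ENNReal.ofReal_mul p2,
      ← ENNReal.ofReal_mul (by positivity)]
    congr 1; ring
  · rw [lintegral_const_mul' _ _ ENNReal.ofReal_ne_top, ← betaInt_zero]
    exact ENNReal.mul_ne_top ENNReal.ofReal_ne_top (betaInt_zero_lt_top hρ0 hρ hb0 hb).ne
  · refine (ae_restrict_mem measurableSet_Ioo).mono fun θ hθ => ?_
    simp only [indicator_of_mem hθ]
    have h1 := hg.comp (J := Ioc 0 T) (φ := fun s => s * θ) (by fun_prop) fun s hs => hmaps s hs hθ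
    have := ENNReal.Tendsto.const_mul (a := ENNReal.ofReal ((1 - θ) ^ (-ρ))) (h1.2 t ht)
      (Or.inr ENNReal.ofReal_ne_top)
    simpa using this

/-- For each `θ` the difference of the integrands at times `s` and `t` splits into a change of data
at the same heat time and a change of heat time for the same data. The first is handled by dominated
convergence, the second by the modulus of the kernel. -/
theorem continuousInW_duhamel (hN : 1 ≤ N) (hq : 1 ≤ q) (hp : 1 < p)
    (hP : PointwiseBound N γ q ρ' C') (hS : SmoothingBound N γ q κ p ρ C) (hC : 0 ≤ C)
    (hK : 0 ≤ K) (hρ0 : 0 ≤ ρ) (hρ : ρ < 1) (hb0 : 0 ≤ b) (hb : b < 1)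
    (hg : ContinuousInW γ q (Ioc 0 T) g)
    (hgK : ∀ σ ∈ Ioc 0 T, wNorm γ q (g σ) ≤ ENNReal.ofReal (K * σ ^ (-b))) :
    ContinuousInW κ p (Ioc 0 T) (duhamel g) := by
  have hsub : ∀ t ∈ Ioc 0 T, Ioo 0 t ⊆ Ioc 0 T := fun t ht σ hσ => ⟨hσ.1, hσ.2.le.trans ht.2⟩
  have hmaps : ∀ s ∈ Ioc 0 T, MapsTo (fun θ => s * θ) (Ioo 0 1) (Ioc 0 T) :=
    fun s hs => mapsTo_mul_Ioc hs
  have hbase : ∀ t ∈ Ioc 0 T,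
      (∀ᵐ x, IntegrableOn (fun σ => heat (t - σ) (g σ) x) (Ioo 0 t)) ∧
        MemW κ p (duhamel g t) := by
    intro t ht
    have h := duhamel_bound_aux hN hq hp hP hS hC hK ht.1 (l := 0) (b := b)
      (hg.mono (hsub t ht)) (fun σ hσ => by simpa using hgK σ (hsub t ht hσ))
      (by rw [zero_mul]; exact (betaInt_zero_lt_top hρ0 hρ hb0 hb).ne)
    exact ⟨h.1, h.2.1⟩
  set H : ℝ → EuclideanSpace ℝ (Fin N) → ℝ :=
    fun t x => ∫ θ in Ioo 0 1, heat (t * (1 - θ)) (g (t * θ)) x with hH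
  have hHD : ∀ t ∈ Ioc 0 T, (fun x => t⁻¹ * duhamel g t x) = H t := by
    intro t ht; ext x
    rw [duhamel_eq_mul ht.1, inv_mul_cancel_left₀ ht.1.ne']
  have hHm : ∀ t ∈ Ioc 0 T, MemW κ p (H t) := fun t ht => by
    rw [← hHD t ht]; exact (hbase t ht).2.const_mul _
  -- The scalar factor `t` is continuous, so the integral over the unit interval is all that
  -- matters.
  suffices hHc : ContinuousInW κ p (Ioc 0 T) H by
    refine (hHc.smul hp.le (c := fun t => t) continuousOn_id).congr fun t ht => ?_
    exact ae_of_all _ fun x => (duhamel_eq_mul ht.1 x).symm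
  refine ⟨hHm, fun t ht => ?_⟩
  have hthalf : 0 < t / 2 := half_pos ht.1
  set A₁ := ENNReal.ofReal (C * (t / 2) ^ (-ρ)) with hA₁
  set A₂ := ENNReal.ofReal (C * K * t ^ (-ρ - b)) with hA₂
  set m : ℝ → ℝ → ℝ≥0∞ := fun s => (Ioo (0 : ℝ) 1).indicator
      (fun θ => ENNReal.ofReal ((1 - θ) ^ (-ρ)) *
        wNorm γ q (fun x => g (s * θ) x - g (t * θ) x)) with hm
  set E : ℝ → ℝ≥0∞ := fun s => ENNReal.ofReal (timeModulus N (max s t / min s t)) with hE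
  have hlim1 := tendsto_lintegral_wNorm_sub hq hK hρ0 hρ hb0 hb hg hgK ht
  have hlim2 := (tendsto_timeModulus_max_div_min (N := N) ht.1).mono_left
    (nhdsWithin_le_nhds (s := Ioc 0 T))
  have hBfin := betaInt_zero_lt_top hρ0 hρ hb0 hb
  have hlim : Tendsto (fun s => A₁ * (∫⁻ θ in Ioo (0 : ℝ) 1, m s θ) +
      E s * (A₂ * betaInt ρ b 0)) (𝓝[Ioc 0 T] t) (𝓝 0) := by
    have h1 := ENNReal.Tendsto.const_mul (a := A₁) hlim1 (Or.inr ENNReal.ofReal_ne_top)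
    have h2 := ENNReal.Tendsto.mul_const (b := A₂ * betaInt ρ b 0) hlim2
      (Or.inr (ENNReal.mul_ne_top ENNReal.ofReal_ne_top hBfin.ne))
    simpa only [mul_zero, zero_mul, add_zero] using h1.add h2
  refine tendsto_of_tendsto_of_tendsto_of_le_of_le' tendsto_const_nhds hlim
    (Eventually.of_forall fun _ => zero_le) ?_
  filter_upwards [self_mem_nhdsWithin,
    mem_nhdsWithin_of_mem_nhds (lt_mem_nhds (half_lt_self ht.1)),
    hlim1.eventually (gt_mem_nhds ENNReal.zero_lt_top)] with s hs hst hmfin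
  have hmm : Measurable (m s) := measurable_indicator_wNorm_sub hq hg hs ht
  set w : ℝ → ℝ≥0∞ := fun θ => A₁ * m s θ +
    E s * (A₂ * ENNReal.ofReal ((1 - θ) ^ (-ρ) * θ ^ (-b))) with hw
  have hbm : Measurable fun θ : ℝ => ENNReal.ofReal ((1 - θ) ^ (-ρ) * θ ^ (-b)) := by
    have m1 : Measurable fun θ : ℝ => (1 - θ) ^ (-ρ) :=
      (measurable_const.sub measurable_id).pow_const _
    have m2 : Measurable fun θ : ℝ => θ ^ (-b) := measurable_id.pow_const _
    fun_prop
  have hwm : Measurable w := (hmm.const_mul _).add ((hbm.const_mul _).const_mul _)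
  have hwI : ∫⁻ θ in Ioo (0 : ℝ) 1, w θ = A₁ * (∫⁻ θ in Ioo (0 : ℝ) 1, m s θ) +
      E s * (A₂ * betaInt ρ b 0) := by
    rw [hw, lintegral_add_left (hmm.const_mul _), lintegral_const_mul _ hmm,
      lintegral_const_mul _ (hbm.const_mul _), lintegral_const_mul _ hbm, betaInt_zero]
  have hbd : ∀ θ ∈ Ioo (0 : ℝ) 1, wNorm κ p (fun x =>
      heat (s * (1 - θ)) (g (s * θ)) x - heat (t * (1 - θ)) (g (t * θ)) x) ≤ w θ := by
    intro θ hθ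
    have hθ1 : 0 < 1 - θ := by linarith [hθ.2]
    have p1 : 0 ≤ θ ^ (-b) := Real.rpow_nonneg hθ.1.le _
    have hs1 : 0 < s * (1 - θ) := mul_pos hs.1 hθ1
    have ht1 : 0 < t * (1 - θ) := mul_pos ht.1 hθ1
    have gs := hg.1 _ (hmaps s hs hθ)
    have gt := hg.1 _ (hmaps t ht hθ)
    have e : (fun x => heat (s * (1 - θ)) (g (s * θ)) x - heat (t * (1 - θ)) (g (t * θ)) x) =
        fun x => heat (s * (1 - θ)) (fun y => g (s * θ) y - g (t * θ) y) x +
          (heat (s * (1 - θ)) (g (t * θ)) x - heat (t * (1 - θ)) (g (t * θ)) x) := by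
      ext x
      rw [heat_sub hs1 gs.1 gt.1 (hP.lt_top hs1 gs x) (hP.lt_top hs1 gt x)]
      ring
    have mes : ∀ r, AEStronglyMeasurable (heat r (g (t * θ))) volume := fun r =>
      (stronglyMeasurable_heat gt.1).aestronglyMeasurable
    rw [e]
    refine (wNorm_add_le hp.le (stronglyMeasurable_heat (gs.sub hq gt).1).aestronglyMeasurable
      ((mes _).sub (mes _))).trans (add_le_add ?_ ?_)
    · refine (hS.wNorm_heat_le hs1 (gs.sub hq gt).1).trans ?_
      simp only [hm, indicator_of_mem hθ]
      rw [← mul_assoc, ← ENNReal.ofReal_mul (by positivity)]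
      refine mul_le_mul_left (ENNReal.ofReal_le_ofReal ?_) _
      rw [Real.mul_rpow hs.1.le hθ1.le, ← mul_assoc]
      have := Real.rpow_le_rpow_of_nonpos hthalf hst.le (by linarith : -ρ ≤ 0)
      gcongr
    · refine (hS.wNorm_le (mul_pos two_pos (lt_max_of_lt_left hs1)) gt.1
        ENNReal.ofReal_ne_top (ae_of_all _ fun x =>
          enorm_heat_sub_heat_le_max hP hs1 ht1 gt x)).trans ?_
      -- The ratio of the two heat times does not depend on `θ`, so the modulus comes out of the
      -- integral.
      have hratio : max (s * (1 - θ)) (t * (1 - θ)) / min (s * (1 - θ)) (t * (1 - θ)) =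
          max s t / min s t := by
        rw [← max_mul_of_nonneg _ _ hθ1.le, ← min_mul_of_nonneg _ _ hθ1.le,
          mul_div_mul_right _ _ hθ1.ne']
      rw [hratio]
      refine mul_le_mul_right ?_ _
      refine (mul_le_mul' (ENNReal.ofReal_le_ofReal (mul_le_mul_of_nonneg_left
        (Real.rpow_le_rpow_of_nonpos ht1 ?_ (by linarith : -ρ ≤ 0)) hC))
        (hgK _ (hmaps t ht hθ))).trans (le_of_eq ?_)
      · have := le_max_right (s * (1 - θ)) (t * (1 - θ))
        linarith
      · rw [← ENNReal.ofReal_mul (by positivity), hA₂, ← ENNReal.ofReal_mul (by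
          have := ht.1; positivity)]
        congr 1
        rw [Real.mul_rpow ht.1.le hθ1.le, Real.mul_rpow ht.1.le hθ.1.le, sub_eq_add_neg (-ρ),
          Real.rpow_add ht.1]
        ring
  have hmeas : AEStronglyMeasurable (fun z : ℝ × EuclideanSpace ℝ (Fin N) =>
      heat (s * (1 - z.1)) (g (s * z.1)) z.2 - heat (t * (1 - z.1)) (g (t * z.1)) z.2)
      ((volume.restrict (Ioo 0 1)).prod volume) :=
    (aestronglyMeasurable_duhamel_integrand hq hP hs.1 (hg.mono (hsub s hs))).sub
      (aestronglyMeasurable_duhamel_integrand hq hP ht.1 (hg.mono (hsub t ht)))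
  have hWfin : ∫⁻ θ in Ioo (0 : ℝ) 1, w θ ≠ ⊤ := by
    rw [hwI]
    exact ENNReal.add_ne_top.2 ⟨ENNReal.mul_ne_top ENNReal.ofReal_ne_top (ne_of_lt hmfin),
      ENNReal.mul_ne_top ENNReal.ofReal_ne_top
        (ENNReal.mul_ne_top ENNReal.ofReal_ne_top hBfin.ne)⟩
  obtain ⟨-, -, h3⟩ := wNorm_integral_le hN hp (F := fun θ x =>
    heat (s * (1 - θ)) (g (s * θ)) x - heat (t * (1 - θ)) (g (t * θ)) x) hmeas hwm hWfin hbd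
  rw [hwI] at h3
  refine le_trans (le_of_eq (wNorm_congr ?_)) h3
  filter_upwards [(hbase s hs).1, (hbase t ht).1] with x hx1 hx2
  exact (integral_sub ((integrableOn_duhamel_iff hs.1 x).2 hx1)
    ((integrableOn_duhamel_iff ht.1 x).2 hx2)).symm

end Duhamel

/-! ### The power nonlinearity between weighted spaces -/

section Nonlinearity

/-- Convexity of the power `α + 1`: its graph lies above the tangent at `a`. After dividing by `a`
this is Bernoulli's inequality at `b / a - 1`. -/
theorem rpow_mul_self_sub_le {α a b : ℝ} (hα : 0 < α) (hb : 0 ≤ b) (hab : b ≤ a) :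
    a ^ α * a - b ^ α * b ≤ (α + 1) * a ^ α * (a - b) := by
  rcases eq_or_lt_of_le (hb.trans hab) with h | ha
  · have : b = 0 := by linarith
    simp [← h, this]
  have hs : -1 ≤ b / a - 1 := by have : 0 ≤ b / a := by positivity
                                 linarith
  have h := one_add_mul_self_le_rpow_one_add hs (show 1 ≤ α + 1 by linarith)
  have e : 1 + (b / a - 1) = b / a := by ring
  rw [e, Real.rpow_add_one' (by positivity) (by linarith), Real.div_rpow hb ha.le] at h
  have hp : 0 < a ^ α := by positivity
  have h2 := mul_le_mul_of_nonneg_left h (mul_pos hp ha).le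
  have e2 : a ^ α * a * (b ^ α / a ^ α * (b / a)) = b ^ α * b := by field_simp
  have e3 : a ^ α * a * (1 + (α + 1) * (b / a - 1)) =
      a ^ α * a - (α + 1) * a ^ α * (a - b) := by field_simp; ring
  rw [e2, e3] at h2
  linarith

theorem abs_rpow_mul_sub_le {α : ℝ} (hα : 0 < α) (a b : ℝ) :
    |(|a| ^ α * a - |b| ^ α * b)| ≤ (α + 1) * (|a| + |b|) ^ α * |a - b| := by
  have key : ∀ a b : ℝ, 0 ≤ b → b ≤ a →
      |(a ^ α * a - b ^ α * b)| ≤ (α + 1) * (a + b) ^ α * |a - b| := by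
    intro a b hb hab
    have h0 : b ^ α * b ≤ a ^ α * a :=
      mul_le_mul (Real.rpow_le_rpow hb hab hα.le) hab hb (by have := hb.trans hab; positivity)
    rw [abs_of_nonneg (by linarith), abs_of_nonneg (by linarith)]
    refine (rpow_mul_self_sub_le hα hb hab).trans ?_
    have : a ^ α ≤ (a + b) ^ α := Real.rpow_le_rpow (hb.trans hab) (by linarith) hα.le
    have : 0 ≤ a - b := by linarith
    gcongr
  have key2 : ∀ a b : ℝ, 0 ≤ a → 0 ≤ b →
      |(a ^ α * a - b ^ α * b)| ≤ (α + 1) * (a + b) ^ α * |a - b| := by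
    intro a b ha hb
    rcases le_total b a with h | h
    · exact key a b hb h
    · rw [abs_sub_comm, abs_sub_comm a b, add_comm a b]; exact key b a ha h
  -- For arguments of opposite sign the difference of values is a sum and `|a - b| = |a| + |b|`, so
  -- monotonicity suffices.
  have key3 : ∀ a b : ℝ, 0 ≤ a → 0 ≤ b →
      a ^ α * a + b ^ α * b ≤ (α + 1) * (a + b) ^ α * (a + b) := by
    intro a b ha hb
    have h1 : a ^ α ≤ (a + b) ^ α := Real.rpow_le_rpow ha (by linarith) hα.le
    have h2 : b ^ α ≤ (a + b) ^ α := Real.rpow_le_rpow hb (by linarith) hα.le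
    have h3 : 0 ≤ (a + b) ^ α := by positivity
    nlinarith [mul_le_mul_of_nonneg_right h1 ha, mul_le_mul_of_nonneg_right h2 hb,
      mul_nonneg hα.le (mul_nonneg h3 (add_nonneg ha hb))]
  rcases le_total 0 a with ha | ha <;> rcases le_total 0 b with hb | hb
  · rw [abs_of_nonneg ha, abs_of_nonneg hb]; exact key2 a b ha hb
  · rw [abs_of_nonneg ha, abs_of_nonpos hb, abs_of_nonneg (show 0 ≤ a - b by linarith)]
    have := key3 a (-b) ha (by linarith)
    rw [abs_of_nonneg]
    · rw [sub_eq_add_neg a b]; linarith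
    · have : 0 ≤ a ^ α * a := by positivity
      have : 0 ≤ (-b) ^ α * (-b) := mul_nonneg (Real.rpow_nonneg (by linarith) _) (by linarith)
      linarith
  · rw [abs_of_nonpos ha, abs_of_nonneg hb, abs_sub_comm, abs_sub_comm a b,
      abs_of_nonneg (show 0 ≤ b - a by linarith)]
    have := key3 (-a) b (by linarith) hb
    rw [abs_of_nonneg]
    · have e : b - a = -a + b := by ring
      rw [e]; linarith
    · have : 0 ≤ b ^ α * b := by positivity
      have : 0 ≤ (-a) ^ α * (-a) := mul_nonneg (Real.rpow_nonneg (by linarith) _) (by linarith)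
      linarith
  · rw [abs_of_nonpos ha, abs_of_nonpos hb]
    have := key2 (-a) (-b) (by linarith) (by linarith)
    have e1 : (-a) ^ α * a - (-b) ^ α * b = -((-a) ^ α * (-a) - (-b) ^ α * (-b)) := by ring
    have e2 : a - b = -(-a - -b) := by ring
    rw [e1, abs_neg, e2, abs_neg]; exact this

variable {N : ℕ} {α γ : ℝ} {q : ℝ≥0∞} {f g : EuclideanSpace ℝ (Fin N) → ℝ}

theorem aestronglyMeasurable_nonlin (hα : 0 < α) (hf : AEStronglyMeasurable f volume) :
    AEStronglyMeasurable (nonlin α f) volume := by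
  have hc : Continuous fun r : ℝ => |r| ^ α * r :=
    (continuous_abs.rpow_const fun _ => Or.inr hα.le).mul continuous_id
  exact hc.comp_aestronglyMeasurable hf

/-- This is `α/r + 1/r = 1/q`, the reason for the choice `r = (α + 1) q`; it also covers `q = ∞`. -/
theorem holderTriple_auxExp (hα : 0 < α) :
    ENNReal.HolderTriple (auxExp α q / ENNReal.ofReal α) (auxExp α q) q := by
  constructor
  have h0 : ENNReal.ofReal (α + 1) ≠ 0 := by simp; linarith
  rw [ENNReal.inv_div (Or.inl ENNReal.ofReal_ne_top) (Or.inl (by simpa using hα)),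
    ENNReal.div_eq_inv_mul]
  have : (auxExp α q)⁻¹ * ENNReal.ofReal α + (auxExp α q)⁻¹ =
      (auxExp α q)⁻¹ * ENNReal.ofReal (α + 1) := by
    rw [ENNReal.ofReal_add hα.le zero_le_one, mul_add, ENNReal.ofReal_one, mul_one]
  rw [this, auxExp, ENNReal.mul_inv (Or.inl h0) (Or.inl ENNReal.ofReal_ne_top), mul_right_comm,
    ENNReal.inv_mul_cancel h0 ENNReal.ofReal_ne_top, one_mul]

/-- The weight factors as `|x|^γ = (|x|^ν)^α |x|^ν`, one `|x|^ν` for each of the `α + 1` powers of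
the unknown. The pointwise Lipschitz bound and Hölder with exponents `r/α` and `r` then conclude. -/
theorem wNorm_nonlin_sub_le (hα : 0 < α) (hq : 1 < q)
    (hf : AEStronglyMeasurable f volume) (hg : AEStronglyMeasurable g volume) :
    wNorm γ q (fun x => nonlin α f x - nonlin α g x) ≤
      ENNReal.ofReal (α + 1) *
        (wNorm (auxWeight α γ) (auxExp α q) f + wNorm (auxWeight α γ) (auxExp α q) g) ^ α *
        wNorm (auxWeight α γ) (auxExp α q) (fun x => f x - g x) := by
  have hα1 : 0 < α + 1 := by linarith
  set ν := auxWeight α γ with hν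
  set r := auxExp α q with hr
  have hr1 : 1 ≤ r := one_le_auxExp hα hq
  set U : EuclideanSpace ℝ (Fin N) → ℝ := fun x => ‖x‖ ^ ν * (|f x| + |g x|) with hU
  set V : EuclideanSpace ℝ (Fin N) → ℝ := fun x => ‖x‖ ^ ν * (f x - g x) with hV
  have hUm : AEStronglyMeasurable U volume :=
    aestronglyMeasurable_weight_mul (hf.norm.add hg.norm)
  have hVm : AEStronglyMeasurable V volume := aestronglyMeasurable_weight_mul (hf.sub hg)
  have hUam : AEStronglyMeasurable (fun x => ‖U x‖ ^ α) volume :=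
    (continuous_norm.rpow_const fun _ => Or.inr hα.le).comp_aestronglyMeasurable hUm
  have hptw : ∀ x : EuclideanSpace ℝ (Fin N),
      ‖‖x‖ ^ γ * (nonlin α f x - nonlin α g x)‖ ≤
        (α + 1) * ‖((fun x => ‖U x‖ ^ α) • V) x‖ := by
    intro x
    have hx : ‖x‖ ^ γ = (‖x‖ ^ ν) ^ α * ‖x‖ ^ ν := by
      rw [← Real.rpow_add_one' (by positivity) hα1.ne', ← Real.rpow_mul (norm_nonneg _), hν,
        auxWeight, div_mul_cancel₀ _ hα1.ne']
    have hUx : ‖U x‖ = ‖x‖ ^ ν * (|f x| + |g x|) := Real.norm_of_nonneg (by positivity)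
    rw [Pi.smul_apply', smul_eq_mul, norm_mul, norm_mul, hUx,
      Real.norm_of_nonneg (show (0 : ℝ) ≤ ‖x‖ ^ γ by positivity),
      Real.norm_of_nonneg (show (0 : ℝ) ≤ (‖x‖ ^ ν * (|f x| + |g x|)) ^ α by positivity),
      hV, norm_mul, Real.norm_of_nonneg (show (0 : ℝ) ≤ ‖x‖ ^ ν by positivity),
      Real.norm_eq_abs, Real.norm_eq_abs, Real.mul_rpow (by positivity) (by positivity), hx]
    calc (‖x‖ ^ ν) ^ α * ‖x‖ ^ ν * |nonlin α f x - nonlin α g x|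
        ≤ (‖x‖ ^ ν) ^ α * ‖x‖ ^ ν * ((α + 1) * (|f x| + |g x|) ^ α * |f x - g x|) :=
          mul_le_mul_of_nonneg_left (abs_rpow_mul_sub_le hα _ _) (by positivity)
      _ = _ := by ring
  have := holderTriple_auxExp (q := q) hα
  have h1 := eLpNorm_smul_le_mul_eLpNorm (p := r / ENNReal.ofReal α) (q := r) (r := q) hVm hUam
  have h2 : eLpNorm (fun x => ‖U x‖ ^ α) (r / ENNReal.ofReal α) volume =
      eLpNorm U r volume ^ α := by
    rw [eLpNorm_norm_rpow _ hα,
      ENNReal.div_mul_cancel (by simpa using hα) ENNReal.ofReal_ne_top]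
  have h3 : eLpNorm U r volume ≤ wNorm ν r f + wNorm ν r g := by
    have e : ∀ k : EuclideanSpace ℝ (Fin N) → ℝ, wNorm ν r (fun x => |k x|) ≤ wNorm ν r k :=
      fun k => wNorm_mono (ae_of_all _ fun x => by simp)
    exact (wNorm_add_le (κ := ν) hr1 hf.norm hg.norm).trans (add_le_add (e f) (e g))
  refine (eLpNorm_le_mul_eLpNorm_of_ae_le_mul (ae_of_all _ hptw) q).trans ?_
  rw [mul_assoc]
  gcongr
  refine h1.trans ?_
  rw [h2]
  gcongr
  exact le_rfl

theorem nonlin_zero : nonlin α (fun _ : EuclideanSpace ℝ (Fin N) => (0 : ℝ)) = fun _ => 0 := by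
  ext x; simp [nonlin]

theorem wNorm_nonlin_le (hα : 0 < α) (hq : 1 < q)
    (hf : AEStronglyMeasurable f volume) :
    wNorm γ q (nonlin α f) ≤ ENNReal.ofReal (α + 1) *
        wNorm (auxWeight α γ) (auxExp α q) f ^ α * wNorm (auxWeight α γ) (auxExp α q) f := by
  have := wNorm_nonlin_sub_le (γ := γ) (g := fun _ => 0) hα hq hf aestronglyMeasurable_const
  simpa [nonlin_zero, wNorm_zero] using this

theorem MemW.nonlin (hα : 0 < α) (hq : 1 < q)
    (hf : MemW (auxWeight α γ) (auxExp α q) f) : MemW γ q (nonlin α f) :=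
  ⟨aestronglyMeasurable_nonlin hα hf.1, (wNorm_nonlin_le hα hq hf.1).trans_lt
    (ENNReal.mul_lt_top (ENNReal.mul_lt_top ENNReal.ofReal_lt_top
      (ENNReal.rpow_lt_top_of_nonneg hα.le hf.2.ne)) hf.2)⟩

theorem ContinuousInW.nonlin (hα : 0 < α) (hq : 1 < q) {I : Set ℝ}
    {u : ℝ → EuclideanSpace ℝ (Fin N) → ℝ}
    (hu : ContinuousInW (auxWeight α γ) (auxExp α q) I u) :
    ContinuousInW γ q I (fun t => nonlin α (u t)) := by
  refine ⟨fun t ht => (hu.1 t ht).nonlin hα hq, fun t ht => ?_⟩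
  have hc := (hu.continuousOn_wNorm (one_le_auxExp hα hq) t ht).tendsto
  have h1 := hc.add_const (wNorm (auxWeight α γ) (auxExp α q) (u t))
  have h2 := ENNReal.Tendsto.const_mul (a := ENNReal.ofReal (α + 1)) (h1.ennrpow_const α)
    (Or.inr ENNReal.ofReal_ne_top)
  have hfin := (hu.1 t ht).2.ne
  have h3 := ENNReal.Tendsto.mul h2 (Or.inr ENNReal.zero_ne_top) (hu.2 t ht)
    (Or.inr (ENNReal.mul_ne_top ENNReal.ofReal_ne_top
      (ENNReal.rpow_ne_top_of_nonneg hα.le (ENNReal.add_ne_top.2 ⟨hfin, hfin⟩))))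
  rw [mul_zero] at h3
  refine tendsto_of_tendsto_of_tendsto_of_le_of_le' tendsto_const_nhds h3
    (Eventually.of_forall fun _ => zero_le) ?_
  filter_upwards [self_mem_nhdsWithin] with s hs
  exact wNorm_nonlin_sub_le hα hq (hu.1 s hs).1 (hu.1 t ht).1

end Nonlinearity

/-! ### Strong continuity of the heat flow at time zero for finite exponents -/

section InitialTime

variable {N : ℕ} {γ : ℝ} {q : ℝ≥0∞} {f h : EuclideanSpace ℝ (Fin N) → ℝ}

/-- The weighted norm is the plain `L^q` norm for the measure `|x|^{γq} dx`. That measure is locally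
finite because its density is continuous, so compactly supported continuous functions are dense. -/
theorem exists_continuous_wNorm_sub_le (hγ : 0 < γ) (hq : 1 < q) (hqt : q ≠ ⊤)
    (hf : MemW γ q f) {ε : ℝ≥0∞} (hε : ε ≠ 0) :
    ∃ h : EuclideanSpace ℝ (Fin N) → ℝ, HasCompactSupport h ∧ Continuous h ∧
      wNorm γ q (fun x => f x - h x) ≤ ε := by
  have hq0 : q ≠ 0 := (zero_lt_one.trans hq).ne'
  have hQ : 0 < q.toReal := ENNReal.toReal_pos hq0 hqt
  have hc : Continuous fun x : EuclideanSpace ℝ (Fin N) => ‖x‖ ^ (γ * q.toReal) :=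
    continuous_norm.rpow_const fun _ => Or.inr (by positivity)
  set μ : Measure (EuclideanSpace ℝ (Fin N)) :=
    volume.withDensity fun x => ENNReal.ofReal (‖x‖ ^ (γ * q.toReal)) with hμ
  have : IsLocallyFiniteMeasure μ := IsLocallyFiniteMeasure.withDensity_ofReal hc
  have hac : μ ≪ volume := withDensity_absolutelyContinuous _ _
  have key : ∀ k : EuclideanSpace ℝ (Fin N) → ℝ, AEStronglyMeasurable k volume →
      eLpNorm k q μ = wNorm γ q k := by
    intro k hk
    rw [wNorm_eq_lintegral hq hqt, eLpNorm_eq_lintegral_rpow_enorm_toReal hq0 hqt, hμ,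
      lintegral_withDensity_eq_lintegral_mul₀ hc.measurable.ennreal_ofReal.aemeasurable
        (hk.enorm.pow_const _)]
    congr 1
    refine lintegral_congr fun x => ?_
    rw [ENNReal.mul_rpow_of_nonneg _ _ hQ.le, ENNReal.ofReal_rpow_of_nonneg (by positivity) hQ.le,
      ← Real.rpow_mul (norm_nonneg _)]
    rfl
  have hfL : MemLp f q μ := ⟨hf.1.mono_ac hac, by rw [key f hf.1]; exact hf.2⟩
  obtain ⟨h, h1, h2, h3, -⟩ := hfL.exists_hasCompactSupport_eLpNorm_sub_le hqt hε
  refine ⟨h, h1, h3, ?_⟩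
  rwa [key _ (hf.1.sub h3.aestronglyMeasurable)] at h2

/-- The kernel at time `t` is the kernel at time 1 rescaled by `1/√t`, hence an approximate
identity; the decay condition `|z|^N G(z) → 0` comes from absorbing one power more than `N`. -/
theorem tendsto_heat_of_hasCompactSupport (hh : HasCompactSupport h) (hc : Continuous h)
    (x : EuclideanSpace ℝ (Fin N)) :
    Tendsto (fun t => heat t h x) (𝓝[>] 0) (𝓝 (h x)) := by
  obtain ⟨C, hC, hCb⟩ := norm_rpow_mul_gaussKernel_le (N := N) (a := (N : ℝ) + 1) (by positivity)
  have hdecay : Tendsto (fun z : EuclideanSpace ℝ (Fin N) =>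
      ‖z‖ ^ Module.finrank ℝ (EuclideanSpace ℝ (Fin N)) * gaussKernel 1 z)
      (Bornology.cobounded _) (𝓝 0) := by
    have h1 : Tendsto (fun z : EuclideanSpace ℝ (Fin N) =>
        (C * (4 * Real.pi * (2 * 1)) ^ (-(N : ℝ) / 2)) * ‖z‖⁻¹) (Bornology.cobounded _) (𝓝 0) := by
      have := (tendsto_inv_atTop_zero.comp
        (tendsto_norm_cobounded_atTop (E := EuclideanSpace ℝ (Fin N)))).const_mul
        (C * (4 * Real.pi * (2 * 1)) ^ (-(N : ℝ) / 2))
      rwa [mul_zero] at this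
    refine tendsto_of_tendsto_of_tendsto_of_le_of_le' tendsto_const_nhds h1
      (Eventually.of_forall fun z =>
        mul_nonneg (by positivity) (gaussKernel_nonneg one_pos z)) ?_
    filter_upwards [(tendsto_norm_cobounded_atTop
      (E := EuclideanSpace ℝ (Fin N))).eventually_gt_atTop 0] with z hz
    rw [finrank_euclideanSpace_fin, ← div_eq_mul_inv, le_div_iff₀ hz]
    have h2 := hCb 1 one_pos z
    rw [Real.rpow_add_one hz.ne', Real.rpow_natCast, Real.one_rpow, mul_one] at h2
    calc ‖z‖ ^ N * gaussKernel 1 z * ‖z‖ = ‖z‖ ^ N * ‖z‖ * gaussKernel 1 z := by ring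
      _ ≤ _ := h2
      _ ≤ _ := mul_le_mul_of_nonneg_left (gaussKernel_le (by norm_num) z) hC.le
  have hmain := tendsto_integral_comp_smul_smul_of_integrable' (x₀ := x)
    (fun z => gaussKernel_nonneg one_pos z) (integral_gaussKernel one_pos) hdecay
    (hc.integrable_of_hasCompactSupport hh) hc.continuousAt
  have hsc : Tendsto (fun t : ℝ => (Real.sqrt t)⁻¹) (𝓝[>] 0) atTop := by
    refine tendsto_inv_nhdsGT_zero.comp ?_
    refine tendsto_nhdsWithin_iff.2 ⟨?_, ?_⟩
    · have := (Real.continuous_sqrt.tendsto 0).mono_left (nhdsWithin_le_nhds (s := Ioi 0))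
      simpa using this
    · filter_upwards [self_mem_nhdsWithin] with t ht
      exact Real.sqrt_pos.2 ht
  refine (hmain.comp hsc).congr' ?_
  filter_upwards [self_mem_nhdsWithin] with t (ht : 0 < t)
  refine integral_congr_ae (ae_of_all _ fun y => ?_)
  have hst : 0 < Real.sqrt t := Real.sqrt_pos.2 ht
  simp only [smul_eq_mul, finrank_euclideanSpace_fin]
  congr 1
  unfold gaussKernel
  have hsq : (Real.sqrt t)⁻¹ ^ 2 = t⁻¹ := by rw [inv_pow, Real.sq_sqrt ht.le]
  rw [norm_smul, Real.norm_of_nonneg (by positivity), mul_pow, hsq, ← mul_assoc, inv_pow]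
  congr 1
  · rw [mul_one, Real.mul_rpow (by positivity) ht.le, mul_comm]
    congr 1
    rw [Real.sqrt_eq_rpow, ← Real.rpow_natCast, ← Real.rpow_mul ht.le, ← Real.rpow_neg ht.le]
    congr 1; ring
  · congr 1; field_simp

/-- For times at most 1 the heat flow preserves polynomial decay, by `1 + |x| ≤ (1 + |x - y|)(1 +
|y|)` and absorption of `|x - y|^m` in the kernel. This supplies a majorant independent of time. -/
theorem heatMaj_le_of_decay {m B : ℝ} (hm : 0 < m) (hB : 0 ≤ B) : ∃ D : ℝ, 0 ≤ D ∧
    ∀ h : EuclideanSpace ℝ (Fin N) → ℝ, (∀ y, |h y| * (1 + ‖y‖) ^ m ≤ B) →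
    ∀ t : ℝ, 0 < t → t ≤ 1 → ∀ x, heatMaj t h x ≤ ENNReal.ofReal (D * (1 + ‖x‖) ^ (-m)) := by
  obtain ⟨C, hC, hCb⟩ := norm_rpow_mul_gaussKernel_le (N := N) (a := m) hm
  refine ⟨B * 2 ^ m * (1 + C), by positivity, fun h hh t ht ht1 x => ?_⟩
  have hx : 0 < 1 + ‖x‖ := by positivity
  have hgm : ∀ t, Measurable fun y : EuclideanSpace ℝ (Fin N) =>
      ENNReal.ofReal (gaussKernel t (x - y)) := fun t => measurable_ofReal_gaussKernel_sub t x
  set A := B * 2 ^ m * (1 + ‖x‖) ^ (-m) with hA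
  have hA0 : 0 ≤ A := by positivity
  have hptw : ∀ y, ENNReal.ofReal (gaussKernel t (x - y)) * ‖h y‖ₑ ≤
      ENNReal.ofReal A * (ENNReal.ofReal (gaussKernel t (x - y)) +
        ENNReal.ofReal C * ENNReal.ofReal (gaussKernel (2 * t) (x - y))) := by
    intro y
    have g1 := gaussKernel_nonneg ht (x - y)
    have g2 := gaussKernel_nonneg (show 0 < 2 * t by linarith) (x - y)
    rw [Real.enorm_eq_ofReal_abs, ← ENNReal.ofReal_mul g1, ← ENNReal.ofReal_mul hC.le,
      ← ENNReal.ofReal_add g1 (by positivity), ← ENNReal.ofReal_mul hA0]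
    refine ENNReal.ofReal_le_ofReal ?_
    have hy : 0 < 1 + ‖y‖ := by positivity
    have h1 : |h y| ≤ B * (1 + ‖y‖) ^ (-m) := by
      rw [Real.rpow_neg hy.le, ← div_eq_mul_inv, le_div_iff₀ (by positivity)]; exact hh y
    have h2 : (1 + ‖x‖) ^ m ≤ (1 + ‖x - y‖) ^ m * (1 + ‖y‖) ^ m := by
      rw [← Real.mul_rpow (by positivity) (by positivity)]
      refine Real.rpow_le_rpow hx.le ?_ hm.le
      have : ‖x‖ ≤ ‖x - y‖ + ‖y‖ := by simpa using norm_add_le (x - y) y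
      nlinarith [norm_nonneg (x - y), norm_nonneg y]
    have h3 : (1 + ‖x - y‖) ^ m ≤ 2 ^ m * (1 + ‖x - y‖ ^ m) := by
      have h4 : 1 + ‖x - y‖ ≤ 2 * max 1 ‖x - y‖ := by
        linarith [le_max_left 1 ‖x - y‖, le_max_right 1 ‖x - y‖]
      refine (Real.rpow_le_rpow (by positivity) h4 hm.le).trans ?_
      rw [Real.mul_rpow (by norm_num) (by positivity)]
      gcongr
      rcases le_total 1 ‖x - y‖ with h | h
      · rw [max_eq_right h]; linarith
      · rw [max_eq_left h, Real.one_rpow]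
        linarith [Real.rpow_nonneg (norm_nonneg (x - y)) m]
    have h5 : ‖x - y‖ ^ m * gaussKernel t (x - y) ≤ C * gaussKernel (2 * t) (x - y) := by
      refine (hCb t ht (x - y)).trans ?_
      gcongr
      exact mul_le_of_le_one_right hC.le (Real.rpow_le_one ht.le ht1 (by positivity))
    have h6 : (1 + ‖y‖) ^ (-m) ≤ (1 + ‖x‖) ^ (-m) * (1 + ‖x - y‖) ^ m := by
      rw [Real.rpow_neg hy.le, Real.rpow_neg hx.le, inv_mul_eq_div, le_div_iff₀ (by positivity),
        inv_mul_le_iff₀ (by positivity), mul_comm]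
      exact h2
    calc gaussKernel t (x - y) * |h y|
        ≤ gaussKernel t (x - y) * (B * ((1 + ‖x‖) ^ (-m) * (2 ^ m * (1 + ‖x - y‖ ^ m)))) := by
          gcongr
          refine h1.trans ?_
          gcongr
          refine h6.trans ?_
          gcongr
      _ = A * (gaussKernel t (x - y) + ‖x - y‖ ^ m * gaussKernel t (x - y)) := by
          rw [hA]; ring
      _ ≤ _ := by gcongr
  refine (lintegral_mono hptw).trans (le_of_eq ?_)
  rw [lintegral_const_mul' _ _ ENNReal.ofReal_ne_top, lintegral_add_left (hgm t),
    lintegral_const_mul' _ _ ENNReal.ofReal_ne_top, lintegral_gaussKernel_sub ht,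
    lintegral_gaussKernel_sub (by linarith), mul_one, ← ENNReal.ofReal_one,
    ← ENNReal.ofReal_add zero_le_one hC.le, ← ENNReal.ofReal_mul hA0]
  congr 1; rw [hA]; ring

theorem tendsto_wNorm_heat_sub_of_hasCompactSupport (hγ : 0 < γ) (hq : 1 < q) (hqt : q ≠ ⊤)
    (hh : HasCompactSupport h) (hc : Continuous h) :
    Tendsto (fun t => wNorm γ q (fun x => heat t h x - h x)) (𝓝[>] 0) (𝓝 0) := by
  have hq0 : q ≠ 0 := (zero_lt_one.trans hq).ne'
  have hQ1 : 1 < q.toReal := by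
    rw [← ENNReal.toReal_one]; exact (ENNReal.toReal_lt_toReal ENNReal.one_ne_top hqt).2 hq
  set Q := q.toReal with hQdef
  have hQ : 0 < Q := zero_lt_one.trans hQ1
  -- After multiplication by `|x|^γ` there remains decay of order `N + 1`, whose power `Q > 1` is
  -- integrable.
  set m : ℝ := γ + N + 1 with hm
  have hm0 : 0 < m := by positivity
  have hcw : Continuous fun y : EuclideanSpace ℝ (Fin N) => h y * (1 + ‖y‖) ^ m :=
    hc.mul ((continuous_const.add continuous_norm).rpow_const fun y => Or.inr hm0.le)
  obtain ⟨B, hB⟩ := hcw.bounded_above_of_compact_support hh.mul_right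
  have hB' : ∀ y, |h y| * (1 + ‖y‖) ^ m ≤ B := by
    intro y
    have := hB y
    rwa [norm_mul, Real.norm_eq_abs, Real.norm_of_nonneg (by positivity)] at this
  have hB0 : 0 ≤ B := (by positivity : 0 ≤ |h 0| * (1 + ‖(0 : EuclideanSpace ℝ (Fin N))‖) ^ m).trans
    (hB' 0)
  obtain ⟨D, hD, hDb⟩ := heatMaj_le_of_decay (N := N) hm0 hB0
  have hlim : Tendsto (fun t => ∫⁻ x, (ENNReal.ofReal (‖x‖ ^ γ) * ‖heat t h x - h x‖ₑ) ^ Q)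
      (𝓝[>] 0) (𝓝 (∫⁻ _ : EuclideanSpace ℝ (Fin N), 0)) := by
    refine tendsto_lintegral_filter_of_dominated_convergence
      (fun x => ENNReal.ofReal (((D + B) ^ Q) * (1 + ‖x‖) ^ (-((N + 1 : ℝ) * Q)))) ?_ ?_ ?_ ?_
    · refine Eventually.of_forall fun t => ?_
      exact ((measurable_norm_rpow _).ennreal_ofReal.mul
        ((stronglyMeasurable_heat hc.aestronglyMeasurable).measurable.sub
          hc.measurable).enorm).pow_const _
    · have hev : ∀ᶠ t : ℝ in 𝓝[>] 0, t ≤ 1 :=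
        mem_nhdsWithin_of_mem_nhds (Iic_mem_nhds zero_lt_one)
      filter_upwards [self_mem_nhdsWithin, hev] with t ht ht1
      refine ae_of_all _ fun x => ?_
      have hx : 0 < 1 + ‖x‖ := by positivity
      have h1 : ‖heat t h x - h x‖ₑ ≤ ENNReal.ofReal ((D + B) * (1 + ‖x‖) ^ (-m)) := by
        refine enorm_sub_le.trans ?_
        rw [add_mul, ENNReal.ofReal_add (by positivity) (by positivity)]
        refine add_le_add ((enorm_heat_le ht h x).trans (hDb h hB' t ht ht1 x)) ?_
        rw [Real.enorm_eq_ofReal_abs]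
        refine ENNReal.ofReal_le_ofReal ?_
        rw [Real.rpow_neg hx.le, ← div_eq_mul_inv, le_div_iff₀ (by positivity)]; exact hB' x
      refine (ENNReal.rpow_le_rpow (mul_le_mul_right h1 _) hQ.le).trans ?_
      rw [← ENNReal.ofReal_mul (by positivity), ENNReal.ofReal_rpow_of_nonneg (by positivity) hQ.le]
      refine ENNReal.ofReal_le_ofReal ?_
      have h2 : ‖x‖ ^ γ * ((D + B) * (1 + ‖x‖) ^ (-m)) ≤ (D + B) * (1 + ‖x‖) ^ (-(N + 1 : ℝ)) := by
        have h3 : ‖x‖ ^ γ ≤ (1 + ‖x‖) ^ γ :=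
          Real.rpow_le_rpow (norm_nonneg _) (by linarith) hγ.le
        have h4 : (1 + ‖x‖) ^ (-(N + 1 : ℝ)) = (1 + ‖x‖) ^ γ * (1 + ‖x‖) ^ (-m) := by
          rw [← Real.rpow_add hx]; congr 1; rw [hm]; ring
        rw [h4]
        calc _ ≤ (1 + ‖x‖) ^ γ * ((D + B) * (1 + ‖x‖) ^ (-m)) := by gcongr
          _ = _ := by ring
      refine (Real.rpow_le_rpow (by positivity) h2 hQ.le).trans (le_of_eq ?_)
      rw [Real.mul_rpow (by positivity) (by positivity), ← Real.rpow_mul hx.le, neg_mul]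
    · have : Integrable fun x : EuclideanSpace ℝ (Fin N) => (1 + ‖x‖) ^ (-((N + 1 : ℝ) * Q)) := by
        refine integrable_one_add_norm ?_
        rw [finrank_euclideanSpace_fin]
        nlinarith [show (0 : ℝ) ≤ N from Nat.cast_nonneg N]
      exact (this.const_mul _).lintegral_lt_top.ne
    · refine ae_of_all _ fun x => ?_
      have h1 := (tendsto_heat_of_hasCompactSupport hh hc x).sub_const (h x)
      have h2 := ENNReal.Tendsto.const_mul (a := ENNReal.ofReal (‖x‖ ^ γ)) h1.enorm
        (Or.inr ENNReal.ofReal_ne_top)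
      have h3 := h2.ennrpow_const Q
      simpa [ENNReal.zero_rpow_of_pos hQ] using h3
  have h4 := hlim.ennrpow_const (1 / Q)
  simp_rw [wNorm_eq_lintegral hq hqt]
  simpa [ENNReal.zero_rpow_of_pos (inv_pos.2 hQ)] using h4

theorem tendsto_wNorm_heat_sub (hγ : 0 < γ) (hq : 1 < q) (hqt : q ≠ ⊤)
    {C ρ' C' : ℝ} (hP : PointwiseBound N γ q ρ' C') (hS : SmoothingBound N γ q γ q 0 C)
    (hf : MemW γ q f) :
    Tendsto (fun t => wNorm γ q (fun x => heat t f x - f x)) (𝓝[>] 0) (𝓝 0) := by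
  refine ENNReal.tendsto_nhds_zero.2 fun ε hε => ?_
  set c := ENNReal.ofReal C with hc
  have hc2 : c + 2 ≠ ⊤ := by simp [hc]
  -- The error is counted `c` times for the heat flow of `f - h`, once for `h` and once for `f - h`.
  -- The minimum with 1 keeps `δ` finite when `ε = ∞`.
  set δ := min (ε / (c + 2)) 1 with hδ
  have hδ0 : δ ≠ 0 := (lt_min (ENNReal.div_pos hε.ne' hc2) one_pos).ne'
  have hδt : δ < ⊤ := (min_le_right _ _).trans_lt ENNReal.one_lt_top
  obtain ⟨h, hh, hcont, hle⟩ := exists_continuous_wNorm_sub_le hγ hq hqt hf hδ0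
  have hhm : AEStronglyMeasurable h volume := hcont.aestronglyMeasurable
  have hfh : MemW γ q (fun x => f x - h x) := ⟨hf.1.sub hhm, hle.trans_lt hδt⟩
  have hhW : MemW γ q h := by simpa using hf.sub hq.le hfh
  have hlim := tendsto_wNorm_heat_sub_of_hasCompactSupport hγ hq hqt hh hcont
  filter_upwards [self_mem_nhdsWithin, (ENNReal.tendsto_nhds_zero.1 hlim) δ
    (pos_iff_ne_zero.2 hδ0)] with t (ht : 0 < t) hth
  have e : (fun x => heat t f x - f x) = fun x =>
      heat t (fun y => f y - h y) x + ((heat t h x - h x) - (f x - h x)) := by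
    ext x
    rw [heat_sub ht hf.1 hhm (hP.lt_top ht hf x) (hP.lt_top ht hhW x)]
    ring
  have m1 : AEStronglyMeasurable (fun x => heat t h x - h x) volume :=
    (stronglyMeasurable_heat hhm).aestronglyMeasurable.sub hhm
  have hb := hS.wNorm_heat_le ht hfh.1
  rw [neg_zero, Real.rpow_zero, mul_one] at hb
  rw [e]
  calc _ ≤ c * δ + (δ + δ) :=
        (wNorm_add_le hq.le (stronglyMeasurable_heat hfh.1).aestronglyMeasurable
          (m1.sub hfh.1)).trans (add_le_add (hb.trans (mul_le_mul_right hle _))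
            ((wNorm_sub_le hq.le m1 hfh.1).trans (add_le_add hth hle)))
    _ = (c + 2) * δ := by ring
    _ ≤ (c + 2) * (ε / (c + 2)) := mul_le_mul_right (min_le_left _ _) _
    _ ≤ ε := ENNReal.mul_div_le

end InitialTime

/-! ### Constants and the function class of the fixed point argument -/

/-- The smoothing estimates behind the fixed point argument, with `β = auxRate N α γ q`. -/
structure Estimates (N : ℕ) (α γ : ℝ) (q : ℝ≥0∞) (β ρ C C₀ C₁ : ℝ) : Prop where
  one_le_dim : 1 ≤ N
  pow_pos : 0 < α
  weight_pos : 0 < γ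
  one_lt : 1 < q
  rate_eq : β = auxRate N α γ q
  rate_pos : 0 < β
  rate_lt : β * (α + 1) < 1
  pointwise : PointwiseBound N γ q ρ C
  const_self_pos : 0 < C₀
  smoothing_self : SmoothingBound N γ q γ q 0 C₀
  const_aux_pos : 0 < C₁
  smoothing_aux : SmoothingBound N γ q (auxWeight α γ) (auxExp α q) β C₁

/-- The condition `β (α + 1) < 1` is the second condition on `q`, because `β (α + 1)` equals `α`
times the pointwise rate. -/
theorem exists_estimates {N : ℕ} {α γ : ℝ} {q : ℝ≥0∞} (hN : 1 ≤ N) (hα : 0 < α)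
    (hγ : 0 < γ) (hγN : γ < N) (hq : 1 < q) (hq₁ : (q⁻¹).toReal + γ / N < 1)
    (hq₂ : N * α / 2 * (q⁻¹).toReal + α * γ / 2 < 1) :
    ∃ ρ C C₀ C₁ : ℝ, Estimates N α γ q (auxRate N α γ q) ρ C C₀ C₁ := by
  obtain ⟨C, hC, hP⟩ := exists_pointwiseBound hN hγ hγN hq hq₁
  obtain ⟨C₀, hC₀, hS⟩ := exists_smoothingBound_self hN hγ hγN hq hq₁
  have hi := SmoothingBound.interpolate hα hγ hC hC₀ hP hS
  rw [← auxRate_eq hα] at hi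
  refine ⟨_, C, C₀, _, hN, hα, hγ, hq, rfl, ?_, ?_, hP, hC₀, hS, by positivity, hi⟩
  · rw [auxRate_eq hα]
    have : 0 ≤ (q⁻¹).toReal := ENNReal.toReal_nonneg
    positivity
  · rw [auxRate_eq hα, mul_assoc, div_mul_cancel₀ _ (by linarith)]
    linarith

/-- The class of functions on `(0, T]` in which the fixed point argument takes place. -/
def AuxClass {N : ℕ} (α γ : ℝ) (q : ℝ≥0∞) (β M T : ℝ)
    (u : ℝ → EuclideanSpace ℝ (Fin N) → ℝ) : Prop :=
  ContinuousInW (auxWeight α γ) (auxExp α q) (Ioc 0 T) u ∧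
    ∀ t ∈ Ioc 0 T, wNorm (auxWeight α γ) (auxExp α q) (u t) ≤ ENNReal.ofReal (M * t ^ (-β))

/-- The Duhamel term of the mild formulation. -/
noncomputable def nonlinDuhamel {N : ℕ} (α : ℝ) (u : ℝ → EuclideanSpace ℝ (Fin N) → ℝ) :
    ℝ → EuclideanSpace ℝ (Fin N) → ℝ :=
  duhamel fun σ => nonlin α (u σ)

/-! ### Nonlinear Duhamel estimates, uniqueness, and solutions from fixed points -/

section Estimates

variable {N : ℕ} {α γ β ρ C C₀ C₁ M M' T d l t : ℝ} {q : ℝ≥0∞}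
  {u v : ℝ → EuclideanSpace ℝ (Fin N) → ℝ} {u₀ : EuclideanSpace ℝ (Fin N) → ℝ}

theorem AuxClass.mono (hu : AuxClass α γ q β M T u) (h : M ≤ M') : AuxClass α γ q β M' T u :=
  ⟨hu.1, fun t ht => (hu.2 t ht).trans (ENNReal.ofReal_le_ofReal
    (mul_le_mul_of_nonneg_right h (Real.rpow_nonneg ht.1.le _)))⟩

theorem Ioo_subset_Ioc_of_mem (ht : t ∈ Ioc 0 T) : Ioo 0 t ⊆ Ioc 0 T := fun _ hσ =>
  ⟨hσ.1, hσ.2.le.trans ht.2⟩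

/-- Each of the `α + 1` factors decays like `t^{-β}`, so the source term has the integrable
singularity `t^{-β(α+1)}`. The exponential factor of the difference is simply carried along. -/
theorem Estimates.wNorm_nonlin_sub_le (h : Estimates N α γ q β ρ C C₀ C₁) (hM : 0 ≤ M)
    (hu : AuxClass α γ q β M T u) (hv : AuxClass α γ q β M T v) (ht : t ∈ Ioc 0 T)
    (huv : wNorm (auxWeight α γ) (auxExp α q) (fun x => u t x - v t x) ≤
      ENNReal.ofReal (d * t ^ (-β) * Real.exp (l * t))) :
    wNorm γ q (fun x => nonlin α (u t) x - nonlin α (v t) x) ≤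
      ENNReal.ofReal ((α + 1) * (2 * M) ^ α * d * t ^ (-(β * (α + 1))) * Real.exp (l * t)) := by
  have hα := h.pow_pos
  have ht0 := ht.1
  refine (WeightedHeat.wNorm_nonlin_sub_le hα h.one_lt (hu.1.1 t ht).1 (hv.1.1 t ht).1).trans ?_
  refine (mul_le_mul' (mul_le_mul_right (ENNReal.rpow_le_rpow
    (add_le_add (hu.2 t ht) (hv.2 t ht)) hα.le) _) huv).trans (le_of_eq ?_)
  rw [← ENNReal.ofReal_add (by positivity) (by positivity),
    ENNReal.ofReal_rpow_of_nonneg (by positivity) hα.le, ← ENNReal.ofReal_mul (by positivity),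
    ← ENNReal.ofReal_mul (by positivity)]
  congr 1
  have e1 : M * t ^ (-β) + M * t ^ (-β) = 2 * M * t ^ (-β) := by ring
  have e2 : t ^ (-(β * (α + 1))) = t ^ (-β * α) * t ^ (-β) := by
    rw [← Real.rpow_add ht0]; congr 1; ring
  rw [e1, Real.mul_rpow (by positivity) (by positivity), ← Real.rpow_mul ht0.le, e2]
  ring

theorem auxClass_zero :
    AuxClass α γ q β M T fun _ (_ : EuclideanSpace ℝ (Fin N)) => (0 : ℝ) := by
  refine ⟨⟨fun t _ => ⟨aestronglyMeasurable_const, by simp [wNorm_zero]⟩, fun t _ => ?_⟩,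
    fun t _ => by simp [wNorm_zero]⟩
  simpa [wNorm_zero] using tendsto_const_nhds

theorem Estimates.wNorm_nonlin_le (h : Estimates N α γ q β ρ C C₀ C₁) (hM : 0 ≤ M)
    (hu : AuxClass α γ q β M T u) (ht : t ∈ Ioc 0 T) :
    wNorm γ q (nonlin α (u t)) ≤
      ENNReal.ofReal ((α + 1) * (2 * M) ^ α * M * t ^ (-(β * (α + 1)))) := by
  have := h.wNorm_nonlin_sub_le (l := 0) hM hu auxClass_zero ht
    (by simpa using hu.2 t ht)
  simpa [nonlin_zero] using this

theorem Estimates.one_le_auxExp (h : Estimates N α γ q β ρ C C₀ C₁) : 1 ≤ auxExp α q :=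
  WeightedHeat.one_le_auxExp h.pow_pos h.one_lt

theorem Estimates.one_lt_auxExp (h : Estimates N α γ q β ρ C C₀ C₁) : 1 < auxExp α q :=
  h.one_lt.trans_le (le_mul_of_one_le_left zero_le
    (ENNReal.one_le_ofReal.2 (by linarith [h.pow_pos])))

theorem Estimates.rate_mul_pos (h : Estimates N α γ q β ρ C C₀ C₁) : 0 < β * (α + 1) :=
  mul_pos h.rate_pos (by linarith [h.pow_pos])

theorem Estimates.rate_lt_rate_mul (h : Estimates N α γ q β ρ C C₀ C₁) : β < β * (α + 1) := by
  nlinarith [mul_pos h.rate_pos h.pow_pos]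

theorem Estimates.betaInt_self_lt_top (h : Estimates N α γ q β ρ C C₀ C₁) :
    betaInt 0 (β * (α + 1)) 0 < ⊤ :=
  betaInt_zero_lt_top le_rfl one_pos h.rate_mul_pos.le h.rate_lt

theorem Estimates.betaInt_aux_lt_top (h : Estimates N α γ q β ρ C C₀ C₁) :
    betaInt β (β * (α + 1)) 0 < ⊤ :=
  betaInt_zero_lt_top h.rate_pos.le (h.rate_lt_rate_mul.trans h.rate_lt) h.rate_mul_pos.le
    h.rate_lt

theorem AuxClass.continuousInW_nonlin (hu : AuxClass α γ q β M T u)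
    (h : Estimates N α γ q β ρ C C₀ C₁) :
    ContinuousInW γ q (Ioc 0 T) (fun t => nonlin α (u t)) :=
  hu.1.nonlin h.pow_pos h.one_lt

theorem Estimates.nonlin_const_nonneg (h : Estimates N α γ q β ρ C C₀ C₁) (hM : 0 ≤ M)
    (hd : 0 ≤ d) : 0 ≤ (α + 1) * (2 * M) ^ α * d := by
  have := h.pow_pos
  positivity

theorem Estimates.continuousInW_nonlinDuhamel_self (h : Estimates N α γ q β ρ C C₀ C₁)
    (hM : 0 ≤ M) (hu : AuxClass α γ q β M T u) :
    ContinuousInW γ q (Ioc 0 T) (nonlinDuhamel α u) :=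
  continuousInW_duhamel h.one_le_dim h.one_lt.le h.one_lt h.pointwise h.smoothing_self
    h.const_self_pos.le (h.nonlin_const_nonneg hM hM) le_rfl one_pos h.rate_mul_pos.le h.rate_lt
    (hu.continuousInW_nonlin h) fun _ ht => h.wNorm_nonlin_le hM hu ht

theorem Estimates.continuousInW_nonlinDuhamel_aux (h : Estimates N α γ q β ρ C C₀ C₁)
    (hM : 0 ≤ M) (hu : AuxClass α γ q β M T u) :
    ContinuousInW (auxWeight α γ) (auxExp α q) (Ioc 0 T) (nonlinDuhamel α u) :=
  continuousInW_duhamel h.one_le_dim h.one_lt.le h.one_lt_auxExp h.pointwise h.smoothing_aux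
    h.const_aux_pos.le (h.nonlin_const_nonneg hM hM) h.rate_pos.le
    (h.rate_lt_rate_mul.trans h.rate_lt) h.rate_mul_pos.le h.rate_lt
    (hu.continuousInW_nonlin h) fun _ ht => h.wNorm_nonlin_le hM hu ht

theorem Estimates.wNorm_nonlinDuhamel_self_le (h : Estimates N α γ q β ρ C C₀ C₁)
    (hM : 0 ≤ M) (hu : AuxClass α γ q β M T u) (ht : t ∈ Ioc 0 T) :
    wNorm γ q (nonlinDuhamel α u t) ≤
      ENNReal.ofReal (C₀ * ((α + 1) * (2 * M) ^ α * M) * t ^ (1 - β * (α + 1))) *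
        betaInt 0 (β * (α + 1)) 0 := by
  have := (duhamel_bound_aux (l := 0) h.one_le_dim h.one_lt.le h.one_lt h.pointwise
    h.smoothing_self h.const_self_pos.le (h.nonlin_const_nonneg hM hM) ht.1
    ((hu.continuousInW_nonlin h).mono (Ioo_subset_Ioc_of_mem ht))
    (fun σ hσ => by simpa using h.wNorm_nonlin_le hM hu (Ioo_subset_Ioc_of_mem ht hσ))
    (by simpa using h.betaInt_self_lt_top.ne)).2.2
  simpa [nonlinDuhamel] using this

theorem Estimates.nonlinDuhamel_aux (h : Estimates N α γ q β ρ C C₀ C₁)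
    (hM : 0 ≤ M) (hu : AuxClass α γ q β M T u) (ht : t ∈ Ioc 0 T) :
    (∀ᵐ x, IntegrableOn (fun σ => heat (t - σ) (nonlin α (u σ)) x) (Ioo 0 t)) ∧
    wNorm (auxWeight α γ) (auxExp α q) (nonlinDuhamel α u t) ≤
      ENNReal.ofReal (C₁ * ((α + 1) * (2 * M) ^ α * M) * t ^ (1 - β - β * (α + 1))) *
        betaInt β (β * (α + 1)) 0 := by
  have := duhamel_bound_aux (l := 0) h.one_le_dim h.one_lt.le h.one_lt_auxExp h.pointwise
    h.smoothing_aux h.const_aux_pos.le (h.nonlin_const_nonneg hM hM) ht.1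
    ((hu.continuousInW_nonlin h).mono (Ioo_subset_Ioc_of_mem ht))
    (fun σ hσ => by simpa using h.wNorm_nonlin_le hM hu (Ioo_subset_Ioc_of_mem ht hσ))
    (by simpa using h.betaInt_aux_lt_top.ne)
  exact ⟨this.1, by simpa [nonlinDuhamel] using this.2.2⟩

theorem Estimates.wNorm_nonlinDuhamel_sub_le (h : Estimates N α γ q β ρ C C₀ C₁)
    (hM : 0 ≤ M) (hd : 0 ≤ d) (hu : AuxClass α γ q β M T u) (hv : AuxClass α γ q β M T v)
    (huv : ∀ t ∈ Ioc 0 T, wNorm (auxWeight α γ) (auxExp α q) (fun x => u t x - v t x) ≤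
      ENNReal.ofReal (d * t ^ (-β) * Real.exp (l * t)))
    (ht : t ∈ Ioc 0 T) (hB : betaInt β (β * (α + 1)) (l * t) ≠ ⊤) :
    wNorm (auxWeight α γ) (auxExp α q) (fun x => nonlinDuhamel α u t x - nonlinDuhamel α v t x) ≤
      ENNReal.ofReal (C₁ * ((α + 1) * (2 * M) ^ α * d) * t ^ (1 - β - β * (α + 1)) *
        Real.exp (l * t)) * betaInt β (β * (α + 1)) (l * t) := by
  have hnu := (hu.continuousInW_nonlin h).mono (Ioo_subset_Ioc_of_mem ht)
  have hnv := (hv.continuousInW_nonlin h).mono (Ioo_subset_Ioc_of_mem ht)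
  unfold nonlinDuhamel
  rw [wNorm_congr (duhamel_sub_ae h.pointwise hnu.1 hnv.1 (h.nonlinDuhamel_aux hM hu ht).1
    (h.nonlinDuhamel_aux hM hv ht).1)]
  exact (duhamel_bound_aux h.one_le_dim h.one_lt.le h.one_lt_auxExp h.pointwise
    h.smoothing_aux h.const_aux_pos.le (h.nonlin_const_nonneg hM hd) ht.1
    (hnu.sub h.one_lt.le hnv)
    (fun σ hσ => h.wNorm_nonlin_sub_le hM hu hv (Ioo_subset_Ioc_of_mem ht hσ)
      (huv σ (Ioo_subset_Ioc_of_mem ht hσ))) hB).2.2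

theorem continuousInW_heat_const {κ ρ₁ K : ℝ} {p : ℝ≥0∞} (h : Estimates N α γ q β ρ C C₀ C₁)
    (hp : 1 ≤ p) (hS : SmoothingBound N γ q κ p ρ₁ K) (hu₀ : MemW γ q u₀) :
    ContinuousInW κ p (Ioc 0 T) (fun t => heat t u₀) := by
  refine continuousInW_heat (g := fun _ => u₀) (τ := fun t => t) h.one_lt.le hp h.pointwise hS
    ⟨fun _ _ => hu₀, fun t _ => ?_⟩ continuousOn_id fun s hs => hs.1
  simpa [wNorm_zero] using tendsto_const_nhds

theorem IsSolutionOn.exists_auxClass (h : Estimates N α γ q β ρ C C₀ C₁)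
    (hu : IsSolutionOn α γ q u₀ T u) : ∃ M, 0 ≤ M ∧ AuxClass α γ q β M T u := by
  obtain ⟨M, hM⟩ := hu.bdd_aux
  refine ⟨max M 0, le_max_right _ _, hu.cont_aux, fun t ht => ?_⟩
  have h1 := hM t ht
  rw [← h.rate_eq] at h1
  have ht0 := ht.1
  have h2 := mul_le_mul_right h1 (ENNReal.ofReal (t ^ (-β)))
  rw [← mul_assoc, ← ENNReal.ofReal_mul (by positivity), ← ENNReal.ofReal_mul (by positivity),
    ← Real.rpow_add ht0, neg_add_cancel, Real.rpow_zero, ENNReal.ofReal_one, one_mul] at h2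
  refine h2.trans (ENNReal.ofReal_le_ofReal ?_)
  rw [mul_comm]
  exact mul_le_mul_of_nonneg_right (le_max_left _ _) (by positivity)

theorem ae_eq_of_wNorm_sub_eq_zero {κ : ℝ} {p : ℝ≥0∞} (hN : 1 ≤ N) (hp : p ≠ 0)
    {f g : EuclideanSpace ℝ (Fin N) → ℝ} (hf : AEStronglyMeasurable f volume)
    (hg : AEStronglyMeasurable g volume)
    (h : wNorm κ p (fun x => f x - g x) = 0) : f =ᵐ[volume] g := by
  have h1 := (eLpNorm_eq_zero_iff (aestronglyMeasurable_weight_mul (hf.sub hg)) hp).1 h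
  filter_upwards [h1, ae_norm_pos hN] with x hx hx0
  have hx1 : ‖x‖ ^ κ * (f x - g x) = 0 := hx
  rcases mul_eq_zero.1 hx1 with h2 | h2
  · exact absurd h2 (Real.rpow_pos_of_pos hx0 κ).ne'
  · linarith

/-- With `b = β (α + 1)`, trading `η = 1 - b` in the beta integral gives a factor `(lt)^{-(1-b)}`
and leaves a convergent integral because `β < b`. Its power of `t` turns `t^{1-β-b}` into `t^{-β}`,
and `l` is chosen so that the remaining constant is at most one half, whatever `t` is. -/
theorem Estimates.exists_exponential_weight (h : Estimates N α γ q β ρ C C₀ C₁) (hM : 0 ≤ M) :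
    ∃ l : ℝ, 0 < l ∧ ∀ t, 0 < t →
      betaInt β (β * (α + 1)) (l * t) ≠ ⊤ ∧
      ∀ d, 0 ≤ d → ENNReal.ofReal (C₁ * ((α + 1) * (2 * M) ^ α * d) *
        t ^ (1 - β - β * (α + 1)) * Real.exp (l * t)) * betaInt β (β * (α + 1)) (l * t) ≤
        ENNReal.ofReal (d / 2 * t ^ (-β) * Real.exp (l * t)) := by
  set b := β * (α + 1) with hb
  have hb1 : b < 1 := h.rate_lt
  have hb0 : 0 < b := h.rate_mul_pos
  have hβb : β < b := h.rate_lt_rate_mul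
  have hB := betaInt_zero_lt_top (ρ := β + (1 - b)) (b := b) (by linarith [h.rate_pos])
    (by linarith) hb0.le hb1
  set B := (betaInt (β + (1 - b)) b 0).toReal with hBdef
  have hB0 : 0 ≤ B := ENNReal.toReal_nonneg
  set A := C₁ * ((α + 1) * (2 * M) ^ α) with hA
  have hA0 : 0 ≤ A := by
    have := h.nonlin_const_nonneg hM zero_le_one
    rw [mul_one] at this
    exact mul_nonneg h.const_aux_pos.le this
  set l := (2 * (A * B + 1)) ^ (1 / (1 - b)) with hl
  have hl0 : 0 < l := by positivity
  have hlb : l ^ (-(1 - b)) = (2 * (A * B + 1))⁻¹ := by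
    rw [hl, ← Real.rpow_mul (by positivity)]
    have : 1 / (1 - b) * -(1 - b) = -1 := by
      have : 1 - b ≠ 0 := by linarith
      field_simp
    rw [this, Real.rpow_neg_one]
  refine ⟨l, hl0, fun t ht => ?_⟩
  have h1 := betaInt_le_rpow_mul (ρ := β) (b := b) (η := 1 - b) (s := l * t) (by linarith)
    (by linarith) (by positivity)
  refine ⟨ne_top_of_le_ne_top (ENNReal.mul_ne_top ENNReal.ofReal_ne_top hB.ne) h1,
    fun d hd => ?_⟩
  refine (mul_le_mul_right h1 _).trans ?_
  rw [← ENNReal.ofReal_toReal hB.ne, ← hBdef, ← ENNReal.ofReal_mul (by positivity),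
    ← ENNReal.ofReal_mul (by
      have : 0 ≤ C₁ * ((α + 1) * (2 * M) ^ α * d) :=
        mul_nonneg h.const_aux_pos.le (h.nonlin_const_nonneg hM hd)
      positivity)]
  refine ENNReal.ofReal_le_ofReal ?_
  rw [Real.mul_rpow hl0.le ht.le, hlb]
  have e1 : t ^ (-β) = t ^ (1 - β - b) * t ^ (-(1 - b)) := by
    rw [← Real.rpow_add ht]; congr 1; ring
  have e2 : A * B * (2 * (A * B + 1))⁻¹ ≤ 1 / 2 := by
    rw [← div_eq_mul_inv, div_le_iff₀ (by positivity)]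
    have := mul_nonneg hA0 hB0
    linarith
  have p : 0 ≤ d * t ^ (-β) * Real.exp (l * t) := by positivity
  calc _ = A * B * (2 * (A * B + 1))⁻¹ * (d * t ^ (-β) * Real.exp (l * t)) := by
        rw [e1, hA]; ring
    _ ≤ 1 / 2 * (d * t ^ (-β) * Real.exp (l * t)) := mul_le_mul_of_nonneg_right e2 p
    _ = _ := by ring

/-- Uniqueness of solutions on `[0, T]`. -/
theorem IsSolutionOn.ae_eq (h : Estimates N α γ q β ρ C C₀ C₁)
    (hu : IsSolutionOn α γ q u₀ T u) (hv : IsSolutionOn α γ q u₀ T v) (ht : t ∈ Ioc 0 T) :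
    u t =ᵐ[volume] v t := by
  obtain ⟨M₁, hM₁, hu1⟩ := hu.exists_auxClass h
  obtain ⟨M₂, hM₂, hv1⟩ := hv.exists_auxClass h
  set M := max M₁ M₂ with hMdef
  have hM : 0 ≤ M := hM₁.trans (le_max_left _ _)
  replace hu1 := hu1.mono (le_max_left M₁ M₂)
  replace hv1 := hv1.mono (le_max_right M₁ M₂)
  obtain ⟨l, hl, hlb⟩ := h.exists_exponential_weight hM
  -- Each use of the integral equation halves the weighted distance of the two solutions; the crude
  -- triangle bound starts the iteration.
  have hind : ∀ n : ℕ, ∀ t ∈ Ioc 0 T,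
      wNorm (auxWeight α γ) (auxExp α q) (fun x => u t x - v t x) ≤
        ENNReal.ofReal (2 * M * (1 / 2) ^ n * t ^ (-β) * Real.exp (l * t)) := by
    intro n
    induction n with
    | zero =>
      intro t ht
      have ht0 := ht.1
      refine (wNorm_sub_le h.one_le_auxExp (hu1.1.1 t ht).1 (hv1.1.1 t ht).1).trans
        ((add_le_add (hu1.2 t ht) (hv1.2 t ht)).trans ?_)
      rw [← ENNReal.ofReal_add (by positivity) (by positivity)]
      refine ENNReal.ofReal_le_ofReal ?_
      have h1 : 1 ≤ Real.exp (l * t) := Real.one_le_exp (by positivity)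
      have h2 : 0 ≤ 2 * M * t ^ (-β) := by positivity
      rw [pow_zero, mul_one]
      nlinarith
    | succ n ih =>
      intro t ht
      have hd : 0 ≤ 2 * M * (1 / 2) ^ n := by positivity
      have e : wNorm (auxWeight α γ) (auxExp α q) (fun x => u t x - v t x) =
          wNorm (auxWeight α γ) (auxExp α q)
            (fun x => nonlinDuhamel α u t x - nonlinDuhamel α v t x) := by
        refine wNorm_congr ?_
        filter_upwards [hu.integral_eq t ht, hv.integral_eq t ht] with x hx1 hx2
        rw [hx1.2, hx2.2, nonlinDuhamel, nonlinDuhamel, duhamel, duhamel]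
        ring
      rw [e]
      refine (h.wNorm_nonlinDuhamel_sub_le hM hd hu1 hv1 ih ht (hlb t ht.1).1).trans
        (((hlb t ht.1).2 _ hd).trans (le_of_eq ?_))
      congr 1; rw [pow_succ]; ring
  refine ae_eq_of_wNorm_sub_eq_zero (κ := auxWeight α γ) h.one_le_dim
    (zero_lt_one.trans h.one_lt_auxExp).ne'
    (hu1.1.1 t ht).1 (hv1.1.1 t ht).1 (le_antisymm ?_ zero_le)
  have hlim : Tendsto (fun n : ℕ => ENNReal.ofReal
      (2 * M * (1 / 2) ^ n * t ^ (-β) * Real.exp (l * t))) atTop (𝓝 0) := by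
    have h1 : Tendsto (fun n : ℕ => (1 / 2 : ℝ) ^ n) atTop (𝓝 0) :=
      tendsto_pow_atTop_nhds_zero_of_lt_one (by norm_num) (by norm_num)
    have h2 := ((h1.const_mul (2 * M)).mul_const (t ^ (-β))).mul_const (Real.exp (l * t))
    have := ENNReal.tendsto_ofReal h2
    simpa using this
  exact ge_of_tendsto' hlim fun n => hind n t ht

/-- A fixed point of the integral equation is a solution. -/
theorem isSolutionOn_of_integral_eq (h : Estimates N α γ q β ρ C C₀ C₁) (hM : 0 ≤ M) (hT : 0 < T)
    (hu₀ : MemW γ q u₀) (hu : AuxClass α γ q β M T u)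
    (hfix : ∀ t ∈ Ioc 0 T, u t =ᵐ[volume] fun x => heat t u₀ x + nonlinDuhamel α u t x) :
    IsSolutionOn α γ q u₀ T (fun t => if t ≤ 0 then u₀ else u t) := by
  -- The fixed point carries no information at time 0, where the value must be the data; all
  -- integrals see positive times only.
  have hpos : ∀ t ∈ Ioc 0 T, (if t ≤ 0 then u₀ else u t) = u t := fun t ht =>
    if_neg (not_le.2 ht.1)
  -- The Duhamel term vanishes in `L^q_γ` as `t → 0` because `1 - β (α + 1) > 0`. This gives the
  -- initial condition for `q = ∞` at once, and for `q < ∞` together with strong continuity of the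
  -- heat flow.
  have hDlim : Tendsto (fun t => wNorm γ q (nonlinDuhamel α u t)) (𝓝[Ioc 0 T] 0) (𝓝 0) := by
    have h1 : Tendsto (fun t : ℝ => ENNReal.ofReal (C₀ * ((α + 1) * (2 * M) ^ α * M) *
        t ^ (1 - β * (α + 1))) * betaInt 0 (β * (α + 1)) 0) (𝓝[Ioc 0 T] 0) (𝓝 0) := by
      have h2 : Tendsto (fun t : ℝ => t ^ (1 - β * (α + 1))) (𝓝[Ioc 0 T] 0) (𝓝 0) := by
        have hpos : 0 < 1 - β * (α + 1) := by linarith [h.rate_lt]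
        have := (Real.continuousAt_rpow_const 0 (1 - β * (α + 1)) (Or.inr hpos.le)).tendsto
        rw [Real.zero_rpow hpos.ne'] at this
        exact this.mono_left nhdsWithin_le_nhds
      have h3 := ENNReal.Tendsto.mul_const (b := betaInt 0 (β * (α + 1)) 0)
        (ENNReal.tendsto_ofReal (h2.const_mul (C₀ * ((α + 1) * (2 * M) ^ α * M))))
        (Or.inr h.betaInt_self_lt_top.ne)
      simpa using h3
    refine tendsto_of_tendsto_of_tendsto_of_le_of_le' tendsto_const_nhds h1
      (Eventually.of_forall fun _ => zero_le) ?_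
    filter_upwards [self_mem_nhdsWithin] with t ht
    exact h.wNorm_nonlinDuhamel_self_le hM hu ht
  have hself : ContinuousInW γ q (Ioc 0 T) (fun t => if t ≤ 0 then u₀ else u t) := by
    refine ((continuousInW_heat_const h h.one_lt.le h.smoothing_self hu₀).add h.one_lt.le
      (h.continuousInW_nonlinDuhamel_self hM hu)).congr fun t ht => ?_
    rw [hpos t ht]
    exact (hfix t ht).symm
  have haux : ContinuousInW (auxWeight α γ) (auxExp α q) (Ioc 0 T)
      (fun t => if t ≤ 0 then u₀ else u t) :=
    hu.1.congr fun t ht => by rw [hpos t ht]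
  refine ⟨fun hqt => ⟨⟨fun t ht => ?_, fun t ht => ?_⟩, ?_⟩, fun hqt => ⟨hself, ?_⟩, haux,
    ⟨M, fun t ht => ?_⟩, fun t ht => ?_⟩
  · rcases eq_or_lt_of_le ht.1 with h0 | h0
    · rw [← h0]; simpa using hu₀
    · exact hself.1 t ⟨h0, ht.2⟩
  · rcases eq_or_lt_of_le ht.1 with h0 | h0
    · subst h0
      have hset : Icc 0 T = insert 0 (Ioc 0 T) := (Ioc_insert_left hT.le).symm
      rw [hset, nhdsWithin_insert]
      refine Tendsto.sup ?_ ?_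
      · rw [tendsto_pure_left]
        intro s hs
        simpa [wNorm_zero] using mem_of_mem_nhds hs
      · have h1 := (tendsto_wNorm_heat_sub h.weight_pos h.one_lt hqt h.pointwise h.smoothing_self
          hu₀).mono_left (nhdsWithin_mono (0 : ℝ) (Ioc_subset_Ioi_self : Ioc 0 T ⊆ Ioi 0))
        have h2 := h1.add hDlim
        rw [add_zero] at h2
        refine tendsto_of_tendsto_of_tendsto_of_le_of_le' tendsto_const_nhds h2
          (Eventually.of_forall fun _ => zero_le) ?_
        filter_upwards [self_mem_nhdsWithin] with s hs
        have m1 : AEStronglyMeasurable (fun x => heat s u₀ x - u₀ x) volume :=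
          (stronglyMeasurable_heat hu₀.1).aestronglyMeasurable.sub hu₀.1
        refine le_trans (le_of_eq (wNorm_congr ?_)) (wNorm_add_le h.one_lt.le m1
          ((h.continuousInW_nonlinDuhamel_self hM hu).1 s hs).1)
        filter_upwards [hfix s hs] with x hx
        simp only [hpos s hs, le_refl, if_true, hx]
        ring
    -- Near a positive time the closed and the half-open interval have the same neighbourhoods.
    · refine (hself.2 t ⟨h0, ht.2⟩).mono_left (nhdsWithin_le_iff.2 ?_)
      filter_upwards [self_mem_nhdsWithin, mem_nhdsWithin_of_mem_nhds (lt_mem_nhds h0)] with s h1 h2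
      exact ⟨h2, h1.2⟩
  · simp
  · rw [← nhdsWithin_Ioc_eq_nhdsGT hT]
    refine hDlim.congr' ?_
    filter_upwards [self_mem_nhdsWithin] with s hs
    refine wNorm_congr ?_
    filter_upwards [hfix s hs] with x hx
    simp only [hpos s hs, hx]
    ring
  · have ht0 := ht.1
    simp only [hpos t ht]
    rw [← h.rate_eq]
    refine (mul_le_mul_right (hu.2 t ht) _).trans (le_of_eq ?_)
    rw [← ENNReal.ofReal_mul (by positivity)]
    congr 1
    rw [mul_left_comm, ← Real.rpow_add ht0]; simp
  · filter_upwards [hfix t ht, (h.nonlinDuhamel_aux hM hu ht).1] with x hx hi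
    have e : ∀ σ ∈ Ioo 0 t, heat (t - σ) (nonlin α (u σ)) x =
        heat (t - σ) (nonlin α (if σ ≤ 0 then u₀ else u σ)) x := fun σ hσ => by
      rw [if_neg (not_le.2 hσ.1)]
    refine ⟨hi.congr_fun e measurableSet_Ioo, ?_⟩
    simp only [hpos t ht]
    rw [hx, nonlinDuhamel, duhamel, setIntegral_congr_fun measurableSet_Ioo e]

end Estimates

/-! ### Weighted spaces represented by the Banach space `Lp` -/

section Representative

variable {N : ℕ} {κ : ℝ} {p : ℝ≥0∞} {I : Set ℝ} {u : ℝ → EuclideanSpace ℝ (Fin N) → ℝ}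

/-- The function `|x|^{-κ} f(x)`, which lies in `L^p_κ` when `f ∈ L^p`. -/
noncomputable def lpRep (κ : ℝ) (f : Lp ℝ p (volume : Measure (EuclideanSpace ℝ (Fin N))))
    (x : EuclideanSpace ℝ (Fin N)) : ℝ :=
  ‖x‖ ^ (-κ) * f x

theorem aestronglyMeasurable_lpRep
    (f : Lp ℝ p (volume : Measure (EuclideanSpace ℝ (Fin N)))) :
    AEStronglyMeasurable (lpRep κ f) volume :=
  aestronglyMeasurable_weight_mul (Lp.aestronglyMeasurable f)

theorem norm_rpow_mul_lpRep (hN : 1 ≤ N)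
    (f : Lp ℝ p (volume : Measure (EuclideanSpace ℝ (Fin N)))) :
    (fun x => ‖x‖ ^ κ * lpRep κ f x) =ᵐ[volume] f := by
  filter_upwards [ae_norm_pos hN] with x hx
  rw [lpRep, ← mul_assoc, ← Real.rpow_add hx, add_neg_cancel, Real.rpow_zero, one_mul]

theorem wNorm_lpRep (hN : 1 ≤ N) (f : Lp ℝ p (volume : Measure (EuclideanSpace ℝ (Fin N)))) :
    wNorm κ p (lpRep κ f) = ‖f‖ₑ := by
  rw [wNorm, eLpNorm_congr_ae (norm_rpow_mul_lpRep hN f), Lp.enorm_def]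

theorem lpRep_sub_ae (f g : Lp ℝ p (volume : Measure (EuclideanSpace ℝ (Fin N)))) :
    (fun x => lpRep κ f x - lpRep κ g x) =ᵐ[volume] lpRep κ (f - g) := by
  filter_upwards [Lp.coeFn_sub f g] with x hx
  simp only [lpRep, hx, Pi.sub_apply, mul_sub]

theorem memW_lpRep (hN : 1 ≤ N) (f : Lp ℝ p (volume : Measure (EuclideanSpace ℝ (Fin N)))) :
    MemW κ p (lpRep κ f) :=
  ⟨aestronglyMeasurable_lpRep f, by rw [wNorm_lpRep hN, Lp.enorm_def]; exact Lp.eLpNorm_lt_top f⟩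

theorem continuousInW_lpRep [Fact (1 ≤ p)] (hN : 1 ≤ N)
    {w : ℝ → Lp ℝ p (volume : Measure (EuclideanSpace ℝ (Fin N)))} (hw : ContinuousOn w I) :
    ContinuousInW κ p I (fun t => lpRep κ (w t)) := by
  refine ⟨fun t _ => memW_lpRep hN _, fun t ht => ?_⟩
  have h1 : Tendsto (fun s => ‖w s - w t‖ₑ) (𝓝[I] t) (𝓝 0) := by
    have := ((hw t ht).sub_const (w t)).enorm
    simpa using this
  refine h1.congr fun s => ?_
  rw [wNorm_congr (lpRep_sub_ae _ _), wNorm_lpRep hN]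

theorem MemW.exists_lpRep_ae_eq (hN : 1 ≤ N) {f : EuclideanSpace ℝ (Fin N) → ℝ}
    (hf : MemW κ p f) :
    ∃ g : Lp ℝ p (volume : Measure (EuclideanSpace ℝ (Fin N))), lpRep κ g =ᵐ[volume] f := by
  have hm : MemLp (fun x => ‖x‖ ^ κ * f x) p volume :=
    ⟨aestronglyMeasurable_weight_mul hf.1, hf.2⟩
  refine ⟨hm.toLp _, ?_⟩
  filter_upwards [hm.coeFn_toLp, ae_norm_pos hN] with x hx h0
  rw [lpRep, hx, ← mul_assoc, ← Real.rpow_add h0, neg_add_cancel, Real.rpow_zero, one_mul]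

theorem ContinuousInW.exists_lpRep_ae_eq [Fact (1 ≤ p)] (hN : 1 ≤ N)
    (hu : ContinuousInW κ p I u) :
    ∃ w : ℝ → Lp ℝ p (volume : Measure (EuclideanSpace ℝ (Fin N))),
      ContinuousOn w I ∧ ∀ t ∈ I, lpRep κ (w t) =ᵐ[volume] u t := by
  have h (t : ℝ) : ∃ g : Lp ℝ p (volume : Measure (EuclideanSpace ℝ (Fin N))),
      t ∈ I → lpRep κ g =ᵐ[volume] u t := by
    by_cases ht : t ∈ I
    · obtain ⟨g, hg⟩ := (hu.1 t ht).exists_lpRep_ae_eq hN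
      exact ⟨g, fun _ => hg⟩
    · exact ⟨0, fun h => absurd h ht⟩
  choose w hw using h
  refine ⟨w, fun t ht => ?_, hw⟩
  refine tendsto_iff_edist_tendsto_0.2 ((hu.2 t ht).congr' ?_)
  filter_upwards [self_mem_nhdsWithin] with s hs
  rw [edist_eq_enorm_sub, ← wNorm_lpRep (κ := κ) hN]
  refine wNorm_congr (.trans ?_ (lpRep_sub_ae _ _))
  filter_upwards [hw s hs, hw t ht] with x h1 h2
  rw [h1, h2]

end Representative

/-! ### Local existence by contraction -/

section LocalExistence

open scoped BoundedContinuousFunction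

variable {N : ℕ} {α γ β ρ C C₀ C₁ M T t : ℝ} {q : ℝ≥0∞} {u₀ : EuclideanSpace ℝ (Fin N) → ℝ}

/-- The complete space in which the fixed point argument takes place: bounded continuous curves
`t ↦ t^β |·|^ν u(t)` in `L^r`. -/
abbrev CurveSpace (N : ℕ) (p : ℝ≥0∞) [Fact (1 ≤ p)] (T : ℝ) :=
  Ioc (0 : ℝ) T →ᵇ Lp ℝ p (volume : Measure (EuclideanSpace ℝ (Fin N)))

open Classical in
/-- The function `u` with `t^β |x|^κ u(t, x) = v(t, x)`. -/
noncomputable def ofCurve {p : ℝ≥0∞} [Fact (1 ≤ p)] (κ β : ℝ) (v : CurveSpace N p T) (t : ℝ)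
    (x : EuclideanSpace ℝ (Fin N)) : ℝ :=
  t ^ (-β) * lpRep κ (if h : t ∈ Ioc 0 T then v ⟨t, h⟩ else 0) x

theorem ofCurve_of_mem {p : ℝ≥0∞} [Fact (1 ≤ p)] {κ : ℝ} (v : CurveSpace N p T)
    (ht : t ∈ Ioc 0 T) : ofCurve κ β v t = fun x => t ^ (-β) * lpRep κ (v ⟨t, ht⟩) x := by
  ext x; rw [ofCurve, dif_pos ht]

theorem continuousInW_ofCurve {p : ℝ≥0∞} [hp : Fact (1 ≤ p)] {κ : ℝ} (hN : 1 ≤ N)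
    (v : CurveSpace N p T) : ContinuousInW κ p (Ioc 0 T) (ofCurve κ β v) := by
  classical
  refine (continuousInW_lpRep hN (w := fun t => if h : t ∈ Ioc 0 T then v ⟨t, h⟩ else 0)
    ?_).smul hp.out (c := fun t => t ^ (-β)) ?_
  · rw [continuousOn_iff_continuous_domRestrict]
    refine v.continuous.congr fun t => ?_
    simp only [domRestrict_apply]
    rw [dif_pos t.2]
  · exact fun t ht => (Real.continuousAt_rpow_const t _ (Or.inl ht.1.ne')).continuousWithinAt

theorem wNorm_ofCurve {p : ℝ≥0∞} [Fact (1 ≤ p)] {κ : ℝ} (hN : 1 ≤ N)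
    (v : CurveSpace N p T) (ht : t ∈ Ioc 0 T) :
    wNorm κ p (ofCurve κ β v t) = ENNReal.ofReal (‖v ⟨t, ht⟩‖ * t ^ (-β)) := by
  have ht0 := ht.1
  rw [ofCurve_of_mem v ht, wNorm_const_mul, wNorm_lpRep hN, mul_comm,
    ENNReal.ofReal_mul (norm_nonneg _), ofReal_norm, Real.enorm_of_nonneg (by positivity)]

/-- With `wNorm_ofCurve` this makes the sup norm of curves the norm `sup t^β ‖u(t)‖` of the class,
so completeness is inherited from bounded continuous functions with values in `Lp`. -/
theorem wNorm_ofCurve_sub {p : ℝ≥0∞} [Fact (1 ≤ p)] {κ : ℝ} (hN : 1 ≤ N)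
    (v w : CurveSpace N p T) (ht : t ∈ Ioc 0 T) :
    wNorm κ p (fun x => ofCurve κ β v t x - ofCurve κ β w t x) =
      ENNReal.ofReal (‖v ⟨t, ht⟩ - w ⟨t, ht⟩‖ * t ^ (-β)) := by
  have := wNorm_ofCurve (β := β) (κ := κ) hN (v - w) ht
  rw [BoundedContinuousFunction.sub_apply] at this
  rw [← this]
  refine wNorm_congr ?_
  rw [ofCurve_of_mem v ht, ofCurve_of_mem w ht, ofCurve_of_mem (v - w) ht,
    BoundedContinuousFunction.sub_apply]
  filter_upwards [lpRep_sub_ae (κ := κ) (v ⟨t, ht⟩) (w ⟨t, ht⟩)] with x hx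
  rw [← hx, mul_sub]

theorem auxClass_ofCurve [Fact (1 ≤ auxExp α q)] (hN : 1 ≤ N)
    {v : CurveSpace N (auxExp α q) T} (hv : ‖v‖ ≤ M) :
    AuxClass α γ q β M T (ofCurve (auxWeight α γ) β v) := by
  refine ⟨continuousInW_ofCurve hN v, fun t ht => ?_⟩
  have ht0 := ht.1
  rw [wNorm_ofCurve hN v ht]
  exact ENNReal.ofReal_le_ofReal (mul_le_mul_of_nonneg_right
    ((v.norm_coe_le_norm _).trans hv) (by positivity))

/-- The contraction constant of the integral equation on the ball of radius `M`. -/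
noncomputable def contractionConst (α β C₁ M T : ℝ) : ℝ :=
  C₁ * ((α + 1) * (2 * M) ^ α) * T ^ (1 - β * (α + 1)) * (betaInt β (β * (α + 1)) 0).toReal

/-- The weight `t^β` turns the Duhamel power into `t^{1-β(α+1)}`, a positive power and therefore
largest at `t = T`. -/
theorem Estimates.duhamelConst_le (h : Estimates N α γ q β ρ C C₀ C₁) (hM : 0 ≤ M) {d : ℝ}
    (hd : 0 ≤ d) (ht : t ∈ Ioc 0 T) :
    ENNReal.ofReal (t ^ β) * (ENNReal.ofReal (C₁ * ((α + 1) * (2 * M) ^ α * d) *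
      t ^ (1 - β - β * (α + 1))) * betaInt β (β * (α + 1)) 0) ≤
      ENNReal.ofReal (contractionConst α β C₁ M T * d) := by
  have ht0 := ht.1
  have h1 := h.const_aux_pos
  have h2 := h.pow_pos
  rw [← ENNReal.ofReal_toReal h.betaInt_aux_lt_top.ne, ← ENNReal.ofReal_mul (by positivity),
    ← ENNReal.ofReal_mul (by positivity)]
  refine ENNReal.ofReal_le_ofReal ?_
  have e : t ^ (1 - β * (α + 1)) = t ^ β * t ^ (1 - β - β * (α + 1)) := by
    rw [← Real.rpow_add ht0]; congr 1; ring
  have h3 : t ^ (1 - β * (α + 1)) ≤ T ^ (1 - β * (α + 1)) :=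
    Real.rpow_le_rpow ht0.le ht.2 (by linarith [h.rate_lt])
  calc _ = C₁ * ((α + 1) * (2 * M) ^ α) * t ^ (1 - β * (α + 1)) *
        (betaInt β (β * (α + 1)) 0).toReal * d := by rw [e]; ring
    _ ≤ _ := by unfold contractionConst; gcongr

theorem Estimates.contractionConst_nonneg (h : Estimates N α γ q β ρ C C₀ C₁) (hM : 0 ≤ M)
    (hT : 0 ≤ T) : 0 ≤ contractionConst α β C₁ M T := by
  have h1 := h.const_aux_pos
  have h2 := h.pow_pos
  unfold contractionConst
  positivity

theorem Estimates.rpow_mul_wNorm_heat_le (h : Estimates N α γ q β ρ C C₀ C₁)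
    (hu₀ : MemW γ q u₀) (ht : 0 < t) :
    ENNReal.ofReal (t ^ β) * wNorm (auxWeight α γ) (auxExp α q) (heat t u₀) ≤
      ENNReal.ofReal (C₁ * (wNorm γ q u₀).toReal) := by
  refine (mul_le_mul_right (h.smoothing_aux.wNorm_heat_le ht hu₀.1) _).trans (le_of_eq ?_)
  have h1 := h.const_aux_pos
  rw [ENNReal.ofReal_mul (p := C₁) (q := (wNorm γ q u₀).toReal) h1.le,
    ENNReal.ofReal_toReal hu₀.2.ne, ← mul_assoc, ← ENNReal.ofReal_mul (by positivity)]
  congr 2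
  rw [mul_left_comm, ← Real.rpow_add ht]; simp

theorem Estimates.wNorm_rhs_le (h : Estimates N α γ q β ρ C C₀ C₁) (hM : 0 ≤ M)
    (hu₀ : MemW γ q u₀) {u : ℝ → EuclideanSpace ℝ (Fin N) → ℝ} (hu : AuxClass α γ q β M T u)
    (ht : t ∈ Ioc 0 T) :
    wNorm (auxWeight α γ) (auxExp α q)
      (fun x => t ^ β * (heat t u₀ x + nonlinDuhamel α u t x)) ≤
      ENNReal.ofReal (C₁ * (wNorm γ q u₀).toReal + contractionConst α β C₁ M T * M) := by
  have ht0 := ht.1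
  rw [wNorm_const_mul, Real.enorm_of_nonneg (by positivity), ENNReal.ofReal_add
    (mul_nonneg h.const_aux_pos.le ENNReal.toReal_nonneg)
    (mul_nonneg (h.contractionConst_nonneg hM (ht0.le.trans ht.2)) hM)]
  refine (mul_le_mul_right (wNorm_add_le h.one_le_auxExp
    (stronglyMeasurable_heat hu₀.1).aestronglyMeasurable
    ((h.continuousInW_nonlinDuhamel_aux hM hu).1 t ht).1) _).trans ?_
  rw [mul_add]
  exact add_le_add (h.rpow_mul_wNorm_heat_le hu₀ ht0)
    ((mul_le_mul_right (h.nonlinDuhamel_aux hM hu ht).2 _).trans (h.duhamelConst_le hM hM ht))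

/-- Encodes the right side of the integral equation as an element of the complete space; boundedness
is the a priori estimate and continuity that of the heat and Duhamel terms. -/
theorem Estimates.exists_rhs_curve [Fact (1 ≤ auxExp α q)]
    (h : Estimates N α γ q β ρ C C₀ C₁) (hT : 0 ≤ T)
    (hu₀ : MemW γ q u₀) (v : CurveSpace N (auxExp α q) T) :
    ∃ w : CurveSpace N (auxExp α q) T, ∀ t : Ioc 0 T,
      lpRep (auxWeight α γ) (w t) =ᵐ[volume] fun x => (t : ℝ) ^ β *
        (heat t u₀ x + nonlinDuhamel α (ofCurve (auxWeight α γ) β v) t x) := by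
  have hv := auxClass_ofCurve (γ := γ) (β := β) h.one_le_dim (le_refl ‖v‖)
  have hc := ((continuousInW_heat_const h h.one_le_auxExp h.smoothing_aux hu₀).add h.one_le_auxExp
    (h.continuousInW_nonlinDuhamel_aux (norm_nonneg v) hv)).smul h.one_le_auxExp
    (c := fun t => t ^ β)
    (fun t ht => (Real.continuousAt_rpow_const t _ (Or.inl ht.1.ne')).continuousWithinAt)
  obtain ⟨w, hw, hwe⟩ := hc.exists_lpRep_ae_eq h.one_le_dim
  refine ⟨BoundedContinuousFunction.ofNormedAddCommGroup ((Ioc 0 T).domRestrict w)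
    (continuousOn_iff_continuous_domRestrict.1 hw)
    (C₁ * (wNorm γ q u₀).toReal + contractionConst α β C₁ ‖v‖ T * ‖v‖) fun t => ?_,
    fun t => hwe t t.2⟩
  have h1 := h.wNorm_rhs_le (norm_nonneg v) hu₀ hv t.2
  rw [← wNorm_congr (hwe t t.2), wNorm_lpRep h.one_le_dim, ← ofReal_norm] at h1
  exact (ENNReal.ofReal_le_ofReal_iff (add_nonneg
    (mul_nonneg h.const_aux_pos.le ENNReal.toReal_nonneg)
    (mul_nonneg (h.contractionConst_nonneg (norm_nonneg v) hT) (norm_nonneg v)))).1 h1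

/-- Local existence for a time `T` that is small in terms of the data. -/
theorem Estimates.exists_isSolutionOn (h : Estimates N α γ q β ρ C C₀ C₁) (hT : 0 < T)
    (hu₀ : MemW γ q u₀)
    (hsmall : contractionConst α β C₁ (2 * (C₁ * (wNorm γ q u₀).toReal)) T ≤ 1 / 2) :
    ∃ u, IsSolutionOn α γ q u₀ T u := by
  have : Fact (1 ≤ auxExp α q) := ⟨h.one_le_auxExp⟩
  set A := C₁ * (wNorm γ q u₀).toReal with hA
  have hA0 : 0 ≤ A := mul_nonneg h.const_aux_pos.le ENNReal.toReal_nonneg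
  -- The heat term uses up half of the radius; a contraction constant at most one half lets the
  -- Duhamel term use at most the other half.
  set M := 2 * A with hMdef
  have hM : 0 ≤ M := by positivity
  have hN := h.one_le_dim
  choose Ψ hΨ using h.exists_rhs_curve hT.le hu₀
  let K : Set (CurveSpace N (auxExp α q) T) := Metric.closedBall 0 M
  have hK (v) (hv : v ∈ K) : AuxClass α γ q β M T (ofCurve (auxWeight α γ) β v) :=
    auxClass_ofCurve hN (by simpa [K] using hv)
  have hmaps : MapsTo Ψ K K := by
    intro v hv
    rw [mem_closedBall_zero_iff, BoundedContinuousFunction.norm_le hM]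
    intro t
    have h1 := h.wNorm_rhs_le hM hu₀ (hK v hv) t.2
    rw [← wNorm_congr (hΨ v t), wNorm_lpRep hN, ← ofReal_norm] at h1
    have h2 := (ENNReal.ofReal_le_ofReal_iff (add_nonneg hA0
      (mul_nonneg (h.contractionConst_nonneg hM hT.le) hM))).1 h1
    have h3 := mul_le_mul_of_nonneg_right hsmall hM
    linarith
  have hdist : ∀ v ∈ K, ∀ w ∈ K, ‖Ψ v - Ψ w‖ ≤ 1 / 2 * ‖v - w‖ := by
    intro v hv w hw
    rw [BoundedContinuousFunction.norm_le (by positivity)]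
    intro t
    have ht0 : (0 : ℝ) < t := t.2.1
    have h1 := h.wNorm_nonlinDuhamel_sub_le (l := 0) hM (norm_nonneg (v - w)) (hK v hv) (hK w hw)
      (fun s hs => by
        have hs0 := hs.1
        rw [wNorm_ofCurve_sub hN v w hs, zero_mul, Real.exp_zero, mul_one]
        exact ENNReal.ofReal_le_ofReal (mul_le_mul_of_nonneg_right
          ((v - w).norm_coe_le_norm ⟨s, hs⟩) (by positivity))) t.2
      (by simpa using h.betaInt_aux_lt_top.ne)
    rw [zero_mul, Real.exp_zero, mul_one] at h1
    have h2 := (mul_le_mul_right h1 (ENNReal.ofReal ((t : ℝ) ^ β))).trans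
      (h.duhamelConst_le hM (norm_nonneg (v - w)) t.2)
    rw [← Real.enorm_of_nonneg (by positivity), ← wNorm_const_mul] at h2
    have h3 : wNorm (auxWeight α γ) (auxExp α q) (lpRep (auxWeight α γ) (Ψ v t - Ψ w t)) ≤
        ENNReal.ofReal (contractionConst α β C₁ M T * ‖v - w‖) := by
      refine le_trans (le_of_eq (wNorm_congr ?_)) h2
      filter_upwards [lpRep_sub_ae (κ := auxWeight α γ) (Ψ v t) (Ψ w t), hΨ v t, hΨ w t]
        with x h1 h2 h3
      rw [← h1, h2, h3]; ring
    rw [wNorm_lpRep hN, ← ofReal_norm] at h3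
    exact ((ENNReal.ofReal_le_ofReal_iff (mul_nonneg (h.contractionConst_nonneg hM hT.le)
      (norm_nonneg _))).1 h3).trans (mul_le_mul_of_nonneg_right hsmall (norm_nonneg _))
  have hcontr : ContractingWith (1 / 2) (hmaps.restrict Ψ K K) := by
    refine ⟨by rw [← NNReal.coe_lt_coe]; norm_num, LipschitzWith.of_dist_le_mul fun v w => ?_⟩
    have := hdist v v.2 w w.2
    simpa [Subtype.dist_eq, dist_eq_norm] using this
  obtain ⟨v, hv, hfix, -⟩ := ContractingWith.exists_fixedPoint' (s := K)
    Metric.isClosed_closedBall.isComplete hmaps hcontr (x := 0)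
    (Metric.mem_closedBall_self hM) (edist_ne_top _ _)
  refine ⟨_, isSolutionOn_of_integral_eq h hM hT hu₀ (hK v hv) fun t ht => ?_⟩
  have h1 := hΨ v ⟨t, ht⟩
  rw [hfix.eq] at h1
  filter_upwards [h1] with x hx
  have e : ofCurve (auxWeight α γ) β v t x =
      t ^ (-β) * lpRep (auxWeight α γ) (v ⟨t, ht⟩) x := by rw [ofCurve_of_mem v ht]
  rw [e, hx, ← mul_assoc, ← Real.rpow_add ht.1, neg_add_cancel, Real.rpow_zero, one_mul]

end LocalExistence

/-! ### Gluing solutions and the maximal existence time -/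

section Maximal

variable {N : ℕ} {α γ β ρ C C₀ C₁ T T' t : ℝ} {q S : ℝ≥0∞}
  {u v : ℝ → EuclideanSpace ℝ (Fin N) → ℝ} {u₀ : EuclideanSpace ℝ (Fin N) → ℝ}

theorem IsSolutionOn.mono (hu : IsSolutionOn α γ q u₀ T u) (h : T' ≤ T) :
    IsSolutionOn α γ q u₀ T' u where
  cont_of_ne_top hq := ⟨(hu.cont_of_ne_top hq).1.mono (Icc_subset_Icc_right h),
    (hu.cont_of_ne_top hq).2⟩
  cont_of_eq_top hq := ⟨(hu.cont_of_eq_top hq).1.mono (Ioc_subset_Ioc_right h),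
    (hu.cont_of_eq_top hq).2⟩
  cont_aux := hu.cont_aux.mono (Ioc_subset_Ioc_right h)
  bdd_aux := hu.bdd_aux.imp fun _ hM t ht => hM t (Ioc_subset_Ioc_right h ht)
  integral_eq t ht := hu.integral_eq t (Ioc_subset_Ioc_right h ht)

theorem IsSolutionOn.congr (hu : IsSolutionOn α γ q u₀ T u) (hT : 0 < T) (h0 : v 0 =ᵐ[volume] u₀)
    (h : ∀ t ∈ Ioc 0 T, u t =ᵐ[volume] v t) : IsSolutionOn α γ q u₀ T v where
  cont_of_ne_top hq := by
    refine ⟨(hu.cont_of_ne_top hq).1.congr fun t ht => ?_, h0⟩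
    rcases eq_or_lt_of_le ht.1 with h1 | h1
    · rw [← h1]; exact (hu.cont_of_ne_top hq).2.trans h0.symm
    · exact h t ⟨h1, ht.2⟩
  cont_of_eq_top hq := by
    refine ⟨(hu.cont_of_eq_top hq).1.congr h, (hu.cont_of_eq_top hq).2.congr' ?_⟩
    rw [← nhdsWithin_Ioc_eq_nhdsGT hT]
    filter_upwards [self_mem_nhdsWithin] with t ht
    refine wNorm_congr ?_
    filter_upwards [h t ht] with x hx
    rw [hx]
  cont_aux := hu.cont_aux.congr h
  bdd_aux := hu.bdd_aux.imp fun _ hM t ht => by rw [← wNorm_congr (h t ht)]; exact hM t ht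
  integral_eq t ht := by
    filter_upwards [hu.integral_eq t ht, h t ht] with x hx hux
    have e : ∀ σ ∈ Ioo 0 t, heat (t - σ) (nonlin α (u σ)) x =
        heat (t - σ) (nonlin α (v σ)) x := fun σ hσ => by
      refine congrFun (heat_congr ?_) x
      filter_upwards [h σ (Ioo_subset_Ioc_of_mem ht hσ)] with y hy
      simp only [nonlin, hy]
    refine ⟨hx.1.congr_fun e measurableSet_Ioo, ?_⟩
    rw [← hux, hx.2, setIntegral_congr_fun measurableSet_Ioo e]

open Classical in
/-- The function obtained by gluing all solutions with data `u₀`. -/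
noncomputable def glue (α γ : ℝ) (q : ℝ≥0∞) (u₀ : EuclideanSpace ℝ (Fin N) → ℝ) (t : ℝ) :
    EuclideanSpace ℝ (Fin N) → ℝ :=
  if t ≤ 0 then u₀ else
    if h : ∃ w, IsSolutionOn α γ q u₀ t w then h.choose t else 0

/-- The supremum of the lengths of the intervals on which a solution exists. -/
noncomputable def maxTime (α γ : ℝ) (q : ℝ≥0∞) (u₀ : EuclideanSpace ℝ (Fin N) → ℝ) : ℝ≥0∞ :=
  sSup (ENNReal.ofReal '' {T | 0 < T ∧ ∃ w, IsSolutionOn α γ q u₀ T w})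

theorem IsSolutionOn.ofReal_le_maxTime (hT : 0 < T) (hu : IsSolutionOn α γ q u₀ T u) :
    ENNReal.ofReal T ≤ maxTime α γ q u₀ :=
  le_sSup ⟨T, ⟨hT, u, hu⟩, rfl⟩

/-- The glued function picks, for each `t` separately, some solution on `[0, t]`. By uniqueness the
choice does not matter, so it agrees with any given solution. -/
theorem IsSolutionOn.glue (h : Estimates N α γ q β ρ C C₀ C₁) (hT : 0 < T)
    (hu : IsSolutionOn α γ q u₀ T u) : IsSolutionOn α γ q u₀ T (glue α γ q u₀) := by
  refine hu.congr hT (by simp [WeightedHeat.glue]) fun t ht => ?_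
  have hex : ∃ w, IsSolutionOn α γ q u₀ t w := ⟨u, hu.mono ht.2⟩
  rw [WeightedHeat.glue, if_neg (not_le.2 ht.1), dif_pos hex]
  exact (hu.mono ht.2).ae_eq h hex.choose_spec ⟨ht.1, le_rfl⟩

theorem isSolutionUpTo_glue (h : Estimates N α γ q β ρ C C₀ C₁) :
    IsSolutionUpTo α γ q u₀ (maxTime α γ q u₀) (glue α γ q u₀) := by
  intro S hS hlt
  obtain ⟨_, ⟨T, ⟨hT, w, hw⟩, rfl⟩, hST⟩ := lt_sSup_iff.1 hlt
  exact (hw.glue h hT).mono ((ENNReal.ofReal_lt_ofReal_iff hT).1 hST).le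

theorem IsSolutionUpTo.le_maxTime (hv : IsSolutionUpTo α γ q u₀ S v) :
    S ≤ maxTime α γ q u₀ := by
  by_contra! hlt
  obtain ⟨c, hc, hcS⟩ := exists_between hlt
  have hct : c ≠ ⊤ := hcS.ne_top
  have hc0 : 0 < c.toReal := ENNReal.toReal_pos (pos_of_gt hc).ne' hct
  have h1 := hv c.toReal hc0 (by rwa [ENNReal.ofReal_toReal hct])
  have h2 := h1.ofReal_le_maxTime hc0
  rw [ENNReal.ofReal_toReal hct] at h2
  exact absurd h2 (not_le.2 hc)

theorem IsSolutionUpTo.agreeUpTo (h : Estimates N α γ q β ρ C C₀ C₁)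
    (hu : IsSolutionUpTo α γ q u₀ S u) (hv : IsSolutionUpTo α γ q u₀ S v) : AgreeUpTo S u v :=
  fun t ht hS => (hu t ht hS).ae_eq h (hv t ht hS) ⟨ht, le_rfl⟩

/-- No solution whatsoever lives longer than the supremum, so agreement with the glued function is
not needed for maximality. -/
theorem isMaximalSolution_glue (h : Estimates N α γ q β ρ C C₀ C₁)
    (hpos : 0 < maxTime α γ q u₀) :
    IsMaximalSolution α γ q u₀ (maxTime α γ q u₀) (glue α γ q u₀) :=
  ⟨hpos, isSolutionUpTo_glue h, fun _ _ hv _ => hv.le_maxTime⟩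

/-- The glued function extends `v` by uniqueness, so maximality of `v` forces its time up to the
supremum. -/
theorem IsMaximalSolution.eq_maxTime (h : Estimates N α γ q β ρ C C₀ C₁)
    (hv : IsMaximalSolution α γ q u₀ S v) :
    S = maxTime α γ q u₀ ∧ AgreeUpTo (maxTime α γ q u₀) v (glue α γ q u₀) := by
  have hle := hv.isSolution.le_maxTime
  have hg : IsSolutionUpTo α γ q u₀ S (WeightedHeat.glue α γ q u₀) := fun t ht hS =>
    isSolutionUpTo_glue h t ht (hS.trans_le hle)
  have hS := le_antisymm hle (hv.maximal _ _ (isSolutionUpTo_glue h)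
    (hg.agreeUpTo h hv.isSolution))
  exact ⟨hS, hS ▸ hv.isSolution.agreeUpTo h hg⟩

end Maximal

/-! ### The lower bound for the existence time -/

section Lifespan

variable {N : ℕ} {α γ β ρ C C₀ C₁ : ℝ} {q : ℝ≥0∞}

/-- The lower bound for the existence time in terms of the size of the data. -/
theorem Estimates.exists_div_le_maxTime (h : Estimates N α γ q β ρ C C₀ C₁) :
    ∃ K : ℝ, 0 < K ∧ ∀ u₀ : EuclideanSpace ℝ (Fin N) → ℝ, MemW γ q u₀ →
      ENNReal.ofReal K / wNorm γ q u₀ ^ ((1 / α - N / 2 * (q⁻¹).toReal - γ / 2)⁻¹) ≤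
        maxTime α γ q u₀ := by
  have hα := h.pow_pos
  have hC := h.const_aux_pos
  set e := 1 / α - N / 2 * (q⁻¹).toReal - γ / 2 with he
  -- The power of `T` in the contraction constant is `α e` and the power of the data is `α`; their
  -- quotient is the exponent `1/e` of the lifespan.
  have hrate : 1 - β * (α + 1) = α * e := by
    rw [h.rate_eq, auxRate_eq hα, he]; field_simp; ring
  have hαe : 0 < α * e := by rw [← hrate]; linarith [h.rate_lt]
  have he0 : 0 < e := pos_of_mul_pos_right hαe hα.le
  set B := (betaInt β (β * (α + 1)) 0).toReal with hB
  have hB0 : 0 ≤ B := ENNReal.toReal_nonneg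
  set k := C₁ * (α + 1) * (4 * C₁) ^ α * B with hk
  have hk0 : 0 ≤ k := by positivity
  -- Solves `k T^{αe} L^α ≤ 1/2` for `T L^{1/e}`; using `k + 1` avoids division by a possibly
  -- vanishing `k`.
  refine ⟨(1 / (2 * (k + 1))) ^ (1 / (α * e)), by positivity, fun u₀ hu₀ => ?_⟩
  -- The bound itself may be infinite, so solutions are built for every finite time below it.
  refine le_of_forall_lt_imp_le_of_dense fun c hc => ?_
  rcases eq_or_ne c 0 with rfl | hc0
  · exact zero_le
  have hct : c ≠ ⊤ := hc.ne_top
  have hT : 0 < c.toReal := ENNReal.toReal_pos hc0 hct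
  set T := c.toReal with hTdef
  set L := (wNorm γ q u₀).toReal with hL
  have hL0 : 0 ≤ L := ENNReal.toReal_nonneg
  have hsmall : T ^ (α * e) * L ^ α ≤ 1 / (2 * (k + 1)) := by
    rcases hL0.eq_or_lt with h0 | h0
    · rw [← h0, Real.zero_rpow hα.ne', mul_zero]; positivity
    have h1 : T * L ^ e⁻¹ ≤ (1 / (2 * (k + 1))) ^ (1 / (α * e)) := by
      rw [← ENNReal.ofReal_toReal hct, ← ENNReal.ofReal_toReal hu₀.2.ne,
        ENNReal.ofReal_rpow_of_pos h0, ← ENNReal.ofReal_div_of_pos (by positivity)] at hc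
      rw [← le_div_iff₀ (by positivity)]
      exact (ENNReal.ofReal_lt_ofReal_iff_of_nonneg hT.le).1 hc |>.le
    have h2 := Real.rpow_le_rpow (by positivity) h1 hαe.le
    rw [Real.mul_rpow hT.le (by positivity), ← Real.rpow_mul hL0, ← Real.rpow_mul (by positivity),
      one_div_mul_cancel hαe.ne', Real.rpow_one] at h2
    have e1 : e⁻¹ * (α * e) = α := by field_simp
    rwa [e1] at h2
  obtain ⟨u, hu⟩ := h.exists_isSolutionOn hT hu₀ (by
    have e1 : contractionConst α β C₁ (2 * (C₁ * L)) T = k * (T ^ (α * e) * L ^ α) := by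
      rw [contractionConst, hrate, hk, ← hB]
      have : 2 * (2 * (C₁ * L)) = 4 * C₁ * L := by ring
      rw [this, Real.mul_rpow (by positivity) hL0]; ring
    rw [e1]
    refine (mul_le_mul_of_nonneg_left hsmall hk0).trans ?_
    rw [mul_one_div, div_le_div_iff₀ (by positivity) (by norm_num)]
    linarith)
  have := hu.ofReal_le_maxTime hT
  rwa [ENNReal.ofReal_toReal hct] at this

end Lifespan

end WeightedHeat

/-- The constant is fixed before the data. In `ℝ≥0∞` the quotient is infinite when the norm
vanishes, since the exponent is positive; this is the convention for `φ = 0`. -/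
theorem theorem1p3 (N : ℕ) (hN : 1 ≤ N) (α γ : ℝ) (q : ℝ≥0∞) (hα : 0 < α)
    (hγ : 0 < γ) (hγN : γ < N) (hγα : γ < 2 / α) (hq : 1 < q)
    (hq₁ : (q⁻¹).toReal + γ / N < 1)
    (hq₂ : N * α / 2 * (q⁻¹).toReal + α * γ / 2 < 1) :
    ∃ C : ℝ, 0 < C ∧
      ∀ φ : EuclideanSpace ℝ (Fin N) → ℝ, WeightedHeat.MemW γ q φ →
        ∀ lam : ℝ, 0 < lam →
          ∃ (Tmax : ℝ≥0∞) (u : ℝ → EuclideanSpace ℝ (Fin N) → ℝ),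
            WeightedHeat.IsMaximalSolution α γ q (fun x => lam * φ x) Tmax u ∧
            (∀ (S : ℝ≥0∞) (v : ℝ → EuclideanSpace ℝ (Fin N) → ℝ),
              WeightedHeat.IsMaximalSolution α γ q (fun x => lam * φ x) S v →
                S = Tmax ∧ WeightedHeat.AgreeUpTo Tmax v u) ∧
            ENNReal.ofReal C /
                (ENNReal.ofReal lam * WeightedHeat.wNorm γ q φ) ^
                  ((1 / α - N / 2 * (q⁻¹).toReal - γ / 2)⁻¹) ≤ Tmax := by
  obtain ⟨ρ, C, C₀, C₁, h⟩ := WeightedHeat.exists_estimates hN hα hγ hγN hq hq₁ hq₂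
  obtain ⟨K, hK, hle⟩ := h.exists_div_le_maxTime
  refine ⟨K, hK, fun φ hφ lam hlam => ?_⟩
  have hu₀ := hφ.const_mul lam
  have hbound := hle _ hu₀
  -- A nonnegative exponent keeps the denominator finite, so the lower bound is positive and so is
  -- the maximal time.
  have hexp : 0 ≤ (1 / α - N / 2 * (q⁻¹).toReal - γ / 2)⁻¹ := by
    have e1 : 1 / α - N / 2 * (q⁻¹).toReal - γ / 2 =
        (1 - (N * α / 2 * (q⁻¹).toReal + α * γ / 2)) / α := by field_simp; ring
    rw [e1]
    exact inv_nonneg.2 (div_nonneg (by linarith) hα.le)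
  have hpos : 0 < WeightedHeat.maxTime α γ q (fun x => lam * φ x) :=
    (ENNReal.div_pos (ENNReal.ofReal_pos.2 hK).ne'
      (ENNReal.rpow_ne_top_of_nonneg hexp hu₀.2.ne)).trans_le hbound
  refine ⟨_, _, WeightedHeat.isMaximalSolution_glue h hpos, fun S v hv => hv.eq_maxTime h, ?_⟩
  rwa [WeightedHeat.wNorm_const_mul, Real.enorm_of_nonneg hlam.le] at hbound
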